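/- Let $(M,g)$ be a connected smooth Riemannian manifold of dimension $m\ge 4$ and let $P\in M$. For a Riemannian manifold $\mathbb M$ containing $P$ let $r_{\mathbb M}$ be the geodesic distance to $P$, let $\iota_{\mathbb M}$ be the injectivity radius at $P$, let $B_{\mathbb M}=\{r_{\mathbb M}<\iota_{\mathbb M}\}$, let $\vec x=\exp_P(x^1e_1+\dots+x^me_m)$ be geodesic coordinates given by an orthonormal basis $e_1,\dots,e_m$ of $T_P\mathbb M$ (so that $r_{\mathbb M}(\vec x)=\|\vec x\|$), and let $\tilde\Theta_{\mathbb M}=\det\big(g(\partial_{x^i},\partial_{x^j})\big)^{1/2}$ be the volume density function at $P$ in these coordinates. A smooth function is radial if it has the form $\eta(\|\vec x\|)$ with $\eta$ a smooth even function of one variable. $\mathbb M$ is central harmonic at $P$ if $\tilde\Theta_{\mathbb M}$ is radial on $B_{\mathbb M}$, and its germ at $P$ is central harmonic if $\tilde\Theta_{\mathbb M}$ is radial near $P$. Theorem 1.2. (1) Suppose that the germ of $\mathbb M=(M,g)$ at $P$ is central harmonic, and let $\Xi$ be a smooth positive even function of one real variable, defined near $0$, with $\Xi(0)=1$. Then there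 is a radius $0<\rho\le\iota_{\mathbb M}$ and, on the geodesic ball $B=\{r_{\mathbb M}<\rho\}$, a smooth positive radial function $\psi$ such that, with $\mathbb M_\psi:=(B,\psi^2g)$, one has $B_{\mathbb M_\psi}=B$, the function $\Xi$ is defined at all values of $r_{\mathbb M_\psi}$ on $B$, and $\tilde\Theta_{\mathbb M_\psi}=\Xi(r_{\mathbb M_\psi})$ on $B$. (2) If $\mathbb M$ is central harmonic at $P$ and $\Xi\equiv1$, then $\psi$ can be defined on all of $B_{\mathbb M}$: there is a smooth positive radial function $\psi$ on $B_{\mathbb M}$ such that, with $\mathbb M_\psi:=(B_{\mathbb M},\psi^2g)$, one has $B_{\mathbb M_\psi}=B_{\mathbb M}$ and $\tilde\Theta_{\mathbb M_\psi}\equiv1$ on $B_{\mathbb M}$. (3) If the manifold $M$, the metric $g$ and (in case (1)) $\Xi$ near $0$ are real analytic, then the function $\psi$ in (1) and in (2) can in addition be chosen to be real analytic. -/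

import Mathlib

open Set Bundle
open scoped Manifold ContDiff Topology ENNReal

noncomputable section

namespace RadialConformal

/-- The model space `ℝ^m` with its Euclidean norm. -/
abbrev Eu (m : ℕ) : Type := EuclideanSpace ℝ (Fin m)

/-- A field of bilinear forms on the tangent spaces of an `m`-dimensional manifold `M`.

Below, a Riemannian manifold is given by a pair `(U, g)`: `U` is an open subset of `M`, and `g` is
such a field which is a smooth Riemannian metric on `U`. The values of `g` outside `U` play no
role: all curves are required to stay in `U`. The case `U = univ` is that of `M` itself. -/
abbrev FormField (m : ℕ) (M : Type*) [TopologicalSpace M] [ChartedSpace (Eu m) M] : Type _ :=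
  ∀ p : M, TangentSpace (𝓡 m) p →L[ℝ] TangentSpace (𝓡 m) p →L[ℝ] ℝ

section

variable {m : ℕ} {M : Type*} [TopologicalSpace M] [ChartedSpace (Eu m) M]

/-- The conformal deformation `ψ² g`. -/
def conformal (ψ : M → ℝ) (g : FormField m M) : FormField m M :=
  fun p ↦ (ψ p) ^ 2 • g p

/-- The length of a tangent vector. -/
def tnorm (g : FormField m M) (p : M) (v : TangentSpace (𝓡 m) p) : ℝ :=
  √(g p v v)

/-- The coefficients of the metric in the preferred chart at `p`: `coordMetric g p y u v` is
`G(u, v)` at the coordinate `y`, where `G` is the pullback of `g` by the inverse of the chart. -/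
def coordMetric (g : FormField m M) (p : M) (y u v : Eu m) : ℝ :=
  g ((extChartAt (𝓡 m) p).symm y)
    (mfderiv (𝓡 m) (𝓡 m) (extChartAt (𝓡 m) p).symm y u)
    (mfderiv (𝓡 m) (𝓡 m) (extChartAt (𝓡 m) p).symm y v)

/-- The Christoffel symbols of the first kind in the preferred chart at `p`:
`Γ(u, v; w) = (D_u G(v, w) + D_v G(u, w) - D_w G(u, v)) / 2`. -/
def christoffel (g : FormField m M) (p : M) (y u v w : Eu m) : ℝ :=
  (fderiv ℝ (fun z ↦ coordMetric g p z v w) y u + fderiv ℝ (fun z ↦ coordMetric g p z u w) y v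
    - fderiv ℝ (fun z ↦ coordMetric g p z u v) y w) / 2

/-- The expression of the curve `γ` in the preferred chart at `p`. -/
def coordCurve (p : M) (γ : ℝ → M) (t : ℝ) : Eu m :=
  extChartAt (𝓡 m) p (γ t)

/-- `γ` is a geodesic of `(U, g)` on the open set `J` of times: it is a `C²` curve in `U` which, in
the preferred chart at any point, satisfies the geodesic equation (with the index lowered by the
metric) `G(c'', w) + Γ(c', c'; w) = 0` for all `w`, where `c` is the expression of `γ` in it. -/
structure IsGeodesicOn (U : Set M) (g : FormField m M) (γ : ℝ → M) (J : Set ℝ) : Prop where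
  mapsTo : MapsTo γ J U
  contMDiffOn : ContMDiffOn 𝓘(ℝ, ℝ) (𝓡 m) 2 γ J
  equation : ∀ t ∈ J, ∀ p : M, γ t ∈ (chartAt (Eu m) p).source → ∀ w : Eu m,
    coordMetric g p (coordCurve p γ t) (deriv (deriv (coordCurve p γ)) t) w
      + christoffel g p (coordCurve p γ t) (deriv (coordCurve p γ) t)
          (deriv (coordCurve p γ) t) w = 0

/-- `γ` is a geodesic of `(U, g)`, defined on an open interval containing `[0, 1]`, with
`γ(0) = P` and `γ'(0) = v`. (All the tangent spaces are the same type; since `γ 0 = P`, the last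
equation is one in the tangent space at `P`.) -/
def IsGeodesicFrom (U : Set M) (g : FormField m M) (P : M) (v : TangentSpace (𝓡 m) P)
    (γ : ℝ → M) : Prop :=
  (∃ ε > 0, IsGeodesicOn U g γ (Ioo (-ε) (1 + ε))) ∧ γ 0 = P ∧
    (mfderiv 𝓘(ℝ, ℝ) (𝓡 m) γ 0 (1 : ℝ) : Eu m) = v

open Classical in
/-- The exponential map of `(U, g)` at `P`, with value `P` at the vectors where it is undefined. -/
def expMap (U : Set M) (g : FormField m M) (P : M) (v : TangentSpace (𝓡 m) P) : M :=
  if h : ∃ γ : ℝ → M, IsGeodesicFrom U g P v γ then h.choose 1 else P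

/-- `f` restricts to a smooth diffeomorphism from the open set `s` onto an open set. -/
def IsDiffeoOnto (f : Eu m → M) (s : Set (Eu m)) : Prop :=
  IsOpen s ∧ IsOpen (f '' s) ∧ ContMDiffOn (𝓡 m) (𝓡 m) ∞ f s ∧
    ∃ h : M → Eu m, ContMDiffOn (𝓡 m) (𝓡 m) ∞ h (f '' s) ∧ ∀ v ∈ s, h (f v) = v

/-- The open ball of radius `R` about the origin of the tangent space at `P`. -/
def tangentBall (g : FormField m M) (P : M) (R : ℝ≥0∞) : Set (Eu m) :=
  {v | ENNReal.ofReal (tnorm g P v) < R}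

/-- The injectivity radius of `(U, g)` at `P`: the supremum of all `R` such that the exponential
map is defined on the ball of radius `R` and is a diffeomorphism from it onto its image. -/
def injRadius (U : Set M) (g : FormField m M) (P : M) : ℝ≥0∞ :=
  sSup {R : ℝ≥0∞ | (∀ v ∈ tangentBall g P R, ∃ γ : ℝ → M, IsGeodesicFrom U g P v γ) ∧
    IsDiffeoOnto (fun v : Eu m ↦ expMap U g P v) (tangentBall g P R)}

/-- The geodesic distance of `(U, g)`: the infimum of the lengths of the `C¹` curves in `U` which
join the two points. -/
def geodDist (U : Set M) (g : FormField m M) (P Q : M) : ℝ≥0∞ :=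
  ⨅ (γ : ℝ → M) (_ : ContMDiffOn 𝓘(ℝ, ℝ) (𝓡 m) 1 γ (Icc 0 1) ∧ MapsTo γ (Icc 0 1) U ∧
      γ 0 = P ∧ γ 1 = Q),
    ∫⁻ t in Ioo (0 : ℝ) 1, ENNReal.ofReal (tnorm g (γ t) (mfderiv 𝓘(ℝ, ℝ) (𝓡 m) γ t (1 : ℝ)))

/-- The open geodesic ball of radius `R` about `P` in `(U, g)`. -/
def geodBall (U : Set M) (g : FormField m M) (P : M) (R : ℝ≥0∞) : Set M :=
  {Q ∈ U | geodDist U g P Q < R}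

/-- `e` is an orthonormal basis of the tangent space at `P`. -/
def IsOrthoFrame (g : FormField m M) (P : M) (e : Fin m → TangentSpace (𝓡 m) P) : Prop :=
  ∀ i j, g P (e i) (e j) = if i = j then 1 else 0

/-- The parametrization by geodesic coordinates centered at `P`:
`x ↦ exp_P (x¹ e₁ + ⋯ + x^m e_m)`. -/
def normalCoord (U : Set M) (g : FormField m M) (P : M) (e : Fin m → TangentSpace (𝓡 m) P)
    (x : Eu m) : M :=
  expMap U g P (∑ i, x i • e i)

/-- The volume density function `det(g_{ij})^{1/2}`, where `g_{ij} = g(∂_{x^i}, ∂_{x^j})` in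
geodesic coordinates centered at `P`. -/
def volDensity (U : Set M) (g : FormField m M) (P : M) (e : Fin m → TangentSpace (𝓡 m) P)
    (x : Eu m) : ℝ :=
  √(Matrix.det (Matrix.of fun i j : Fin m ↦
    g (normalCoord U g P e x)
      (mfderiv (𝓡 m) (𝓡 m) (normalCoord U g P e) x (EuclideanSpace.single i (1 : ℝ) : Eu m))
      (mfderiv (𝓡 m) (𝓡 m) (normalCoord U g P e) x (EuclideanSpace.single j (1 : ℝ) : Eu m))))

/-- `F`, a function given in geodesic coordinates `x` centered at `P` for every choice `e` of the
orthonormal basis defining them, is a smooth radial function on the ball of radius `ρ`: there it is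
of the form `η(‖x‖)`, for a smooth even function `η` of one variable. -/
def IsRadialOn (g : FormField m M) (P : M) (ρ : ℝ≥0∞)
    (F : (Fin m → TangentSpace (𝓡 m) P) → Eu m → ℝ) : Prop :=
  ∃ η : ℝ → ℝ, ContDiffOn ℝ ∞ η {t | ‖t‖ₑ < ρ} ∧ (∀ t, ‖t‖ₑ < ρ → η (-t) = η t) ∧
    ∀ e, IsOrthoFrame g P e → ∀ x, ‖x‖ₑ < ρ → F e x = η ‖x‖

/-- `(U, g)` is central harmonic at `P`: the volume density function is radial on the ball whose
radius is the injectivity radius. -/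
def IsCentralHarmonic (U : Set M) (g : FormField m M) (P : M) : Prop :=
  IsRadialOn g P (injRadius U g P) (volDensity U g P)

/-- The germ of `(U, g)` at `P` is central harmonic: the volume density function is radial near
`P`. -/
def IsCentralHarmonicGerm (U : Set M) (g : FormField m M) (P : M) : Prop :=
  ∃ ρ > 0, IsRadialOn g P ρ (volDensity U g P)

/-- `ψ` is a smooth positive radial function on the open geodesic ball `B` of radius `ρ` about `P`
in `(M, g)`, the injectivity ball about `P` of the Riemannian manifold `(B, ψ² g)` is all of `B`,
and the volume density function of `(B, ψ² g)` at `P` equals `Ξ` of the geodesic distance to `P` in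
`(B, ψ² g)`. -/
structure PrescribesDensity (g : FormField m M) (P : M) (ρ : ℝ≥0∞) (Ξ : ℝ → ℝ) (ψ : M → ℝ) :
    Prop where
  smooth : ContMDiffOn (𝓡 m) 𝓘(ℝ, ℝ) ∞ ψ (geodBall univ g P ρ)
  pos : ∀ Q ∈ geodBall univ g P ρ, 0 < ψ Q
  radial : IsRadialOn g P ρ (fun e x ↦ ψ (normalCoord univ g P e x))
  ball_eq :
    geodBall (geodBall univ g P ρ) (conformal ψ g) P
      (injRadius (geodBall univ g P ρ) (conformal ψ g) P) = geodBall univ g P ρ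
  density : ∀ e, IsOrthoFrame (conformal ψ g) P e →
    ∀ x : Eu m, ‖x‖ₑ < injRadius (geodBall univ g P ρ) (conformal ψ g) P →
      volDensity (geodBall univ g P ρ) (conformal ψ g) P e x =
        Ξ (geodDist (geodBall univ g P ρ) (conformal ψ g) P
          (normalCoord (geodBall univ g P ρ) (conformal ψ g) P e x)).toReal

end

/-- The Riemannian manifold `(M, g)` is real analytic: both the manifold and the metric are. -/
def IsRealAnalytic {m : ℕ} {M : Type*} [TopologicalSpace M] [ChartedSpace (Eu m) M]
    [IsManifold (𝓡 m) ∞ M] (g : FormField m M) : Prop :=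
  IsManifold (𝓡 m) ω M ∧
    ContMDiff (𝓡 m) ((𝓡 m).prod 𝓘(ℝ, Eu m →L[ℝ] Eu m →L[ℝ] ℝ)) ω
      (fun p : M ↦ TotalSpace.mk' (Eu m →L[ℝ] Eu m →L[ℝ] ℝ)
        (E := fun p : M ↦ TangentSpace (𝓡 m) p →L[ℝ] TangentSpace (𝓡 m) p →L[ℝ] ℝ) p (g p))

end RadialConformal

end

open RadialConformal

/-! Let r be the distance to P, let l = m - 1, and let η be the radial profile of the density of g.
By the Gauss lemma, geodesic coordinates split off dr². Hence for ψ = h'(r), with h odd, increasing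
and h'(0) = 1, the rays from P stay geodesics up to parametrization and the new distance to P is s =
h(r). Comparing volume elements, ψ^m η r^l dr = Θ s^l ds with ds = h' dr, so the new density Θ
equals Ξ(s) when h'^l η r^l = Ξ(h) h^l.

After taking l-th roots this equation separates. If β'/β = 1/(r η^(1/l)) and α'/α = 1/(s Ξ^(1/l)),
then h = α⁻¹ ∘ β is a solution. Both singular equations have the odd solution t exp(∫ G), with
derivative 1 at 0 and as regular as the data (`exists_odd_solution`). The composite makes sense only
where β takes values in the range of α, so the radius may have to shrink in (1)
(`exists_isProfile`). For Ξ = 1 the function α is the identity and nothing shrinks, which is (2)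
(`exists_isProfile_one`).

On the geometric side, if N gives geodesic coordinates for g, then N ∘ κ gives them for ψ² g, where
κ(x) = q(‖x‖) x and t q(t) is the inverse function of h (`IsNormalParam.conformal`). The Gauss lemma
identifies the geodesic distance with the norm of the coordinates (`IsNormalParam.geodDist_eq`).
Since the new coordinates fill the whole ball B, their radius is exactly the new injectivity radius
(`IsNormalParam.injRadius_eq_of_image_eq`). The determinant of the derivative of κ then turns the
equation for h into the formula for the density (`prescribesDensity_of_isProfile`).

The smooth and the real analytic cases run in parallel, with n = ∞ or n = ω. This needs C^n
dependence of solutions of differential equations on initial values (`exists_local_flow`, by the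
implicit function theorem in a space of curves), a C^n exponential map wherever it is defined
(`HasGeod.expSmoothNear`), and the fact that f(‖x‖) is C^n when f is even and C^n
(`contDiffOn_radial`). -/

namespace RadialConformal

set_option linter.unusedSectionVars false
set_option synthInstance.maxHeartbeats 200000

universe u

/-! ### Superposition operators on spaces of continuous functions -/

section Superposition

variable {K : Type*} [TopologicalSpace K] [CompactSpace K]

open Classical in
/-- The superposition operator `u ↦ f ∘ u` on spaces of continuous functions, with value `0` where
`f ∘ u` is not continuous. -/
noncomputable def superpose {E F : Type*} [TopologicalSpace E] [TopologicalSpace F] [Zero F]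
    (f : E → F) (u : C(K, E)) : C(K, F) :=
  if h : Continuous (f ∘ u) then ⟨f ∘ u, h⟩ else 0

theorem superpose_apply {E F : Type*} [TopologicalSpace E] [TopologicalSpace F] [Zero F]
    {f : E → F} {Ω : Set E} (hf : ContinuousOn f Ω) {u : C(K, E)} (hu : ∀ t, u t ∈ Ω) (t : K) :
    superpose f u t = f (u t) := by
  have h : Continuous (f ∘ u) := hf.comp_continuous u.continuous hu
  simp [superpose, h]

theorem isOpen_setOf_forall_mem {E : Type*} [TopologicalSpace E] {Ω : Set E} (hΩ : IsOpen Ω) :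
    IsOpen {u : C(K, E) | ∀ t, u t ∈ Ω} := by
  simpa [MapsTo] using ContinuousMap.isOpen_setOfPred_mapsTo (isCompact_univ (X := K)) hΩ

variable {E F : Type*} [NormedAddCommGroup E] [NormedSpace ℝ E]
  [NormedAddCommGroup F] [NormedSpace ℝ F]

/-- Pointwise application of a continuous family of linear maps, as a linear map. -/
noncomputable def pointwiseApplyLin (A : C(K, E →L[ℝ] F)) : C(K, E) →L[ℝ] C(K, F) :=
  LinearMap.mkContinuous
    { toFun := fun h ↦ (⟨fun t ↦ A t (h t), by fun_prop⟩ : C(K, F))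
      map_add' := fun _ _ ↦ by ext; simp
      map_smul' := fun _ _ ↦ by ext; simp } ‖A‖ (by
    intro h
    refine (ContinuousMap.norm_le _ (by positivity)).2 fun t ↦ ?_
    exact (A t).le_of_opNorm_le_of_le (A.norm_coe_le_norm t) (h.norm_coe_le_norm t))

theorem norm_pointwiseApplyLin_le (A : C(K, E →L[ℝ] F)) : ‖pointwiseApplyLin A‖ ≤ ‖A‖ :=
  LinearMap.mkContinuous_norm_le _ (norm_nonneg A) _

/-- Pointwise application of a continuous family of linear maps. -/
noncomputable def pointwiseApply : C(K, E →L[ℝ] F) →L[ℝ] (C(K, E) →L[ℝ] C(K, F)) :=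
  LinearMap.mkContinuous (𝕜 := ℝ) (σ := RingHom.id ℝ)
    { toFun := fun A ↦ pointwiseApplyLin (K := K) (E := E) (F := F) A
      map_add' := fun _ _ ↦ ContinuousLinearMap.ext fun _ ↦ ContinuousMap.ext fun _ ↦ rfl
      map_smul' := fun _ _ ↦ ContinuousLinearMap.ext fun _ ↦ ContinuousMap.ext fun _ ↦ rfl } 1
    (fun A ↦ (norm_pointwiseApplyLin_le A).trans (one_mul ‖A‖).ge)

@[simp] theorem pointwiseApply_apply (A : C(K, E →L[ℝ] F)) (h : C(K, E)) (t : K) :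
    pointwiseApply A h t = A t (h t) := rfl

/-- Strict differentiability of f at u(t) bounds the remainder for all times near t, and compactness
of K makes the bound uniform in t, as the supremum norm requires. -/
theorem hasFDerivAt_superpose {f : E → F} {Ω : Set E} (hΩ : IsOpen Ω) (hf : ContDiffOn ℝ 1 f Ω)
    {u : C(K, E)} (hu : ∀ t, u t ∈ Ω) :
    HasFDerivAt (superpose (K := K) f) (pointwiseApply (superpose (fderiv ℝ f) u)) u := by
  have hf' : ContinuousOn (fderiv ℝ f) Ω := hf.continuousOn_fderiv_of_isOpen hΩ le_rfl
  rw [hasFDerivAt_iff_isLittleO_nhds_zero, Asymptotics.isLittleO_iff]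
  intro ε hε
  have key : ∀ t ∈ (univ : Set K), ∀ᶠ q : E × K in 𝓝 (0, t),
      ‖f (u q.2 + q.1) - f (u q.2) - fderiv ℝ f (u q.2) q.1‖ ≤ ε * ‖q.1‖ := by
    intro t _
    have hs : HasStrictFDerivAt f (fderiv ℝ f (u t)) (u t) :=
      (hf.contDiffAt (hΩ.mem_nhds (hu t))).hasStrictFDerivAt (by simp)
    have h1 := hs.isLittleO.def (half_pos hε)
    have hcont : Filter.Tendsto (fun q : E × K ↦ (u q.2 + q.1, u q.2)) (𝓝 (0, t))
        (𝓝 (u t, u t)) := by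
      have : Continuous (fun q : E × K ↦ (u q.2 + q.1, u q.2)) := by fun_prop
      simpa using this.tendsto (0, t)
    have h2 := hcont.eventually h1
    have h3 : ∀ᶠ q : E × K in 𝓝 (0, t), ‖fderiv ℝ f (u q.2) - fderiv ℝ f (u t)‖ < ε / 2 := by
      have hc : ContinuousAt (fun q : E × K ↦ fderiv ℝ f (u q.2)) (0, t) :=
        ContinuousAt.comp (f := fun q : E × K ↦ u q.2)
          (hf'.continuousAt (hΩ.mem_nhds (hu t))) (by fun_prop)
      have := hc.tendsto.eventually (Metric.ball_mem_nhds _ (half_pos hε))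
      simpa [dist_eq_norm] using this
    filter_upwards [h2, h3] with q hq2 hq3
    have e : f (u q.2 + q.1) - f (u q.2) - fderiv ℝ f (u q.2) q.1
        = (f (u q.2 + q.1) - f (u q.2) - fderiv ℝ f (u t) (u q.2 + q.1 - u q.2))
          - (fderiv ℝ f (u q.2) - fderiv ℝ f (u t)) q.1 := by
      simp
    rw [e]
    refine (norm_sub_le _ _).trans ?_
    have h4 := (fderiv ℝ f (u q.2) - fderiv ℝ f (u t)).le_of_opNorm_le hq3.le q.1
    simp only [add_sub_cancel_left] at hq2 ⊢
    linarith
  have hall := (isCompact_univ (X := K)).eventually_forall_of_forall_eventually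
    (P := fun (w : E) (t : K) ↦ ‖f (u t + w) - f (u t) - fderiv ℝ f (u t) w‖ ≤ ε * ‖w‖) key
  obtain ⟨δ, hδ, hball⟩ := Metric.eventually_nhds_iff.1 hall
  have hmem : ∀ᶠ h : C(K, E) in 𝓝 0, ∀ t, (u + h) t ∈ Ω := by
    have := (isOpen_setOf_forall_mem (K := K) hΩ).mem_nhds (x := u + 0) (by simpa using hu)
    exact ((continuous_const_add u).tendsto 0).eventually this
  filter_upwards [Metric.ball_mem_nhds (0 : C(K, E)) hδ, hmem] with h hh hm
  refine (ContinuousMap.norm_le _ (by positivity)).2 fun t ↦ ?_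
  have ht : ‖h t‖ < δ := (h.norm_coe_le_norm t).trans_lt (by simpa using hh)
  have := hball (y := h t) (by simpa using ht) t (mem_univ t)
  simp only [ContinuousMap.sub_apply, pointwiseApply_apply,
    superpose_apply hf.continuousOn hm, superpose_apply hf.continuousOn hu,
    superpose_apply hf' hu]
  exact this.trans (by gcongr; exact h.norm_coe_le_norm t)

/-- The derivative of u ↦ f ∘ u is pointwise application of f' ∘ u, so the induction passes from f
to f'. The spaces are quantified inside the induction, and in one universe, because f' takes values
in `E →L[ℝ] F`. -/
theorem contDiffOn_superpose_nat (k : ℕ) :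
    ∀ {E F : Type u} [NormedAddCommGroup E] [NormedSpace ℝ E] [NormedAddCommGroup F]
      [NormedSpace ℝ F] {f : E → F} {Ω : Set E} (_ : IsOpen Ω) (_ : ContDiffOn ℝ k f Ω),
      ContDiffOn ℝ k (superpose (K := K) f) {u | ∀ t, u t ∈ Ω} := by
  induction k with
  | zero =>
    intro E F _ _ _ _ f Ω hΩ hf
    rw [CharP.cast_eq_zero, contDiffOn_zero] at hf ⊢
    intro u hu
    refine ContinuousAt.continuousWithinAt ?_
    rw [Metric.continuousAt_iff']
    intro ε hε
    have key : ∀ t ∈ (univ : Set K), ∀ᶠ q : C(K, E) × K in 𝓝 (u, t),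
        dist (f (q.1 q.2)) (f (u q.2)) < ε / 2 := by
      intro t _
      have hft := hf.continuousAt (hΩ.mem_nhds (hu t))
      have hc1 : ContinuousAt (fun q : C(K, E) × K ↦ f (q.1 q.2)) (u, t) :=
        ContinuousAt.comp (f := fun q : C(K, E) × K ↦ q.1 q.2) hft (by fun_prop)
      have hc2 : ContinuousAt (fun q : C(K, E) × K ↦ f (u q.2)) (u, t) :=
        ContinuousAt.comp (f := fun q : C(K, E) × K ↦ u q.2) hft (by fun_prop)
      have h3 := (Filter.Tendsto.dist hc1 hc2).eventually
        (eventually_lt_nhds (b := ε / 2) (by simpa using hε))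
      exact h3
    have hall := (isCompact_univ (X := K)).eventually_forall_of_forall_eventually
      (P := fun (v : C(K, E)) (t : K) ↦ dist (f (v t)) (f (u t)) < ε / 2) key
    filter_upwards [hall, (isOpen_setOf_forall_mem hΩ).mem_nhds hu] with v hv hv'
    refine lt_of_le_of_lt ?_ (half_lt_self hε)
    refine (ContinuousMap.dist_le (half_pos hε).le).2 fun t ↦ ?_
    rw [superpose_apply hf hv', superpose_apply hf hu]
    exact (hv t (mem_univ t)).le
  | succ k ih =>
    intro E F _ _ _ _ f Ω hΩ hf
    have hf1 : ContDiffOn ℝ 1 f Ω := hf.of_le (by norm_cast; omega)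
    have hop := isOpen_setOf_forall_mem (K := K) hΩ
    push_cast at hf ⊢
    rw [contDiffOn_succ_iff_hasFDerivWithinAt_of_uniqueDiffOn hop.uniqueDiffOn]
    refine ⟨by simp, fun u ↦ pointwiseApply (superpose (fderiv ℝ f) u), ?_, fun u hu ↦
      (hasFDerivAt_superpose hΩ hf1 hu).hasFDerivWithinAt⟩
    rw [contDiffOn_succ_iff_fderiv_of_isOpen hΩ] at hf
    exact pointwiseApply.contDiff.comp_contDiffOn (ih hΩ hf.2.2)

theorem contDiffOn_superpose_infty {E F : Type u} [NormedAddCommGroup E] [NormedSpace ℝ E]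
    [NormedAddCommGroup F] [NormedSpace ℝ F] {f : E → F} {Ω : Set E} (hΩ : IsOpen Ω)
    (hf : ContDiffOn ℝ ∞ f Ω) :
    ContDiffOn ℝ ∞ (superpose (K := K) f) {u | ∀ t, u t ∈ Ω} := by
  rw [contDiffOn_infty] at hf ⊢
  exact fun k ↦ contDiffOn_superpose_nat k hΩ (hf k)

/-- A multilinear map acting pointwise on continuous functions. -/
noncomputable def pointwiseMultilinear {k : ℕ} (p : E [×k]→L[ℝ] F) : C(K, E) [×k]→L[ℝ] C(K, F) :=
  MultilinearMap.mkContinuous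
    { toFun := fun h ↦ (⟨fun t ↦ p fun i ↦ h i t, by fun_prop⟩ : C(K, F))
      map_update_add' := fun h i x y ↦ by
        ext t
        have e : ∀ z : C(K, E), (fun j ↦ Function.update h i z j t)
            = Function.update (fun j ↦ h j t) i (z t) := by
          intro z; ext j; by_cases hj : j = i
          · subst hj; simp
          · simp [hj]
        simp [e]
      map_update_smul' := fun h i c x ↦ by
        ext t
        have e : ∀ z : C(K, E), (fun j ↦ Function.update h i z j t)
            = Function.update (fun j ↦ h j t) i (z t) := by
          intro z; ext j; by_cases hj : j = i
          · subst hj; simp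
          · simp [hj]
        simp [e] } ‖p‖ (by
    intro h
    refine (ContinuousMap.norm_le _ (by positivity)).2 fun t ↦ ?_
    refine (p.le_opNorm _).trans ?_
    gcongr with i
    exact (h i).norm_coe_le_norm t)

theorem norm_pointwiseMultilinear_le {k : ℕ} (p : E [×k]→L[ℝ] F) :
    ‖pointwiseMultilinear (K := K) p‖ ≤ ‖p‖ :=
  MultilinearMap.mkContinuous_norm_le _ (norm_nonneg _) _

/-- The Taylor coefficients of f at x act pointwise with no larger norms, so their series converges
on at least the same ball. The centre is a constant function because one expansion of f has to serve
for all t. -/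
theorem analyticAt_superpose [CompleteSpace F] {f : E → F} {x : E} (hf : AnalyticAt ℝ f x) :
    AnalyticAt ℝ (superpose (K := K) f) (ContinuousMap.const K x) := by
  obtain ⟨p, r, hp⟩ := hf
  let P : FormalMultilinearSeries ℝ C(K, E) C(K, F) := fun k ↦ pointwiseMultilinear (p k)
  have hr : r ≤ P.radius := by
    refine hp.r_le.trans ?_
    refine ENNReal.le_of_forall_nnreal_lt fun s hs ↦ ?_
    obtain ⟨C, _, hC⟩ := p.norm_mul_pow_le_of_lt_radius hs
    refine P.le_radius_of_bound C fun k ↦ ?_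
    refine le_trans ?_ (hC k)
    gcongr
    exact norm_pointwiseMultilinear_le _
  refine ⟨P, r, hr, hp.r_pos, ?_⟩
  · intro h hh
    have hcont : ContinuousOn f (Metric.eball x r) := hp.continuousOn
    have hh' : ‖h‖ₑ < r := by simpa using hh
    have ht : ∀ t, ‖h t‖ₑ ≤ ‖h‖ₑ := fun t ↦ by
      rw [enorm_le_iff_norm_le]; exact h.norm_coe_le_norm t
    have hmem : ∀ t, (ContinuousMap.const K x + h) t ∈ Metric.eball x r := fun t ↦ by
      simpa [edist_eq_enorm_sub] using (ht t).trans_lt hh'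
    have hs : Summable fun k ↦ ‖P k fun _ ↦ h‖ :=
      P.summable_norm_apply (Metric.eball_subset_eball hr hh)
    have hsum : Summable fun k ↦ P k fun _ ↦ h := hs.of_norm
    have e : superpose f (ContinuousMap.const K x + h) = ∑' k, P k fun _ ↦ h := by
      ext t
      rw [superpose_apply hcont hmem]
      have h1 := hsum.hasSum.map (ContinuousMap.evalCLM ℝ t) (ContinuousMap.evalCLM ℝ t).continuous
      have h2 := hp.hasSum (y := h t) (by simpa using (ht t).trans_lt hh')
      exact h2.unique h1
    rw [e]
    exact hsum.hasSum

/-- The common form of the two cases. Only functions near a constant are needed: short pieces of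
solutions, or short segments, are nearly constant. -/
theorem eventually_contDiffAt_superpose {E F : Type u} [NormedAddCommGroup E] [NormedSpace ℝ E]
    [NormedAddCommGroup F] [NormedSpace ℝ F] [CompleteSpace F] {n : WithTop ℕ∞}
    (hn : n = (∞ : WithTop ℕ∞) ∨ n = ω) {f : E → F} {Ω : Set E} (hΩ : IsOpen Ω)
    (hf : ContDiffOn ℝ n f Ω) {x : E} (hx : x ∈ Ω) :
    ∀ᶠ u in 𝓝 (ContinuousMap.const K x), ContDiffAt ℝ n (superpose (K := K) f) u := by
  rcases hn with rfl | rfl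
  · have hop := isOpen_setOf_forall_mem (K := K) hΩ
    filter_upwards [hop.mem_nhds (x := ContinuousMap.const K x) (by simpa using fun _ ↦ hx)]
      with u hu
    exact (contDiffOn_superpose_infty hΩ hf).contDiffAt (hop.mem_nhds hu)
  · exact (analyticAt_superpose (hf.contDiffAt (hΩ.mem_nhds hx)).analyticAt).contDiffAt.eventually
      (by simp)

end Superposition

/-! ### Regular dependence of solutions of differential equations on initial values -/

section Flow

/-- `ContDiffAt` of order ∞ at one point does not spread to nearby points. So the implicit function
theorem is applied again at each nearby point of the graph, and local uniqueness identifies the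
implicit function found there with the first one. -/
theorem eventually_contDiffAt_implicitFunction {E₁ E₂ F : Type*} [NormedAddCommGroup E₁]
    [NormedSpace ℝ E₁] [CompleteSpace E₁] [NormedAddCommGroup E₂] [NormedSpace ℝ E₂]
    [CompleteSpace E₂] [NormedAddCommGroup F] [NormedSpace ℝ F] [CompleteSpace F]
    {n : WithTop ℕ∞} (hn : 1 ≤ n) {f : E₁ × E₂ → F} {p : E₁ × E₂}
    (hf : ∀ᶠ q in 𝓝 p, ContDiffAt ℝ n f q)
    (hi : (fderiv ℝ f p ∘L .inr ℝ E₁ E₂).IsInvertible) :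
    ∃ ψ : E₁ → E₂, ψ p.1 = p.2 ∧ ∀ᶠ z in 𝓝 p.1, ContDiffAt ℝ n ψ z ∧ f (z, ψ z) = f p := by
  have hn0 : n ≠ 0 := (zero_lt_one.trans_le hn).ne'
  have cdf := hf.self_of_nhds
  refine ⟨cdf.implicitFunction hn0 hi, cdf.implicitFunction_apply_self hn0 hi, ?_⟩
  set ψ := cdf.implicitFunction hn0 hi with hψ
  have hψp : ψ p.1 = p.2 := cdf.implicitFunction_apply_self hn0 hi
  have hψc : ContDiffAt ℝ n ψ p.1 := cdf.contDiffAt_implicitFunction hn0 hi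
  have hinv : ∀ᶠ q in 𝓝 p, (fderiv ℝ f q ∘L .inr ℝ E₁ E₂).IsInvertible := by
    have hc : ContinuousAt (fun q ↦ fderiv ℝ f q ∘L .inr ℝ E₁ E₂) p :=
      (cdf.continuousAt_fderiv hn0).clm_comp continuousAt_const
    obtain ⟨e, he⟩ := hi
    have := hc.tendsto.eventually (he ▸ ContinuousLinearEquiv.nhds e)
    filter_upwards [this] with q hq
    obtain ⟨e', he'⟩ := hq
    exact ⟨e', he'⟩
  have hiff := (cdf.eventually_apply_eq_iff_implicitFunction hn0 hi).eventually_nhds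
  have hlim : Filter.Tendsto (fun z ↦ (z, ψ z)) (𝓝 p.1) (𝓝 p) := by
    have : ContinuousAt (fun z ↦ (z, ψ z)) p.1 := continuousAt_id.prodMk hψc.continuousAt
    simpa [ContinuousAt, hψp] using this
  filter_upwards [hlim.eventually hf, hlim.eventually hinv, hlim.eventually hiff,
    cdf.eventually_apply_implicitFunction hn0 hi] with z h1 h2 h3 h4
  refine ⟨?_, h4⟩
  have hψ'c := h1.contDiffAt_implicitFunction hn0 h2
  have hψ'z := h1.implicitFunction_apply_self hn0 h2
  have h5 := h1.eventually_apply_implicitFunction hn0 h2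
  refine hψ'c.congr_of_eventuallyEq ?_
  have hlim' : Filter.Tendsto (fun z' ↦ (z', h1.implicitFunction hn0 h2 z')) (𝓝 z)
      (𝓝 (z, ψ z)) := by
    have : ContinuousAt (fun z' ↦ (z', h1.implicitFunction hn0 h2 z')) z :=
      continuousAt_id.prodMk hψ'c.continuousAt
    simpa [ContinuousAt, hψ'z] using this
  filter_upwards [hlim'.eventually h3, h5] with z' h6 h7
  exact h6.1 (h7.trans h4)

/-- The primitive vanishing at `0` of a continuous function on `[-1, 2]`. -/
noncomputable def primitive {F : Type u} [NormedAddCommGroup F] [NormedSpace ℝ F] :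
    C(Icc (-1 : ℝ) 2, F) →L[ℝ] C(Icc (-1 : ℝ) 2, F) :=
  LinearMap.mkContinuous
    { toFun := fun u ↦ ⟨fun t ↦ ∫ τ in (0 : ℝ)..t, u (projIcc (-1) 2 (by norm_num) τ), by
        refine (intervalIntegral.continuous_primitive (fun a b ↦ ?_) 0).comp
          continuous_subtype_val
        exact (u.continuous.comp continuous_projIcc).intervalIntegrable a b⟩
      map_add' := fun u v ↦ by
        ext t
        exact intervalIntegral.integral_add
          ((u.continuous.comp continuous_projIcc).intervalIntegrable _ _)
          ((v.continuous.comp continuous_projIcc).intervalIntegrable _ _)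
      map_smul' := fun c u ↦ by
        ext t
        exact intervalIntegral.integral_smul c _ } 2 (by
    intro u
    refine (ContinuousMap.norm_le _ (by positivity)).2 fun t ↦ ?_
    have := intervalIntegral.norm_integral_le_of_norm_le_const (a := 0) (b := (t : ℝ))
      (C := ‖u‖) (f := fun τ ↦ u (projIcc (-1) 2 (by norm_num) τ))
      (fun τ _ ↦ u.norm_coe_le_norm _)
    refine this.trans ?_
    rw [mul_comm]
    gcongr
    rw [sub_zero, abs_le]
    constructor <;> linarith [t.2.1, t.2.2])

theorem primitive_apply {F : Type u} [NormedAddCommGroup F] [NormedSpace ℝ F]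
    (u : C(Icc (-1 : ℝ) 2, F)) (t : Icc (-1 : ℝ) 2) :
    primitive u t = ∫ τ in (0 : ℝ)..t, u (projIcc (-1) 2 (by norm_num) τ) := rfl

/-- Local solutions of an autonomous smooth or analytic differential equation depend smoothly or
analytically on the initial value. -/
theorem exists_local_flow {F : Type u} [NormedAddCommGroup F] [NormedSpace ℝ F] [CompleteSpace F]
    {n : WithTop ℕ∞} (hn : n = (∞ : WithTop ℕ∞) ∨ n = ω) {f : F → F} {Ω : Set F} (hΩ : IsOpen Ω)
    (hf : ContDiffOn ℝ n f Ω) {x₀ : F} (hx₀ : x₀ ∈ Ω) :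
    ∃ ε > 0, ∃ V : Set F, IsOpen V ∧ x₀ ∈ V ∧ ∀ s : ℝ, |s| < ε → ∃ φ : F → F,
      ContDiffOn ℝ n φ V ∧ ∀ x ∈ V, ∃ u : ℝ → F, u 0 = x ∧ u 1 = φ x ∧
        ∀ t ∈ Ioo (-1 : ℝ) 2, u t ∈ Ω ∧ HasDerivAt u (s • f (u t)) t := by
  have h1n : 1 ≤ n := by rcases hn with rfl | rfl <;> simp
  let K := Icc (-1 : ℝ) 2
  let c : F →L[ℝ] C(K, F) := ContinuousLinearMap.const ℝ K
  -- The Picard equation u = x + s ∫ f(u), with the length of time s as a parameter and a fixed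
  -- interval that contains [0, 1] in its interior. For s = 0 it reads u = x, so the derivative of Φ
  -- in u is the identity there.
  let Φ : (F × ℝ) × C(K, F) → C(K, F) :=
    fun q ↦ q.2 - c q.1.1 - q.1.2 • primitive (superpose f q.2)
  let p : (F × ℝ) × C(K, F) := ((x₀, 0), c x₀)
  have hsup := eventually_contDiffAt_superpose (K := K) hn hΩ hf hx₀
  have hlim2 : Filter.Tendsto (fun q : (F × ℝ) × C(K, F) ↦ q.2) (𝓝 p) (𝓝 (c x₀)) :=
    continuous_snd.tendsto p
  have hΦ : ∀ᶠ q in 𝓝 p, ContDiffAt ℝ n Φ q := by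
    filter_upwards [hlim2.eventually hsup] with q hq
    have h2 : ContDiffAt ℝ n (fun q : (F × ℝ) × C(K, F) ↦ superpose f q.2) q :=
      hq.comp q contDiffAt_snd
    have h3 : ContDiffAt ℝ n (fun q : (F × ℝ) × C(K, F) ↦ primitive (superpose f q.2)) q :=
      (primitive (F := F)).contDiff.contDiffAt.comp q h2
    exact (contDiffAt_snd.sub (c.contDiff.contDiffAt.comp q contDiffAt_fst.fst)).sub
      (contDiffAt_fst.snd.smul h3)
  have hΦp : Φ p = 0 := by simp [Φ, p]
  have hder : fderiv ℝ Φ p ∘L .inr ℝ (F × ℝ) C(K, F) = ContinuousLinearMap.id ℝ C(K, F) := by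
    have h1 : HasFDerivAt (fun u : C(K, F) ↦ Φ ((x₀, 0), u))
        (fderiv ℝ Φ p ∘L .inr ℝ (F × ℝ) C(K, F)) (c x₀) :=
      (hΦ.self_of_nhds.differentiableAt (zero_lt_one.trans_le h1n).ne').hasFDerivAt.comp (c x₀)
        (hasFDerivAt_prodMk_right _ _)
    have h2 : HasFDerivAt (fun u : C(K, F) ↦ Φ ((x₀, 0), u))
        (ContinuousLinearMap.id ℝ C(K, F)) (c x₀) := by
      simpa [Φ] using (hasFDerivAt_id (c x₀)).sub_const (c x₀)
    exact h1.unique h2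
  obtain ⟨ψ, hψp, hψ⟩ := eventually_contDiffAt_implicitFunction h1n hΦ
    (hder ▸ ⟨ContinuousLinearEquiv.refl ℝ _, rfl⟩)
  have hΩK := (isOpen_setOf_forall_mem (K := K) hΩ).mem_nhds (x := c x₀) (fun _ ↦ hx₀)
  have hψc : ContinuousAt ψ p.1 := hψ.self_of_nhds.1.continuousAt
  have hev : ∀ᶠ z in 𝓝 p.1, ContDiffAt ℝ n ψ z ∧ Φ (z, ψ z) = 0 ∧ ∀ t, ψ z t ∈ Ω := by
    have hlim : Filter.Tendsto ψ (𝓝 p.1) (𝓝 (c x₀)) := by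
      have := hψc.tendsto
      rwa [hψp] at this
    have := hlim.eventually hΩK
    filter_upwards [hψ, this] with z h1 h2
    exact ⟨h1.1, h1.2.trans hΦp, h2⟩
  obtain ⟨A, hA, B, hB, hAB⟩ := mem_nhds_prod_iff.1 hev
  obtain ⟨ε, hε, hεB⟩ := Metric.mem_nhds_iff.1 hB
  obtain ⟨V, hVA, hVo, hxV⟩ := mem_nhds_iff.1 hA
  refine ⟨ε, hε, V, hVo, hxV, fun s hs ↦ ?_⟩
  have hsB : s ∈ B := hεB (by simpa [p] using hs)
  refine ⟨fun x ↦ ψ (x, s) ⟨1, by norm_num, by norm_num⟩, ?_, ?_⟩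
  · intro x hx
    have h1 : ContDiffAt ℝ n ψ (x, s) := (hAB (mk_mem_prod (hVA hx) hsB)).1
    have h2 : ContDiffAt ℝ n (fun x ↦ ψ (x, s)) x :=
      h1.comp x (contDiffAt_id.prodMk contDiffAt_const)
    exact ((ContinuousMap.evalCLM ℝ (⟨1, by norm_num, by norm_num⟩ : K)).contDiff.contDiffAt.comp
      x h2).contDiffWithinAt
  · intro x hx
    obtain ⟨-, h2, h3⟩ := hAB (mk_mem_prod (hVA hx) hsB)
    have hc : Continuous fun τ : ℝ ↦ f (ψ (x, s) (projIcc (-1) 2 (by norm_num) τ)) :=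
      hf.continuousOn.comp_continuous ((ψ (x, s)).continuous.comp continuous_projIcc)
        fun τ ↦ h3 _
    -- The right side of the Picard equation is differentiable in t, and on [-1, 2] it equals the
    -- solution found in the space of continuous functions.
    let u : ℝ → F := fun t ↦ x + s • ∫ τ in (0 : ℝ)..t,
      f (ψ (x, s) (projIcc (-1) 2 (by norm_num) τ))
    have hu : ∀ t : K, u t = ψ (x, s) t := by
      intro t
      have h4 := congrArg (fun v : C(K, F) ↦ v t) h2
      have h5 : ψ (x, s) t - x - s • (primitive (superpose f (ψ (x, s)))) t = 0 := h4
      rw [primitive_apply] at h5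
      simp only [superpose_apply hf.continuousOn h3] at h5
      rw [sub_sub, sub_eq_zero] at h5
      exact h5.symm
    refine ⟨u, by simp [u], hu ⟨1, by norm_num, by norm_num⟩, fun t ht ↦ ?_⟩
    have htK : t ∈ K := Ioo_subset_Icc_self ht
    have hut : u t = ψ (x, s) ⟨t, htK⟩ := hu ⟨t, htK⟩
    refine ⟨hut ▸ h3 _, ?_⟩
    have := ((hc.integral_hasStrictDerivAt 0 t).hasDerivAt.const_smul s).const_add x
    rw [projIcc_of_mem (by norm_num) htK] at this
    rw [hut]
    exact this

end Flow

/-! ### Primitives and difference quotients of smooth or analytic functions -/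

section Average

/-- The function `s ↦ max 0 (min 1 s)` on `[-1, 2]`. -/
noncomputable def clampedId : C(Icc (-1 : ℝ) 2, ℝ) := ⟨fun s ↦ max 0 (min 1 (s : ℝ)), by fun_prop⟩

/-- The mean of `G` over the segment from `a` to `t`. -/
noncomputable def segmentMean (G : ℝ → ℝ) (a t : ℝ) : ℝ :=
  ∫ s in (0 : ℝ)..1, G (a + (t - a) * s)

/-- The path from a to t depends affinely on t as an element of the space of continuous functions
and is constant for t = a. The mean is therefore a composite of an affine map, a superposition
operator near a constant, and a continuous linear map. -/
theorem eventually_contDiffAt_segmentMean {n : WithTop ℕ∞} (hn : n = (∞ : WithTop ℕ∞) ∨ n = ω)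
    {G : ℝ → ℝ} {I : Set ℝ} (hI : IsOpen I) (hG : ContDiffOn ℝ n G I) {a : ℝ} (ha : a ∈ I) :
    ∀ᶠ t in 𝓝 a, ContDiffAt ℝ n (segmentMean G a) t := by
  let L : ℝ → C(Icc (-1 : ℝ) 2, ℝ) := fun t ↦ ContinuousMap.const _ a + (t - a) • clampedId
  have hL : ContDiff ℝ n L := by fun_prop
  have hLa : L a = ContinuousMap.const _ a := by simp [L]
  have h1 : ∀ᶠ t in 𝓝 a, ContDiffAt ℝ n (superpose (K := Icc (-1 : ℝ) 2) G) (L t) := by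
    have := eventually_contDiffAt_superpose (K := Icc (-1 : ℝ) 2) hn hI hG ha
    rw [← hLa] at this
    exact (hL.continuous.tendsto a).eventually this
  have h2 : ∀ᶠ t in 𝓝 a, ∀ s, L t s ∈ I := by
    have := (isOpen_setOf_forall_mem (K := Icc (-1 : ℝ) 2) hI).mem_nhds (x := L a)
      (by rw [hLa]; exact fun _ ↦ ha)
    exact (hL.continuous.tendsto a).eventually this
  filter_upwards [h1, h2.eventually_nhds] with t ht1 ht2
  have h3 : ContDiffAt ℝ n (fun t ↦ primitive (superpose G (L t)) ⟨1, by norm_num, by norm_num⟩)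
      t :=
    ((ContinuousMap.evalCLM (M := ℝ) ℝ (⟨1, by norm_num, by norm_num⟩ : Icc (-1 : ℝ) 2)).contDiff.comp
      (primitive (F := ℝ)).contDiff).contDiffAt.comp t (ht1.comp t hL.contDiffAt)
  refine h3.congr_of_eventuallyEq ?_
  filter_upwards [ht2] with r hr
  rw [primitive_apply]
  refine intervalIntegral.integral_congr fun s hs ↦ ?_
  rw [uIcc_of_le zero_le_one] at hs
  have hs' : s ∈ Icc (-1 : ℝ) 2 := ⟨by linarith [hs.1], by linarith [hs.2]⟩
  rw [superpose_apply hG.continuousOn hr, projIcc_of_mem (by norm_num) hs']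
  simp [L, clampedId, hs.1, hs.2]

theorem eq_add_mul_segmentMean {f G : ℝ → ℝ} {I : Set ℝ} (hI : Convex ℝ I)
    (hG : ContinuousOn G I) (hf : ∀ t ∈ I, HasDerivAt f (G t) t) {a t : ℝ} (ha : a ∈ I)
    (ht : t ∈ I) : f t = f a + (t - a) * segmentMean G a t := by
  have hmem : ∀ s ∈ uIcc (0 : ℝ) 1, a + (t - a) * s ∈ I := fun s hs ↦ by
    rw [uIcc_of_le zero_le_one] at hs
    have := hI.add_smul_sub_mem ha ht hs
    simpa [mul_comm] using this
  have h := intervalIntegral.integral_eq_sub_of_hasDerivAt (a := 0) (b := 1)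
    (f := fun s ↦ f (a + (t - a) * s)) (f' := fun s ↦ G (a + (t - a) * s) * (t - a))
    (fun s hs ↦ by
      have h1 : HasDerivAt (fun s : ℝ ↦ a + (t - a) * s) (t - a) s := by
        simpa using ((hasDerivAt_id s).const_mul (t - a)).const_add a
      exact (hf _ (hmem s hs)).comp s h1)
    (by
      refine ContinuousOn.intervalIntegrable ?_
      refine ContinuousOn.mul (hG.comp (by fun_prop) hmem) continuousOn_const)
  rw [intervalIntegral.integral_mul_const] at h
  simp only [mul_one, mul_zero, add_zero, add_sub_cancel] at h
  rw [segmentMean]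
  linarith

/-- Near a, f(t) = f(a) + (t - a) · (mean of G over the segment), which treats the smooth and the
analytic case at once. -/
theorem contDiffOn_of_hasDerivAt {n : WithTop ℕ∞} (hn : n = (∞ : WithTop ℕ∞) ∨ n = ω)
    {f G : ℝ → ℝ} {I : Set ℝ} (hI : IsOpen I) (hG : ContDiffOn ℝ n G I)
    (hf : ∀ t ∈ I, HasDerivAt f (G t) t) : ContDiffOn ℝ n f I := by
  intro a ha
  refine ContDiffAt.contDiffWithinAt ?_
  obtain ⟨ε, hε, hball⟩ := Metric.isOpen_iff.1 hI a ha
  have h1 := (eventually_contDiffAt_segmentMean hn hI hG ha).self_of_nhds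
  have h2 : ContDiffAt ℝ n (fun t ↦ f a + (t - a) * segmentMean G a t) a := by fun_prop
  refine h2.congr_of_eventuallyEq ?_
  filter_upwards [Metric.ball_mem_nhds a hε] with t ht
  exact eq_add_mul_segmentMean (convex_ball a ε) (hG.continuousOn.mono hball)
    (fun s hs ↦ hf s (hball hs)) (Metric.mem_ball_self hε) ht

theorem contDiffOn_deriv {n : WithTop ℕ∞} (hn : n = (∞ : WithTop ℕ∞) ∨ n = ω)
    {f : ℝ → ℝ} {I : Set ℝ} (hI : IsOpen I) (hf : ContDiffOn ℝ n f I) :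
    ContDiffOn ℝ n (deriv f) I :=
  hf.deriv_of_isOpen hI (by rcases hn with rfl | rfl <;> simp)

/-- Hadamard's lemma: near a the difference quotient is the mean of f' over the segment; elsewhere
it is a quotient with nonzero denominator. -/
theorem contDiffOn_dslope {n : WithTop ℕ∞} (hn : n = (∞ : WithTop ℕ∞) ∨ n = ω)
    {f : ℝ → ℝ} {I : Set ℝ} (hI : IsOpen I) (hf : ContDiffOn ℝ n f I) {a : ℝ} (ha : a ∈ I) :
    ContDiffOn ℝ n (dslope f a) I := by
  intro t ht
  refine ContDiffAt.contDiffWithinAt ?_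
  rcases eq_or_ne t a with rfl | hta
  · obtain ⟨ε, hε, hball⟩ := Metric.isOpen_iff.1 hI t ht
    have hG := contDiffOn_deriv hn hI hf
    have h1 := (eventually_contDiffAt_segmentMean hn hI hG ht).self_of_nhds
    have hn0 : n ≠ 0 := by rcases hn with rfl | rfl <;> simp
    have hd : ∀ s ∈ I, HasDerivAt f (deriv f s) s := fun s hs ↦
      ((hf.contDiffAt (hI.mem_nhds hs)).differentiableAt hn0).hasDerivAt
    refine h1.congr_of_eventuallyEq ?_
    filter_upwards [Metric.ball_mem_nhds t hε] with s hs
    have := eq_add_mul_segmentMean (convex_ball t ε) (hG.continuousOn.mono hball)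
      (fun s hs ↦ hd s (hball hs)) (Metric.mem_ball_self hε) hs
    rcases eq_or_ne s t with rfl | hst
    · simp [segmentMean]
    · rw [dslope_of_ne _ hst, slope_def_field, this]
      field_simp [sub_ne_zero.2 hst]
      ring
  · have h1 : ContDiffAt ℝ n (fun s ↦ (f s - f a) / (s - a)) t :=
      ((hf.contDiffAt (hI.mem_nhds ht)).sub contDiffAt_const).div
        (contDiffAt_id.sub contDiffAt_const) (sub_ne_zero.2 hta)
    refine h1.congr_of_eventuallyEq ?_
    filter_upwards [eventually_ne_nhds hta] with s hs
    rw [dslope_of_ne _ hs, slope_def_field]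

end Average

/-! ### Even functions of one variable and radial functions -/

section Even

/-- The open ball about `0` of an extended radius. -/
abbrev enormBall (E : Type*) [NormedAddCommGroup E] (ρ : ℝ≥0∞) : Set E := {x | ‖x‖ₑ < ρ}

variable {E : Type*} [NormedAddCommGroup E] [InnerProductSpace ℝ E]

theorem isOpen_enormBall {E : Type*} [NormedAddCommGroup E] (ρ : ℝ≥0∞) : IsOpen (enormBall E ρ) :=
  isOpen_lt continuous_enorm continuous_const

theorem norm_mem_enormBall {E : Type*} [NormedAddCommGroup E] {ρ : ℝ≥0∞} {x : E} :
    ‖x‖ ∈ enormBall ℝ ρ ↔ x ∈ enormBall E ρ := by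
  simp [enormBall]

theorem zero_mem_enormBall {E : Type*} [NormedAddCommGroup E] {ρ : ℝ≥0∞} (hρ : 0 < ρ) :
    (0 : E) ∈ enormBall E ρ := by
  simpa [enormBall] using hρ

theorem mem_enormBall_of_norm_le {E F : Type*} [NormedAddCommGroup E] [NormedAddCommGroup F]
    {ρ : ℝ≥0∞} {x : E} {y : F} (hx : x ∈ enormBall E ρ) (h : ‖y‖ ≤ ‖x‖) : y ∈ enormBall F ρ := by
  refine lt_of_le_of_lt ?_ (show ‖x‖ₑ < ρ from hx)
  rw [← ofReal_norm, ← ofReal_norm]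
  exact ENNReal.ofReal_le_ofReal h

theorem neg_mem_enormBall {E : Type*} [NormedAddCommGroup E] {ρ : ℝ≥0∞} {x : E}
    (hx : x ∈ enormBall E ρ) : -x ∈ enormBall E ρ :=
  mem_enormBall_of_norm_le hx (norm_neg x).le

theorem convex_enormBall {E : Type*} [NormedAddCommGroup E] [NormedSpace ℝ E] (ρ : ℝ≥0∞) :
    Convex ℝ (enormBall E ρ) := by
  intro x hx y hy a b ha hb hab
  rcases le_total ‖x‖ ‖y‖ with h | h
  · refine mem_enormBall_of_norm_le hy ((norm_add_le _ _).trans ?_)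
    rw [norm_smul, norm_smul, Real.norm_of_nonneg ha, Real.norm_of_nonneg hb]
    obtain rfl : b = 1 - a := by linarith
    nlinarith [mul_le_mul_of_nonneg_left h ha]
  · refine mem_enormBall_of_norm_le hx ((norm_add_le _ _).trans ?_)
    rw [norm_smul, norm_smul, Real.norm_of_nonneg ha, Real.norm_of_nonneg hb]
    obtain rfl : a = 1 - b := by linarith
    nlinarith [mul_le_mul_of_nonneg_left h hb]

theorem deriv_neg_of_even {f : ℝ → ℝ} {ρ : ℝ≥0∞} (he : ∀ t ∈ enormBall ℝ ρ, f (-t) = f t) {t : ℝ}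
    (ht : t ∈ enormBall ℝ ρ) : deriv f (-t) = - deriv f t := by
  have h : (fun s ↦ f (-s)) =ᶠ[𝓝 t] f := by
    filter_upwards [(isOpen_enormBall ρ).mem_nhds ht] with s hs using he s hs
  rw [← h.deriv_eq, deriv_comp_neg, neg_neg]

theorem deriv_neg_of_odd {f : ℝ → ℝ} {ρ : ℝ≥0∞} (he : ∀ t ∈ enormBall ℝ ρ, f (-t) = - f t) {t : ℝ}
    (ht : t ∈ enormBall ℝ ρ) : deriv f (-t) = deriv f t := by
  have h : (fun s ↦ - f (-s)) =ᶠ[𝓝 t] f := by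
    filter_upwards [(isOpen_enormBall ρ).mem_nhds ht] with s hs
    rw [he s hs, neg_neg]
  rw [← h.deriv_eq, deriv.fun_neg, deriv_comp_neg, neg_neg]

theorem deriv_zero_of_even {f : ℝ → ℝ} {ρ : ℝ≥0∞} (hρ : 0 < ρ)
    (he : ∀ t ∈ enormBall ℝ ρ, f (-t) = f t) : deriv f 0 = 0 := by
  have := deriv_neg_of_even he (zero_mem_enormBall hρ)
  rw [neg_zero] at this
  linarith

/-- The function `f'(t) / t`, for an even function `f`. -/
noncomputable def radialDeriv (f : ℝ → ℝ) : ℝ → ℝ := dslope (deriv f) 0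

theorem mul_radialDeriv {f : ℝ → ℝ} (h0 : deriv f 0 = 0) (t : ℝ) :
    t * radialDeriv f t = deriv f t := by
  simpa [h0, radialDeriv] using sub_smul_dslope (deriv f) 0 t

theorem radialDeriv_even {f : ℝ → ℝ} {ρ : ℝ≥0∞} (he : ∀ t ∈ enormBall ℝ ρ, f (-t) = f t) {t : ℝ}
    (ht : t ∈ enormBall ℝ ρ) : radialDeriv f (-t) = radialDeriv f t := by
  have h0 : deriv f 0 = 0 := deriv_zero_of_even (lt_of_le_of_lt zero_le ht) he
  rcases eq_or_ne t 0 with rfl | h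
  · simp
  · have h1 := mul_radialDeriv h0 t
    have h2 := mul_radialDeriv h0 (-t)
    rw [deriv_neg_of_even he ht, ← h1] at h2
    have : t * (radialDeriv f (-t) - radialDeriv f t) = 0 := by linarith
    rcases mul_eq_zero.1 this with h' | h'
    · exact absurd h' h
    · linarith

theorem contDiffOn_radialDeriv {n : WithTop ℕ∞} (hn : n = (∞ : WithTop ℕ∞) ∨ n = ω)
    {f : ℝ → ℝ} {ρ : ℝ≥0∞} (hf : ContDiffOn ℝ n f (enormBall ℝ ρ)) :
    ContDiffOn ℝ n (radialDeriv f) (enormBall ℝ ρ) := by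
  rcases eq_or_lt_of_le (zero_le (a := ρ)) with rfl | hρ
  · intro t ht; simp at ht
  exact contDiffOn_dslope hn (isOpen_enormBall ρ) (contDiffOn_deriv hn (isOpen_enormBall ρ) hf)
    (zero_mem_enormBall hρ)

/-- Away from 0 the norm has gradient x / ‖x‖, and f'(r) / r is `radialDeriv f r`. At 0 evenness
forces f'(0) = 0, and the same formula gives the derivative 0. -/
theorem hasFDerivAt_radial {f : ℝ → ℝ} {ρ : ℝ≥0∞} (hf : DifferentiableOn ℝ f (enormBall ℝ ρ))
    (he : ∀ t ∈ enormBall ℝ ρ, f (-t) = f t) {x : E} (hx : x ∈ enormBall E ρ) :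
    HasFDerivAt (fun x ↦ f ‖x‖) (radialDeriv f ‖x‖ • innerSL ℝ x) x := by
  have h0 : deriv f 0 = 0 := deriv_zero_of_even (lt_of_le_of_lt zero_le hx) he
  have hd : HasDerivAt f (deriv f ‖x‖) ‖x‖ :=
    (hf.differentiableAt ((isOpen_enormBall ρ).mem_nhds (norm_mem_enormBall.2 hx))).hasDerivAt
  rcases eq_or_ne x 0 with rfl | h
  · rw [map_zero, smul_zero]
    rw [norm_zero, h0] at hd
    rw [hasFDerivAt_iff_isLittleO_nhds_zero]
    have h1 := hasDerivAt_iff_isLittleO_nhds_zero.1 hd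
    have h2 := h1.comp_tendsto (k := fun y : E ↦ ‖y‖) (l' := 𝓝 0)
      (by simpa using (continuous_norm (E := E)).tendsto 0)
    have h3 : (fun y : E ↦ f ‖y‖ - f 0) =o[𝓝 0] fun y ↦ ‖y‖ := by
      simpa [Function.comp_def] using h2
    simpa using h3.of_norm_right
  · have hsq : HasFDerivAt (fun x : E ↦ ‖x‖) (‖x‖⁻¹ • innerSL ℝ x) x := by
      have h1 := (hasStrictFDerivAt_norm_sq x).hasFDerivAt.sqrt (by positivity)
      have h2 : (fun y : E ↦ √(‖y‖ ^ 2)) = fun y ↦ ‖y‖ := by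
        ext y; exact Real.sqrt_sq (norm_nonneg y)
      rw [h2, Real.sqrt_sq (norm_nonneg x)] at h1
      convert h1 using 1
      rw [← Nat.cast_smul_eq_nsmul ℝ, smul_smul]
      congr 1
      field_simp
      norm_num
    have h3 := hd.comp_hasFDerivAt x hsq
    rw [smul_smul, ← mul_radialDeriv h0 ‖x‖] at h3
    have e : ‖x‖ * radialDeriv f ‖x‖ * ‖x‖⁻¹ = radialDeriv f ‖x‖ := by field_simp
    rw [e] at h3
    exact h3

/-- The gradient of f(‖x‖) is `radialDeriv f ‖x‖` times x, and `radialDeriv f` is again smooth and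
even, so induction on the order applies. -/
theorem contDiffOn_radial_nat (k : ℕ) : ∀ {f : ℝ → ℝ} {ρ : ℝ≥0∞}
    (_ : ContDiffOn ℝ ∞ f (enormBall ℝ ρ)) (_ : ∀ t ∈ enormBall ℝ ρ, f (-t) = f t),
    ContDiffOn ℝ k (fun x : E ↦ f ‖x‖) (enormBall E ρ) := by
  induction k with
  | zero =>
    intro f ρ hf he
    rw [CharP.cast_eq_zero, contDiffOn_zero]
    exact hf.continuousOn.comp continuous_norm.continuousOn fun x hx ↦ norm_mem_enormBall.2 hx
  | succ k ih =>
    intro f ρ hf he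
    push_cast
    rw [contDiffOn_succ_iff_hasFDerivWithinAt_of_uniqueDiffOn (isOpen_enormBall ρ).uniqueDiffOn]
    refine ⟨by simp, fun x ↦ radialDeriv f ‖x‖ • innerSL ℝ x, ?_, fun x hx ↦
      (hasFDerivAt_radial (hf.differentiableOn (by simp)) he hx).hasFDerivWithinAt⟩
    exact (ih (contDiffOn_radialDeriv (Or.inl rfl) hf) fun t ht ↦ radialDeriv_even he ht).smul
      (innerSL ℝ).contDiff.contDiffOn

/-- An even power series is a power series in t², and ‖x‖² is analytic. If p converges beyond s, the
series with coefficients p_{2k} converges up to s² at least. -/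
theorem analyticAt_radial_zero {f : ℝ → ℝ} {ρ : ℝ≥0∞} (hρ : 0 < ρ) (hf : AnalyticAt ℝ f 0)
    (he : ∀ t ∈ enormBall ℝ ρ, f (-t) = f t) : AnalyticAt ℝ (fun x : E ↦ f ‖x‖) 0 := by
  obtain ⟨p, r, hp⟩ := hf
  obtain ⟨s, hs0, hsr⟩ := ENNReal.lt_iff_exists_nnreal_btwn.1 (lt_min hp.r_pos hρ)
  have hs0' : 0 < s := by exact_mod_cast hs0
  obtain ⟨C, _, hC⟩ := p.norm_mul_pow_le_of_lt_radius
    ((hsr.trans_le (min_le_left _ _)).trans_le hp.r_le)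
  let b : ℕ → ℝ := fun k ↦ p.coeff (2 * k)
  let q := FormalMultilinearSeries.ofScalars ℝ b
  have hq : ((s ^ 2 : NNReal) : ℝ≥0∞) ≤ q.radius := by
    refine q.le_radius_of_bound C fun k ↦ ?_
    have h1 := hC (2 * k)
    rw [p.norm_apply_eq_norm_coef] at h1
    have h2 : ‖q k‖ = ‖b k‖ := by
      rw [q.norm_apply_eq_norm_coef]
      simp [q, FormalMultilinearSeries.coeff_ofScalars]
    rw [h2]
    push_cast
    rw [← pow_mul]
    exact h1
  have hqpos : 0 < q.radius := lt_of_lt_of_le (by positivity) hq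
  have hK := q.hasFPowerSeriesOnBall hqpos
  have hfK : ∀ t : ℝ, |t| < s → f t = q.sum (t ^ 2) := by
    intro t ht
    have hte : ‖t‖ₑ < s := by
      rw [enorm_lt_coe]
      exact_mod_cast ht
    have hsum : ∀ t : ℝ, ‖t‖ₑ < s → HasSum (fun k ↦ t ^ k * p.coeff k) (f t) := by
      intro t ht
      have := hp.hasSum (y := t) (by simpa using ht.trans (hsr.trans_le (min_le_left _ _)))
      simpa [p.apply_eq_pow_smul_coeff] using this
    have h1 := hsum t hte
    have h2 := hsum (-t) (by simpa using hte)
    rw [he t (hte.trans (hsr.trans_le (min_le_right _ _)))] at h2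
    -- Averaging the expansions at t and -t removes the odd terms.
    have h3 := (h1.add h2).div_const 2
    rw [add_self_div_two] at h3
    have h4 : HasSum (fun k ↦ (t ^ 2) ^ k * b k) (f t) := by
      have hinj : Function.Injective fun k : ℕ ↦ 2 * k := fun a b h ↦ by simpa using h
      rw [← hinj.hasSum_iff] at h3
      · have e : (fun k ↦ (t ^ 2) ^ k * b k)
            = (fun i ↦ (t ^ i * p.coeff i + (-t) ^ i * p.coeff i) / 2) ∘ fun k ↦ 2 * k := by
          funext k
          simp only [Function.comp_apply, (even_two_mul k).neg_pow, b]
          rw [add_self_div_two, pow_mul]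
        rw [e]
        exact h3
      · intro k hk
        have : Odd k := by
          rw [← Nat.not_even_iff_odd]
          rintro ⟨j, rfl⟩
          exact hk ⟨j, by simp [two_mul]⟩
        simp [this.neg_pow]
    have h5 := hK.hasSum (y := t ^ 2) (by
      rw [Metric.mem_eball, edist_zero_right]
      refine lt_of_lt_of_le ?_ hq
      rw [enorm_lt_coe]
      have : |t| ^ 2 < (s : ℝ) ^ 2 := by gcongr
      rw [← NNReal.coe_lt_coe]
      simpa using this)
    rw [zero_add] at h5
    refine h4.unique ?_
    have e : (fun k ↦ (t ^ 2) ^ k * b k) = fun k ↦ q k fun _ ↦ t ^ 2 := by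
      funext k
      simp [q, mul_comm]
    rw [e]
    exact h5
  have hA : AnalyticAt ℝ (fun x : E ↦ q.sum (‖x‖ ^ 2)) 0 := by
    refine AnalyticAt.comp (g := q.sum) (f := fun x : E ↦ ‖x‖ ^ 2) ?_
      (contDiff_norm_sq ℝ).contDiffAt.analyticAt
    simpa using hK.analyticAt
  refine hA.congr ?_
  filter_upwards [Metric.ball_mem_nhds (0 : E) (show (0 : ℝ) < s by exact_mod_cast hs0')] with x hx
  exact (hfK ‖x‖ (by simpa using hx)).symm

theorem contDiffOn_radial {n : WithTop ℕ∞} (hn : n = (∞ : WithTop ℕ∞) ∨ n = ω)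
    {f : ℝ → ℝ} {ρ : ℝ≥0∞} (hf : ContDiffOn ℝ n f (enormBall ℝ ρ))
    (he : ∀ t ∈ enormBall ℝ ρ, f (-t) = f t) :
    ContDiffOn ℝ n (fun x : E ↦ f ‖x‖) (enormBall E ρ) := by
  rcases hn with rfl | rfl
  · exact contDiffOn_infty.2 fun k ↦ contDiffOn_radial_nat k hf he
  · intro x hx
    refine ContDiffAt.contDiffWithinAt ?_
    have hfx := hf.contDiffAt ((isOpen_enormBall ρ).mem_nhds (norm_mem_enormBall.2 hx))
    rcases eq_or_ne x 0 with rfl | h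
    · rw [norm_zero] at hfx
      exact (analyticAt_radial_zero (lt_of_le_of_lt zero_le hx) hfx.analyticAt he).contDiffAt
    · exact hfx.comp x (contDiffAt_norm ℝ h)

end Even

/-! ### The ordinary differential equation for the radial change of distance -/

section Profile

variable {ρ : ℝ≥0∞}

theorem uIcc_zero_subset_enormBall {t : ℝ} (ht : t ∈ enormBall ℝ ρ) :
    uIcc 0 t ⊆ enormBall ℝ ρ :=
  (convex_enormBall ρ).ordConnected.uIcc_subset
    (zero_mem_enormBall (lt_of_le_of_lt zero_le ht)) ht

theorem hasDerivAt_primitive_of_continuousOn {G : ℝ → ℝ} (hG : ContinuousOn G (enormBall ℝ ρ))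
    {t : ℝ} (ht : t ∈ enormBall ℝ ρ) : HasDerivAt (fun t ↦ ∫ s in (0 : ℝ)..t, G s) (G t) t :=
  intervalIntegral.integral_hasDerivAt_right
    (hG.mono (uIcc_zero_subset_enormBall ht)).intervalIntegrable
    (hG.stronglyMeasurableAtFilter (isOpen_enormBall ρ) t ht)
    (hG.continuousAt ((isOpen_enormBall ρ).mem_nhds ht))

theorem primitive_even_of_odd {G : ℝ → ℝ} (ho : ∀ t ∈ enormBall ℝ ρ, G (-t) = - G t) {t : ℝ}
    (ht : t ∈ enormBall ℝ ρ) : ∫ s in (0 : ℝ)..(-t), G s = ∫ s in (0 : ℝ)..t, G s := by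
  have h1 := intervalIntegral.integral_comp_neg (a := t) (b := 0) G
  rw [neg_zero] at h1
  rw [← h1, intervalIntegral.integral_symm, ← intervalIntegral.integral_neg]
  refine intervalIntegral.integral_congr fun s hs ↦ ?_
  rw [ho s (uIcc_zero_subset_enormBall ht hs), neg_neg]

theorem dslope_odd_of_even {f : ℝ → ℝ} (he : ∀ t ∈ enormBall ℝ ρ, f (-t) = f t) {t : ℝ}
    (ht : t ∈ enormBall ℝ ρ) : dslope f 0 (-t) = - dslope f 0 t := by
  have h0 : deriv f 0 = 0 := deriv_zero_of_even (lt_of_le_of_lt zero_le ht) he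
  rcases eq_or_ne t 0 with rfl | h
  · simp [h0]
  · rw [dslope_of_ne _ h, dslope_of_ne _ (neg_ne_zero.2 h), slope_def_field, slope_def_field,
      he t ht, sub_zero, sub_zero, div_neg]

/-- The solution `β` of `β' / β = 1 / (t η(t) ^ (1 / N))` with `β'(0) = 1`. -/
theorem exists_odd_solution (hρ : 0 < ρ) {N : ℕ} (hN : N ≠ 0) {η : ℝ → ℝ}
    (hη : ContDiffOn ℝ ∞ η (enormBall ℝ ρ)) (he : ∀ t ∈ enormBall ℝ ρ, η (-t) = η t)
    (hpos : ∀ t ∈ enormBall ℝ ρ, 0 < η t) (h1 : η 0 = 1) :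
    ∃ β : ℝ → ℝ, ContDiffOn ℝ ∞ β (enormBall ℝ ρ) ∧
      (ContDiffOn ℝ ω η (enormBall ℝ ρ) → ContDiffOn ℝ ω β (enormBall ℝ ρ)) ∧
      (∀ t ∈ enormBall ℝ ρ, β (-t) = - β t) ∧ (∀ t ∈ enormBall ℝ ρ, 0 < deriv β t) ∧
      deriv β 0 = 1 ∧ ∀ t ∈ enormBall ℝ ρ, deriv β t ^ N * η t * t ^ N = β t ^ N := by
  have hI := isOpen_enormBall (E := ℝ) ρ
  have h0I : (0 : ℝ) ∈ enormBall ℝ ρ := zero_mem_enormBall hρ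
  -- Writing β = t exp B turns β'/β = 1/(t F) into B' = (1/F - 1)/t, whose right side G is regular
  -- at 0 because F(0) = 1. As 1/F is even, G is odd, B is even and β is odd.
  let F : ℝ → ℝ := fun t ↦ η t ^ ((1 : ℝ) / N)
  let H : ℝ → ℝ := fun t ↦ (F t)⁻¹
  let G : ℝ → ℝ := dslope H 0
  let B : ℝ → ℝ := fun t ↦ ∫ s in (0 : ℝ)..t, G s
  let β : ℝ → ℝ := fun t ↦ t * Real.exp (B t)
  have hFpos : ∀ t ∈ enormBall ℝ ρ, 0 < F t := fun t ht ↦ Real.rpow_pos_of_pos (hpos t ht) _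
  have hFN : ∀ t ∈ enormBall ℝ ρ, F t ^ N = η t := fun t ht ↦ by
    simp only [F]
    rw [← Real.rpow_natCast, ← Real.rpow_mul (hpos t ht).le, one_div,
      inv_mul_cancel₀ (by exact_mod_cast hN), Real.rpow_one]
  have hF0 : F 0 = 1 := by simp [F, h1]
  have hG : ∀ n : WithTop ℕ∞, n = (∞ : WithTop ℕ∞) ∨ n = ω → ContDiffOn ℝ n η (enormBall ℝ ρ) →
      ContDiffOn ℝ n G (enormBall ℝ ρ) := fun n hn hηn ↦
    contDiffOn_dslope hn hI ((hηn.rpow_const_of_ne fun t ht ↦ (hpos t ht).ne').inv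
      fun t ht ↦ (hFpos t ht).ne') h0I
  have hGc := (hG _ (Or.inl rfl) hη).continuousOn
  have hB : ∀ t ∈ enormBall ℝ ρ, HasDerivAt B (G t) t := fun t ht ↦
    hasDerivAt_primitive_of_continuousOn hGc ht
  have hβ : ∀ n : WithTop ℕ∞, n = (∞ : WithTop ℕ∞) ∨ n = ω → ContDiffOn ℝ n η (enormBall ℝ ρ) →
      ContDiffOn ℝ n β (enormBall ℝ ρ) := fun n hn hηn ↦
    contDiffOn_id.mul (contDiffOn_of_hasDerivAt hn hI (hG n hn hηn) hB).exp
  have hHe : ∀ t ∈ enormBall ℝ ρ, H (-t) = H t := fun t ht ↦ by simp only [H, F, he t ht]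
  have hGodd : ∀ t ∈ enormBall ℝ ρ, G (-t) = - G t := fun t ht ↦ dslope_odd_of_even hHe ht
  have hβd : ∀ t ∈ enormBall ℝ ρ, HasDerivAt β (Real.exp (B t) / F t) t := fun t ht ↦ by
    have h2 := (hasDerivAt_id t).mul (hB t ht).exp
    have h3 : t * G t = (F t)⁻¹ - 1 := by
      have := sub_smul_dslope H 0 t
      simpa [H, hF0] using this
    refine h2.congr_deriv ?_
    simp only [id]
    linear_combination Real.exp (B t) * h3
  have hB0 : B 0 = 0 := by simp [B]
  refine ⟨β, hβ _ (Or.inl rfl) hη, hβ _ (Or.inr rfl), fun t ht ↦ ?_, fun t ht ↦ ?_, ?_,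
    fun t ht ↦ ?_⟩
  · simp only [β, B]
    rw [primitive_even_of_odd hGodd ht, neg_mul]
  · rw [(hβd t ht).deriv]
    exact div_pos (Real.exp_pos _) (hFpos t ht)
  · rw [(hβd 0 h0I).deriv, hB0, hF0]
    simp
  · rw [(hβd t ht).deriv, div_pow, hFN t ht, div_mul_cancel₀ _ (hpos t ht).ne']
    simp only [β]
    ring

theorem strictMonoOn_of_deriv_pos_enormBall {h : ℝ → ℝ} (hc : DifferentiableOn ℝ h (enormBall ℝ ρ))
    (hd : ∀ t ∈ enormBall ℝ ρ, 0 < deriv h t) : StrictMonoOn h (enormBall ℝ ρ) :=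
  strictMonoOn_of_deriv_pos (convex_enormBall ρ) hc.continuousOn
    fun t ht ↦ hd t (interior_subset ht)

/-- The local inverse of h takes values in I near h(r), where k inverts h, so k agrees with it
there. -/
theorem contDiffAt_of_local_inverse {E F : Type*} [NormedAddCommGroup E] [NormedSpace ℝ E]
    [CompleteSpace E] [NormedAddCommGroup F] [NormedSpace ℝ F] {n : WithTop ℕ∞} (hn : n ≠ 0)
    {h : E → F} {k : F → E} {I : Set E} (hI : IsOpen I) {r : E} (hr : r ∈ I)
    (hc : ContDiffAt ℝ n h r) (hi : (fderiv ℝ h r).IsInvertible) (hk : ∀ r ∈ I, k (h r) = r) :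
    ContDiffAt ℝ n k (h r) := by
  obtain ⟨e, he⟩ := hi
  have hd : HasFDerivAt h (e : E →L[ℝ] F) r := by
    rw [he]; exact (hc.differentiableAt hn).hasFDerivAt
  have hs : HasStrictFDerivAt h (e : E →L[ℝ] F) r := hc.hasStrictFDerivAt' hd hn
  have hg := hc.to_localInverse hd hn
  have hg' : ContDiffAt ℝ n (hs.localInverse h e r) (h r) := hg
  refine hg'.congr_of_eventuallyEq ?_
  have h1 : ∀ᶠ t in 𝓝 (h r), hs.localInverse h e r t ∈ I := by
    refine hg'.continuousAt.tendsto.eventually ?_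
    rw [hs.localInverse_apply_image]
    exact hI.mem_nhds hr
  filter_upwards [hs.eventually_right_inverse, h1] with t ht1 ht2
  rw [← hk _ ht2, ht1]

/-- R is the supremum of |h|, possibly infinite. It is not attained, since |h(r)| = h(|r|) is
strictly increasing in |r| on an open ball, and the intermediate value theorem shows that h is onto
the ball of radius R. -/
theorem exists_odd_inverse (hρ : 0 < ρ) {h : ℝ → ℝ} (hc : ContDiffOn ℝ ∞ h (enormBall ℝ ρ))
    (ho : ∀ t ∈ enormBall ℝ ρ, h (-t) = - h t) (hd : ∀ t ∈ enormBall ℝ ρ, 0 < deriv h t) :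
    ∃ (R : ℝ≥0∞) (k : ℝ → ℝ), 0 < R ∧ ContDiffOn ℝ ∞ k (enormBall ℝ R) ∧
      (ContDiffOn ℝ ω h (enormBall ℝ ρ) → ContDiffOn ℝ ω k (enormBall ℝ R)) ∧
      (∀ t ∈ enormBall ℝ R, k t ∈ enormBall ℝ ρ ∧ h (k t) = t) ∧
      (∀ r ∈ enormBall ℝ ρ, h r ∈ enormBall ℝ R ∧ k (h r) = r) := by
  have hI := isOpen_enormBall (E := ℝ) ρ
  have h0I : (0 : ℝ) ∈ enormBall ℝ ρ := zero_mem_enormBall hρ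
  have hmono := strictMonoOn_of_deriv_pos_enormBall (hc.differentiableOn (by simp)) hd
  have h0 : h 0 = 0 := by
    have := ho 0 h0I
    rw [neg_zero] at this
    linarith
  have habs : ∀ r ∈ enormBall ℝ ρ, |h r| = h |r| := fun r hr ↦ by
    rcases le_total 0 r with h1 | h1
    · rw [abs_of_nonneg h1, abs_of_nonneg]
      rw [← h0]
      exact hmono.monotoneOn h0I hr h1
    · rw [abs_of_nonpos h1, ho r hr, abs_of_nonpos]
      rw [← h0]
      exact hmono.monotoneOn hr h0I h1
  let R : ℝ≥0∞ := sSup ((fun r ↦ ‖h r‖ₑ) '' enormBall ℝ ρ)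
  let k : ℝ → ℝ := Function.invFunOn h (enormBall ℝ ρ)
  have hR : ∀ r ∈ enormBall ℝ ρ, h r ∈ enormBall ℝ R := by
    intro r hr
    obtain ⟨ε, hε, hball⟩ := Metric.isOpen_iff.1 hI |r| (norm_mem_enormBall.2 hr)
    have hr' : |r| + ε / 2 ∈ enormBall ℝ ρ := hball (by simp [abs_of_pos hε, hε])
    have h1 : |h r| < h (|r| + ε / 2) := by
      rw [habs r hr]
      exact hmono (norm_mem_enormBall.2 hr) hr' (by rw [Real.norm_eq_abs]; linarith)
    refine lt_of_lt_of_le (show ‖h r‖ₑ < ‖h (|r| + ε / 2)‖ₑ from ?_)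
      (le_sSup (mem_image_of_mem (fun r ↦ ‖h r‖ₑ) hr'))
    rw [← ofReal_norm, ← ofReal_norm]
    refine (ENNReal.ofReal_lt_ofReal_iff_of_nonneg (norm_nonneg _)).2 (h1.trans_le (le_abs_self _))
  have hsurj : ∀ t ∈ enormBall ℝ R, t ∈ h '' enormBall ℝ ρ := by
    intro t ht
    obtain ⟨_, ⟨r, hr, rfl⟩, htr⟩ := lt_sSup_iff.1 (show ‖t‖ₑ < R from ht)
    have hr' : |r| ∈ enormBall ℝ ρ := norm_mem_enormBall.2 hr
    have h1 : |t| < h |r| := by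
      rw [← habs r hr]
      simp only [← ofReal_norm] at htr
      exact (ENNReal.ofReal_lt_ofReal_iff_of_nonneg (norm_nonneg _)).1 htr
    have hsub : Icc (-|r|) |r| ⊆ enormBall ℝ ρ :=
      (convex_enormBall ρ).ordConnected.out (neg_mem_enormBall hr') hr'
    have h2 := intermediate_value_Icc (neg_le_self (abs_nonneg r)) (hc.continuousOn.mono hsub)
    rw [ho _ hr'] at h2
    exact image_mono hsub (h2 ⟨by linarith [neg_abs_le t], by linarith [le_abs_self t]⟩)
  have hkmem : ∀ t ∈ enormBall ℝ R, k t ∈ enormBall ℝ ρ ∧ h (k t) = t := fun t ht ↦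
    ⟨Function.invFunOn_mem (hsurj t ht), Function.invFunOn_eq (hsurj t ht)⟩
  have hkh : ∀ r ∈ enormBall ℝ ρ, k (h r) = r := hmono.injOn.leftInvOn_invFunOn
  have hsm : ∀ n : WithTop ℕ∞, n ≠ 0 → ContDiffOn ℝ n h (enormBall ℝ ρ) →
      ContDiffOn ℝ n k (enormBall ℝ R) := by
    intro n hn hcn t ht
    obtain ⟨hk1, hk2⟩ := hkmem t ht
    have h1 := hcn.contDiffAt (hI.mem_nhds hk1)
    have h2 := ((h1.differentiableAt hn).hasDerivAt.hasFDerivAt_equiv (hd _ hk1).ne')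
    have h3 := contDiffAt_of_local_inverse hn hI hk1 h1 (h2.fderiv ▸ ⟨_, rfl⟩) hkh
    rw [hk2] at h3
    exact h3.contDiffWithinAt
  refine ⟨R, k, ?_, hsm _ (by simp) hc, hsm _ (by simp), hkmem, fun r hr ↦ ⟨hR r hr, hkh r hr⟩⟩
  have := hR 0 h0I
  rw [h0] at this
  simpa using this

/-- `h` is an odd diffeomorphism which relates the radial densities `η` and `Ξ` in dimension
`N + 1`. -/
structure IsProfile (N : ℕ) (η Ξ : ℝ → ℝ) (ρ : ℝ≥0∞) (h : ℝ → ℝ) : Prop where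
  contDiffOn : ContDiffOn ℝ ∞ h (enormBall ℝ ρ)
  odd : ∀ t ∈ enormBall ℝ ρ, h (-t) = - h t
  deriv_pos : ∀ t ∈ enormBall ℝ ρ, 0 < deriv h t
  deriv_zero : deriv h 0 = 1
  density : ∀ t ∈ enormBall ℝ ρ, deriv h t ^ N * η t * t ^ N = Ξ (h t) * h t ^ N

/-- For the target density 1 the profile is β itself, on the full ball. -/
theorem exists_isProfile_one (hρ : 0 < ρ) {N : ℕ} (hN : N ≠ 0) {η : ℝ → ℝ}
    (hη : ContDiffOn ℝ ∞ η (enormBall ℝ ρ)) (he : ∀ t ∈ enormBall ℝ ρ, η (-t) = η t)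
    (hpos : ∀ t ∈ enormBall ℝ ρ, 0 < η t) (h1 : η 0 = 1) :
    ∃ h : ℝ → ℝ, IsProfile N η (fun _ ↦ 1) ρ h ∧
      (ContDiffOn ℝ ω η (enormBall ℝ ρ) → ContDiffOn ℝ ω h (enormBall ℝ ρ)) := by
  obtain ⟨β, hβ1, hβ2, hβ3, hβ4, hβ5, hβ6⟩ := exists_odd_solution hρ hN hη he hpos h1
  exact ⟨β, ⟨hβ1, hβ3, hβ4, hβ5, fun t ht ↦ by rw [hβ6 t ht, one_mul]⟩, hβ2⟩

/-- With β and α solving the separated equations for η and Ξ, the profile is h = α⁻¹ ∘ β. Its values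
lie in the domain of α, hence in the domain of Ξ. -/
theorem exists_isProfile (hρ : 0 < ρ) {δ : ℝ≥0∞} (hδ : 0 < δ) {N : ℕ} (hN : N ≠ 0) {η Ξ : ℝ → ℝ}
    (hη : ContDiffOn ℝ ∞ η (enormBall ℝ ρ)) (he : ∀ t ∈ enormBall ℝ ρ, η (-t) = η t)
    (hpos : ∀ t ∈ enormBall ℝ ρ, 0 < η t) (h1 : η 0 = 1)
    (hΞ : ContDiffOn ℝ ∞ Ξ (enormBall ℝ δ)) (heΞ : ∀ t ∈ enormBall ℝ δ, Ξ (-t) = Ξ t)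
    (hposΞ : ∀ t ∈ enormBall ℝ δ, 0 < Ξ t) (h1Ξ : Ξ 0 = 1) :
    ∃ ρ' : ℝ≥0∞, 0 < ρ' ∧ ρ' ≤ ρ ∧ ∃ h : ℝ → ℝ, IsProfile N η Ξ ρ' h ∧
      (∀ t ∈ enormBall ℝ ρ', h t ∈ enormBall ℝ δ) ∧
      (ContDiffOn ℝ ω η (enormBall ℝ ρ) → ContDiffOn ℝ ω Ξ (enormBall ℝ δ) →
        ContDiffOn ℝ ω h (enormBall ℝ ρ')) := by
  obtain ⟨β, hβ1, hβ2, hβ3, hβ4, hβ5, hβ6⟩ := exists_odd_solution hρ hN hη he hpos h1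
  obtain ⟨α, hα1, hα2, hα3, hα4, hα5, hα6⟩ := exists_odd_solution hδ hN hΞ heΞ hposΞ h1Ξ
  obtain ⟨S, k, hS, hk1, hk2, hk3, hk4⟩ := exists_odd_inverse hδ hα1 hα3 hα4
  have h0ρ : (0 : ℝ) ∈ enormBall ℝ ρ := zero_mem_enormBall hρ
  have h0δ : (0 : ℝ) ∈ enormBall ℝ δ := zero_mem_enormBall hδ
  have hβ0 : β 0 = 0 := by
    have := hβ3 0 h0ρ
    rw [neg_zero] at this
    linarith
  have hα0 : α 0 = 0 := by
    have := hα3 0 h0δ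
    rw [neg_zero] at this
    linarith
  have hk0 : k 0 = 0 := by
    have := (hk4 0 h0δ).2
    rwa [hα0] at this
  -- The range of β may exceed the range of α, the ball of radius S; this is the only reason for
  -- shrinking ρ.
  obtain ⟨ρ', hρ'0, hρ'ρ, hmaps⟩ : ∃ ρ' : ℝ≥0∞, 0 < ρ' ∧ ρ' ≤ ρ ∧
      MapsTo β (enormBall ℝ ρ') (enormBall ℝ S) := by
    have hβc : ContinuousAt β 0 :=
      hβ1.continuousOn.continuousAt ((isOpen_enormBall ρ).mem_nhds h0ρ)
    have h2 : β ⁻¹' enormBall ℝ S ∈ 𝓝 0 := by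
      refine hβc.preimage_mem_nhds ?_
      rw [hβ0]
      exact (isOpen_enormBall S).mem_nhds (zero_mem_enormBall hS)
    obtain ⟨ε, hε, hball⟩ := Metric.nhds_basis_eball.mem_iff.1 h2
    refine ⟨min ε ρ, lt_min hε hρ, min_le_right _ _, fun t ht ↦ hball ?_⟩
    simpa using lt_of_lt_of_le ht (min_le_left _ _)
  have hsub : enormBall ℝ ρ' ⊆ enormBall ℝ ρ := fun t ht ↦ lt_of_lt_of_le ht hρ'ρ
  have hδmem : ∀ t ∈ enormBall ℝ ρ', k (β t) ∈ enormBall ℝ δ := fun t ht ↦ (hk3 _ (hmaps ht)).1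
  have hder : ∀ t ∈ enormBall ℝ ρ', deriv (fun t ↦ k (β t)) t * deriv α (k (β t)) = deriv β t := by
    intro t ht
    have hh : DifferentiableAt ℝ (fun t ↦ k (β t)) t :=
      ((hk1.comp (hβ1.mono hsub) hmaps).contDiffAt
        ((isOpen_enormBall ρ').mem_nhds ht)).differentiableAt (by simp)
    have hα' : DifferentiableAt ℝ α (k (β t)) :=
      (hα1.contDiffAt ((isOpen_enormBall δ).mem_nhds (hδmem t ht))).differentiableAt (by simp)
    have h2 := (hα'.hasDerivAt.comp t hh.hasDerivAt).deriv
    have h3 : α ∘ (fun t ↦ k (β t)) =ᶠ[𝓝 t] β := by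
      filter_upwards [(isOpen_enormBall ρ').mem_nhds ht] with s hs using (hk3 _ (hmaps hs)).2
    rw [h3.deriv_eq] at h2
    rw [h2, mul_comm]
  refine ⟨ρ', hρ'0, hρ'ρ, fun t ↦ k (β t), ⟨?_, fun t ht ↦ ?_, fun t ht ↦ ?_, ?_, fun t ht ↦ ?_⟩,
    hδmem, fun hηω hΞω ↦ ?_⟩
  · exact hk1.comp (hβ1.mono hsub) hmaps
  · have h2 := (hk3 _ (hmaps ht)).2
    have h3 := hα3 _ (hδmem t ht)
    rw [h2, ← hβ3 t (hsub ht)] at h3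
    rw [← h3]
    exact (hk4 _ (neg_mem_enormBall (hδmem t ht))).2
  · have h2 := hder t ht
    have h3 := hβ4 t (hsub ht)
    rw [← h2] at h3
    exact (mul_pos_iff_of_pos_right (hα4 _ (hδmem t ht))).1 h3
  · have h2 := hder 0 (zero_mem_enormBall hρ'0)
    rw [hβ0, hk0, hα5, hβ5, mul_one] at h2
    exact h2
  · have h2 := hder t ht
    have h3 := hβ6 t (hsub ht)
    have h4 := hα6 _ (hδmem t ht)
    rw [(hk3 _ (hmaps ht)).2, ← h3, ← h2] at h4
    -- By the chain rule β' = α'(h) h', so the equations for β and α, both with right side β^N,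
    -- differ from the claim by the factor α'(h)^N.
    have h5 : 0 < deriv α (k (β t)) ^ N := pow_pos (hα4 _ (hδmem t ht)) N
    refine mul_left_cancel₀ h5.ne' ?_
    linear_combination -h4
  · exact (hk2 (hα2 hΞω)).comp ((hβ2 hηω).mono hsub) hmaps

end Profile

/-! ### The geodesic equation in coordinates and the Gauss lemma -/

section Christoffel

variable {E F : Type*} [NormedAddCommGroup E] [NormedSpace ℝ E]
  [NormedAddCommGroup F] [NormedSpace ℝ F]

noncomputable instance instNormedAddCommGroupForm : NormedAddCommGroup (E →L[ℝ] E →L[ℝ] ℝ) :=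
  ContinuousLinearMap.toNormedAddCommGroup

noncomputable instance instNormedSpaceForm : NormedSpace ℝ (E →L[ℝ] E →L[ℝ] ℝ) :=
  ContinuousLinearMap.toNormedSpace

/-- The Christoffel symbols of the first kind of a field of bilinear forms. -/
noncomputable def formChristoffel (G : E → E →L[ℝ] E →L[ℝ] ℝ) (x u v w : E) : ℝ :=
  (fderiv ℝ (fun z ↦ G z v w) x u + fderiv ℝ (fun z ↦ G z u w) x v
    - fderiv ℝ (fun z ↦ G z u v) x w) / 2

/-- The left hand side of the geodesic equation, with the index lowered. -/
noncomputable def geodesicExpr (G : E → E →L[ℝ] E →L[ℝ] ℝ) (c : ℝ → E) (t : ℝ) (w : E) : ℝ :=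
  G (c t) (deriv (deriv c) t) w + formChristoffel G (c t) (deriv c t) (deriv c t) w

theorem hasFDerivAt_form_apply {G : E → F →L[ℝ] F →L[ℝ] ℝ} {x : E} (hG : DifferentiableAt ℝ G x)
    {a b : E → F} {a' b' : E →L[ℝ] F} (ha : HasFDerivAt a a' x) (hb : HasFDerivAt b b' x) (u : E) :
    fderiv ℝ (fun z ↦ G z (a z) (b z)) x u
      = fderiv ℝ G x u (a x) (b x) + G x (a' u) (b x) + G x (a x) (b' u) := by
  have h := (hG.hasFDerivAt.clm_apply ha).clm_apply hb
  rw [h.fderiv]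
  simp
  ring

theorem fderiv_form_apply {G : E → F →L[ℝ] F →L[ℝ] ℝ} {x : E} (hG : DifferentiableAt ℝ G x)
    (a b : F) (u : E) : fderiv ℝ (fun z ↦ G z a b) x u = fderiv ℝ G x u a b := by
  simpa using hasFDerivAt_form_apply hG (hasFDerivAt_const a x) (hasFDerivAt_const b x) u

/-- The transformation law. Each derivative of G contributes two terms with the second derivative of
φ; by symmetry all of them cancel except two equal ones. -/
theorem formChristoffel_pullback {G : E → E →L[ℝ] E →L[ℝ] ℝ} {G' : F → F →L[ℝ] F →L[ℝ] ℝ}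
    {φ : E → F} {x : E} (hφ : ContDiffAt ℝ 2 φ x) (hG' : DifferentiableAt ℝ G' (φ x))
    (hsymm : ∀ a b, G' (φ x) a b = G' (φ x) b a)
    (hG : ∀ᶠ z in 𝓝 x, ∀ a b, G z a b = G' (φ z) (fderiv ℝ φ z a) (fderiv ℝ φ z b)) (u v w : E) :
    formChristoffel G x u v w
      = formChristoffel G' (φ x) (fderiv ℝ φ x u) (fderiv ℝ φ x v) (fderiv ℝ φ x w)
        + G' (φ x) (fderiv ℝ (fderiv ℝ φ) x u v) (fderiv ℝ φ x w) := by
  have hφ1 : DifferentiableAt ℝ φ x := hφ.differentiableAt (by simp)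
  have hφ2 : DifferentiableAt ℝ (fderiv ℝ φ) x :=
    (hφ.fderiv_right (m := 1) (by norm_num)).differentiableAt (by simp)
  have hs : IsSymmSndFDerivAt ℝ φ x := hφ.isSymmSndFDerivAt (by simp)
  have key : ∀ a b c : E, fderiv ℝ (fun z ↦ G z a b) x c
      = fderiv ℝ G' (φ x) (fderiv ℝ φ x c) (fderiv ℝ φ x a) (fderiv ℝ φ x b)
        + G' (φ x) (fderiv ℝ (fderiv ℝ φ) x c a) (fderiv ℝ φ x b)
        + G' (φ x) (fderiv ℝ φ x a) (fderiv ℝ (fderiv ℝ φ) x c b) := by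
    intro a b c
    have e : (fun z ↦ G z a b) =ᶠ[𝓝 x] fun z ↦ G' (φ z) (fderiv ℝ φ z a) (fderiv ℝ φ z b) :=
      hG.mono fun z hz ↦ hz a b
    have hcomp : HasFDerivAt (fun z ↦ G' (φ z)) (fderiv ℝ G' (φ x) ∘L fderiv ℝ φ x) x :=
      hG'.hasFDerivAt.comp x hφ1.hasFDerivAt
    have hd : ∀ a : E, HasFDerivAt (fun z ↦ fderiv ℝ φ z a)
        ((fderiv ℝ (fderiv ℝ φ) x).flip a) x := fun a ↦ by
      simpa using hφ2.hasFDerivAt.clm_apply (hasFDerivAt_const a x)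
    rw [e.fderiv_eq, hasFDerivAt_form_apply hcomp.differentiableAt (hd a) (hd b), hcomp.fderiv]
    simp
  simp only [formChristoffel, key, fderiv_form_apply hG']
  rw [hs.eq v u, hs.eq w u, hs.eq w v, hsymm _ (fderiv ℝ φ x v)]
  ring

/-- The second derivative of φ that enters the acceleration of φ ∘ c is the inhomogeneous term of
the Christoffel symbols, so the geodesic equation with lowered index transforms as a covector. -/
theorem geodesicExpr_pullback {G : E → E →L[ℝ] E →L[ℝ] ℝ} {G' : F → F →L[ℝ] F →L[ℝ] ℝ}
    {φ : E → F} {c : ℝ → E} {t : ℝ} (hc : ContDiffAt ℝ 2 c t) (hφ : ContDiffAt ℝ 2 φ (c t))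
    (hG' : DifferentiableAt ℝ G' (φ (c t)))
    (hsymm : ∀ a b, G' (φ (c t)) a b = G' (φ (c t)) b a)
    (hG : ∀ᶠ z in 𝓝 (c t), ∀ a b, G z a b = G' (φ z) (fderiv ℝ φ z a) (fderiv ℝ φ z b)) (w : E) :
    geodesicExpr G' (φ ∘ c) t (fderiv ℝ φ (c t) w) = geodesicExpr G c t w := by
  have hφ1 : ∀ᶠ z in 𝓝 (c t), DifferentiableAt ℝ φ z :=
    (hφ.eventually (by simp)).mono fun z hz ↦ hz.differentiableAt (by simp)
  have hφ2 : DifferentiableAt ℝ (fderiv ℝ φ) (c t) :=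
    (hφ.fderiv_right (m := 1) (by norm_num)).differentiableAt (by simp)
  have hc1 : ∀ᶠ s in 𝓝 t, DifferentiableAt ℝ c s :=
    (hc.eventually (by simp)).mono fun z hz ↦ hz.differentiableAt (by simp)
  have hc2 : DifferentiableAt ℝ (deriv c) t := by
    have := (hc.fderiv_right (m := 1) (by norm_num)).differentiableAt (by simp)
    exact this.clm_apply (differentiableAt_const 1)
  have h1 : deriv (φ ∘ c) =ᶠ[𝓝 t] fun s ↦ fderiv ℝ φ (c s) (deriv c s) := by
    filter_upwards [hc.continuousAt.tendsto.eventually hφ1, hc1] with s hs1 hs2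
    exact (hs1.hasFDerivAt.comp_hasDerivAt s hs2.hasDerivAt).deriv
  have h2 : HasDerivAt (fun s ↦ fderiv ℝ φ (c s) (deriv c s))
      (fderiv ℝ (fderiv ℝ φ) (c t) (deriv c t) (deriv c t)
        + fderiv ℝ φ (c t) (deriv (deriv c) t)) t :=
    (hφ2.hasFDerivAt.comp_hasDerivAt t hc1.self_of_nhds.hasDerivAt).clm_apply hc2.hasDerivAt
  rw [geodesicExpr, geodesicExpr, h1.deriv_eq, h2.deriv, h1.self_of_nhds,
    formChristoffel_pullback hφ hG' hsymm hG, hG.self_of_nhds]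
  simp only [Function.comp_apply, map_add, add_apply]
  ring

/-- **Gauss lemma**, in coordinates in which the rays from the origin are geodesics. -/
theorem gauss_lemma {H : E → E →L[ℝ] E →L[ℝ] ℝ} {ρ : ℝ≥0∞}
    (hH : ∀ x ∈ enormBall E ρ, DifferentiableAt ℝ H x)
    (hsymm : ∀ x ∈ enormBall E ρ, ∀ a b, H x a b = H x b a)
    (hline : ∀ (v : E) (t : ℝ), t • v ∈ enormBall E ρ → ∀ w, formChristoffel H (t • v) v v w = 0)
    {x : E} (hx : x ∈ enormBall E ρ) (w : E) : H x x w = H 0 x w := by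
  have hseg : ∀ {x : E}, x ∈ enormBall E ρ → ∀ t ∈ Icc (0 : ℝ) 1, t • x ∈ enormBall E ρ :=
    fun {x} hx t ht ↦ mem_enormBall_of_norm_le hx (by
      rw [norm_smul, Real.norm_of_nonneg ht.1]
      exact mul_le_of_le_one_left (norm_nonneg _) ht.2)
  have hHd : ∀ x ∈ enormBall E ρ, ∀ a b : E, ∀ t ∈ Icc (0 : ℝ) 1,
      HasDerivAt (fun t : ℝ ↦ H (t • x) a b) (fderiv ℝ H (t • x) x a b) t := by
    intro x hx a b t ht
    have h1 : HasDerivAt (fun t : ℝ ↦ t • x) x t := by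
      simpa using (hasDerivAt_id t).smul_const x
    have h2 := (hH _ (hseg hx t ht)).hasFDerivAt.comp_hasDerivAt t h1
    simpa using (h2.clm_apply (hasDerivAt_const t a)).clm_apply (hasDerivAt_const t b)
  -- The geodesic equation of the ray, written out.
  have hline' : ∀ x ∈ enormBall E ρ, ∀ t ∈ Icc (0 : ℝ) 1, ∀ w,
      2 * fderiv ℝ H (t • x) x x w = fderiv ℝ H (t • x) w x x := by
    intro x hx t ht w
    have := hline x t (hseg hx t ht) w
    simp only [formChristoffel, fderiv_form_apply (hH _ (hseg hx t ht))] at this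
    linarith
  -- Rays have constant speed: take w = x in `hline'`.
  have hnorm : ∀ x ∈ enormBall E ρ, H x x x = H 0 x x := by
    intro x hx
    have hd0 : ∀ t ∈ Icc (0 : ℝ) 1, HasDerivAt (fun t : ℝ ↦ H (t • x) x x) 0 t := by
      intro t ht
      refine (hHd x hx x x t ht).congr_deriv ?_
      have := hline' x hx t ht x
      linarith
    have h2 := constant_of_has_deriv_right_zero
      (fun t ht ↦ (hd0 t ht).continuousAt.continuousWithinAt)
      (fun t ht ↦ (hd0 t (Ico_subset_Icc_self ht)).hasDerivWithinAt) 1 ⟨zero_le_one, le_rfl⟩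
    simpa using h2
  have h0 : (0 : E) ∈ enormBall E ρ := by simpa using hseg hx 0 ⟨le_rfl, zero_le_one⟩
  -- The identity `hnorm` differentiated at z in the direction w.
  have hpolar : ∀ z ∈ enormBall E ρ, fderiv ℝ H z w z z = 2 * (H 0 z w - H z z w) := by
    intro z hz
    have e : (fun z ↦ H z z z) =ᶠ[𝓝 z] fun z ↦ H 0 z z := by
      filter_upwards [(isOpen_enormBall ρ).mem_nhds hz] with y hy using hnorm y hy
    have h1 := hasFDerivAt_form_apply (hH z hz) (hasFDerivAt_id z) (hasFDerivAt_id z) w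
    have h2 := hasFDerivAt_form_apply (differentiableAt_const (H 0)) (hasFDerivAt_id z)
      (hasFDerivAt_id z) w
    simp only [id] at h1 h2
    rw [e.fderiv_eq, h2] at h1
    simp only [fderiv_fun_const, Pi.zero_apply, zero_apply,
      ContinuousLinearMap.id_apply] at h1
    rw [hsymm 0 h0 w z, hsymm z hz w z] at h1
    linarith
  -- By `hline'` and `hpolar` the defect of the claim at t x, multiplied by t, is constant along the
  -- ray. It vanishes at t = 0, hence also at t = 1.
  have hd : ∀ t ∈ Icc (0 : ℝ) 1,
      HasDerivAt (fun t : ℝ ↦ t * (H (t • x) x w - H 0 x w)) 0 t := by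
    intro t ht
    refine ((hasDerivAt_id t).mul ((hHd x hx x w t ht).sub_const (H 0 x w))).congr_deriv ?_
    simp only [id, one_mul]
    rcases eq_or_lt_of_le ht.1 with rfl | hpos
    · simp
    · have h1 := hline' x hx t ht w
      have h2 := hpolar _ (hseg hx t ht)
      simp only [map_smul, smul_apply, smul_eq_mul] at h2
      rw [← h1] at h2
      have h3 : (2 * t) * (H (t • x) x w - H 0 x w + t * fderiv ℝ H (t • x) x x w) = 0 := by
        linear_combination h2
      exact (mul_eq_zero.1 h3).resolve_left (by positivity)
  have h2 := constant_of_has_deriv_right_zero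
    (fun t ht ↦ (hd t ht).continuousAt.continuousWithinAt)
    (fun t ht ↦ (hd t (Ico_subset_Icc_self ht)).hasDerivWithinAt) 1 ⟨zero_le_one, le_rfl⟩
  simp only [one_mul, one_smul, zero_mul] at h2
  linarith

theorem form_apply_sq_le {B : E →L[ℝ] E →L[ℝ] ℝ} (hs : ∀ a b, B a b = B b a)
    (hp : ∀ a, 0 ≤ B a a) (a b : E) : B a b ^ 2 ≤ B a a * B b b := by
  have := LinearMap.BilinForm.apply_sq_le_of_symm
    (B := (ContinuousLinearMap.coeLM ℝ).comp B.toLinearMap) hp ⟨hs⟩ a b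
  simpa using this

end Christoffel

/-! ### Radial conformal changes and radial maps in normal coordinates -/

section Radial

variable {E : Type*} [NormedAddCommGroup E] [InnerProductSpace ℝ E]

/-- Reparametrized rays are geodesics of the conformal metric `f(‖x‖)² H`, when the rays are
geodesics of `H`. -/
theorem geodesicExpr_conformal_ray {H : E → E →L[ℝ] E →L[ℝ] ℝ} {ρ : ℝ≥0∞}
    (hH : ∀ x ∈ enormBall E ρ, DifferentiableAt ℝ H x)
    (hsymm : ∀ x ∈ enormBall E ρ, ∀ a b, H x a b = H x b a)
    (hline : ∀ (v : E) (t : ℝ), t • v ∈ enormBall E ρ → ∀ w, formChristoffel H (t • v) v v w = 0)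
    (h0 : ∀ a b, H 0 a b = inner ℝ a b) {f : ℝ → ℝ} (hf : ContDiffOn ℝ ∞ f (enormBall ℝ ρ))
    (he : ∀ t ∈ enormBall ℝ ρ, f (-t) = f t) {a : ℝ → ℝ} {v : E} {t : ℝ}
    (hat : a t • v ∈ enormBall E ρ) (ha : ContDiffAt ℝ 2 a t)
    (hfa : ∀ᶠ s in 𝓝 t, f (a s * ‖v‖) * deriv a s = 1) (w : E) :
    geodesicExpr (fun x ↦ (f ‖x‖) ^ 2 • H x) (fun s ↦ a s • v) t w = 0 := by
  have ha1 : ∀ᶠ s in 𝓝 t, DifferentiableAt ℝ a s :=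
    (ha.eventually (by simp)).mono fun z hz ↦ hz.differentiableAt (by simp)
  have ha2 : DifferentiableAt ℝ (deriv a) t := by
    have := (ha.fderiv_right (m := 1) (by norm_num)).differentiableAt (by simp)
    exact this.clm_apply (differentiableAt_const 1)
  have hc1 : deriv (fun s ↦ a s • v) =ᶠ[𝓝 t] fun s ↦ deriv a s • v :=
    ha1.mono fun s hs ↦ (hs.hasDerivAt.smul_const v).deriv
  have hc2 : deriv (deriv (fun s ↦ a s • v)) t = deriv (deriv a) t • v := by
    rw [hc1.deriv_eq, (ha2.hasDerivAt.smul_const v).deriv]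
  set x := a t • v with hx
  have hmem : a t * ‖v‖ ∈ enormBall ℝ ρ :=
    mem_enormBall_of_norm_le hat (by simp [hx, norm_smul])
  have hfd := hf.differentiableOn (by simp)
  have hψ : HasFDerivAt (fun x : E ↦ f ‖x‖) (radialDeriv f ‖x‖ • innerSL ℝ x) x :=
    hasFDerivAt_radial hfd he hat
  have hfx : f ‖x‖ = f (a t * ‖v‖) := by
    rw [hx, norm_smul, Real.norm_eq_abs]
    rcases abs_choice (a t) with h | h
    · rw [h]
    · rw [h, neg_mul, he _ hmem]
  have hrx : radialDeriv f ‖x‖ = radialDeriv f (a t * ‖v‖) := by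
    rw [hx, norm_smul, Real.norm_eq_abs]
    rcases abs_choice (a t) with h | h
    · rw [h]
    · rw [h, neg_mul, radialDeriv_even he hmem]
  have hρ : 0 < ρ := lt_of_le_of_lt zero_le hat
  have hfd' : HasDerivAt (fun s ↦ f (a s * ‖v‖) * deriv a s)
      (deriv f (a t * ‖v‖) * (deriv a t * ‖v‖) * deriv a t
        + f (a t * ‖v‖) * deriv (deriv a) t) t := by
    have h1 : HasDerivAt f (deriv f (a t * ‖v‖)) (a t * ‖v‖) :=
      (hfd.differentiableAt ((isOpen_enormBall ρ).mem_nhds hmem)).hasDerivAt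
    exact (h1.comp t (ha1.self_of_nhds.hasDerivAt.mul_const ‖v‖)).mul ha2.hasDerivAt
  -- Unit speed of the reparametrization, f(a ‖v‖) a' = 1, differentiated once: this is the radial
  -- part of the geodesic equation.
  have hode : deriv f (a t * ‖v‖) * (deriv a t * ‖v‖) * deriv a t
        + f (a t * ‖v‖) * deriv (deriv a) t = 0 := by
    rw [← hfd'.deriv, Filter.EventuallyEq.deriv_eq (f := fun _ ↦ (1 : ℝ)) hfa, deriv_const]
  rw [← mul_radialDeriv (deriv_zero_of_even hρ he), ← hrx, ← hfx] at hode
  have hHx := hH x hat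
  have hD : ∀ u b c : E, fderiv ℝ (fun z ↦ ((f ‖z‖) ^ 2 • H z) b c) x u
      = 2 * f ‖x‖ * (radialDeriv f ‖x‖ * inner ℝ x u) * H x b c
        + (f ‖x‖) ^ 2 * fderiv ℝ H x u b c := by
    intro u b c
    have h1 := (hψ.pow 2).smul hHx.hasFDerivAt
    have h2 := fderiv_form_apply h1.differentiableAt b c u
    rw [h1.fderiv] at h2
    refine h2.trans ?_
    simp
    ring
  -- The Gauss lemma at x = a(t) v. The factor a(t), which may vanish, need not be cancelled: the
  -- gradient of the conformal factor carries it too.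
  have hQ : ∀ w, a t * H x v w = a t * inner ℝ v w := fun w ↦ by
    have := gauss_lemma hH hsymm hline hat w
    rw [h0] at this
    simpa [hx, inner_smul_left] using this
  have hch := hline v (a t) hat w
  simp only [formChristoffel, fderiv_form_apply hHx, ← hx] at hch
  have hix : ∀ u, inner ℝ x u = a t * inner ℝ v u := fun u ↦ by
    rw [hx, real_inner_smul_left]
  simp only [geodesicExpr, formChristoffel]
  rw [hc2, hc1.self_of_nhds]
  simp only [← hx, hD]
  simp only [hix, map_smul, smul_apply, smul_eq_mul, inner_smul_right,
    real_inner_self_eq_norm_sq]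
  have hQv := hQ v
  have hQw := hQ w
  rw [real_inner_self_eq_norm_sq] at hQv
  linear_combination f ‖x‖ * H x v w * hode
    - f ‖x‖ * radialDeriv f ‖x‖ * deriv a t ^ 2 * inner ℝ v w * hQv
    + f ‖x‖ * radialDeriv f ‖x‖ * deriv a t ^ 2 * ‖v‖ ^ 2 * hQw
    + f ‖x‖ ^ 2 * deriv a t ^ 2 * hch

/-- The derivative at `x` of the map `x ↦ q(‖x‖) x`. -/
noncomputable def radialMapDeriv (q : ℝ → ℝ) (x : E) : E →L[ℝ] E :=
  q ‖x‖ • ContinuousLinearMap.id ℝ E + (radialDeriv q ‖x‖ • innerSL ℝ x).smulRight x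

theorem hasFDerivAt_radialMap {q : ℝ → ℝ} {ρ : ℝ≥0∞} (hq : DifferentiableOn ℝ q (enormBall ℝ ρ))
    (he : ∀ t ∈ enormBall ℝ ρ, q (-t) = q t) {x : E} (hx : x ∈ enormBall E ρ) :
    HasFDerivAt (fun x ↦ q ‖x‖ • x) (radialMapDeriv q x) x :=
  (hasFDerivAt_radial hq he hx).smul (hasFDerivAt_id x)

/-- The derivative is q times a rank one perturbation of the identity: it multiplies by q on the
orthogonal complement of x and by q + r q' along x. -/
theorem det_radialMapDeriv {m : ℕ} (q : ℝ → ℝ) (x : Eu (m + 1)) (hq : q ‖x‖ ≠ 0) :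
    Matrix.det (Matrix.of fun i j ↦ radialMapDeriv q x (EuclideanSpace.single j 1) i)
      = q ‖x‖ ^ m * (q ‖x‖ + radialDeriv q ‖x‖ * ‖x‖ ^ 2) := by
  have e : (Matrix.of fun i j ↦ radialMapDeriv q x (EuclideanSpace.single j (1 : ℝ)) i)
      = q ‖x‖ • (1 + Matrix.replicateCol Unit x.ofLp
          * Matrix.replicateRow Unit ((radialDeriv q ‖x‖ / q ‖x‖) • x.ofLp)) := by
    ext i j
    simp [radialMapDeriv, Matrix.mul_apply, Matrix.one_apply, mul_add,
      EuclideanSpace.inner_single_right]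
    field_simp
  rw [e, Matrix.det_smul, Matrix.det_one_add_replicateCol_mul_replicateRow, Fintype.card_fin,
    smul_dotProduct, EuclideanSpace.real_norm_sq_eq x]
  simp only [dotProduct, smul_eq_mul, ← sq]
  field_simp
  ring

end Radial

theorem two_le_infty : (2 : WithTop ℕ∞) ≤ (∞ : WithTop ℕ∞) :=
  WithTop.coe_le_coe.2 (le_top : (2 : ℕ∞) ≤ ⊤)

/-! ### Pullbacks of the metric and charts -/

section Pullback

variable {m : ℕ} {M : Type*} [TopologicalSpace M] [ChartedSpace (Eu m) M]

/-- The derivative of a map into a manifold, all the tangent spaces being the same type. -/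
noncomputable def mderiv (N : Eu m → M) (x : Eu m) : Eu m →L[ℝ] Eu m :=
  mfderiv (𝓡 m) (𝓡 m) N x

/-- The value at `p` of a field of bilinear forms, as a form on the model space. -/
def formAt (g : FormField m M) (p : M) : Eu m →L[ℝ] Eu m →L[ℝ] ℝ := g p

/-- The pullback of a field of bilinear forms. -/
noncomputable def pullbackForm (g : FormField m M) (N : Eu m → M) (x : Eu m) :
    Eu m →L[ℝ] Eu m →L[ℝ] ℝ :=
  (formAt g (N x)).bilinearComp (mderiv N x) (mderiv N x)

theorem pullbackForm_apply (g : FormField m M) (N : Eu m → M) (x a b : Eu m) :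
    pullbackForm g N x a b = formAt g (N x) (mderiv N x a) (mderiv N x b) := rfl

/-- The expression of the metric in the preferred chart at `p`. -/
noncomputable def chartMetric (g : FormField m M) (p : M) : Eu m → Eu m →L[ℝ] Eu m →L[ℝ] ℝ :=
  pullbackForm g (extChartAt (𝓡 m) p).symm

/-- The part of the target of the preferred chart at `p` which corresponds to `U`. -/
def chartDomain (U : Set M) (p : M) : Set (Eu m) :=
  (extChartAt (𝓡 m) p).target ∩ (extChartAt (𝓡 m) p).symm ⁻¹' U

/-- `g` is a Riemannian metric of class `C^n` on the open set `U`. -/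
structure IsMetric (n : WithTop ℕ∞) (U : Set M) (g : FormField m M) : Prop where
  isOpen : IsOpen U
  symm : ∀ p ∈ U, ∀ a b : Eu m, formAt g p a b = formAt g p b a
  pos : ∀ p ∈ U, ∀ a : Eu m, a ≠ 0 → 0 < formAt g p a a
  contDiffOn : ∀ (p : M) (a b : Eu m),
    ContDiffOn ℝ n (fun y ↦ chartMetric g p y a b) (chartDomain U p)

theorem isOpen_chartDomain {U : Set M} (hU : IsOpen U) (p : M) :
    IsOpen (chartDomain (m := m) U p) :=
  (continuousOn_extChartAt_symm p).isOpen_inter_preimage (isOpen_extChartAt_target p) hU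

theorem IsMetric.contDiffOn_chartMetric {n : WithTop ℕ∞} {U : Set M} {g : FormField m M}
    (hg : IsMetric n U g) (p : M) : ContDiffOn ℝ n (chartMetric g p) (chartDomain U p) :=
  contDiffOn_clm_apply.2 fun a ↦ contDiffOn_clm_apply.2 fun b ↦ hg.contDiffOn p a b

/-- The tangent space at γ(t) is identified with the model space through the preferred chart at
γ(t), so that chart computes the velocity. -/
theorem mfderiv_curve_eq_deriv {γ : ℝ → M} {t : ℝ}
    (hγ : MDifferentiableAt 𝓘(ℝ, ℝ) (𝓡 m) γ t) :
    (mfderiv 𝓘(ℝ, ℝ) (𝓡 m) γ t (1 : ℝ) : Eu m) = deriv (coordCurve (m := m) (γ t) γ) t := by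
  have h : (mfderiv 𝓘(ℝ, ℝ) (𝓡 m) γ t (1 : ℝ) : Eu m)
      = (fderivWithin ℝ (writtenInExtChartAt 𝓘(ℝ, ℝ) (𝓡 m) t γ) (range 𝓘(ℝ, ℝ))
          (extChartAt 𝓘(ℝ, ℝ) t t) : ℝ →L[ℝ] Eu m) 1 :=
    congrArg (fun L : ℝ →L[ℝ] Eu m ↦ L 1) hγ.mfderiv
  rw [h]
  simp only [writtenInExtChartAt, extChartAt_model_space_eq_id, PartialEquiv.refl_symm,
    PartialEquiv.refl_coe, Function.comp_id, modelWithCornersSelf_coe, range_id, id_eq,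
    fderivWithin_univ]
  rfl

variable [IsManifold (𝓡 m) ∞ M]

/-- Near x, N factors through the chart at p; the chain rule reduces pullbacks along N to pullbacks
between open sets of the model space. -/
theorem pullbackForm_eq_chart (g : FormField m M) {N : Eu m → M} {x : Eu m} {p : M}
    (hN : MDifferentiableAt (𝓡 m) (𝓡 m) N x) (hp : N x ∈ (chartAt (Eu m) p).source) :
    mderiv N x = mderiv (extChartAt (𝓡 m) p).symm (extChartAt (𝓡 m) p (N x)) ∘L
      fderiv ℝ (extChartAt (𝓡 m) p ∘ N) x ∧
    ∀ a b, pullbackForm g N x a b = chartMetric g p (extChartAt (𝓡 m) p (N x))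
      (fderiv ℝ (extChartAt (𝓡 m) p ∘ N) x a) (fderiv ℝ (extChartAt (𝓡 m) p ∘ N) x b) := by
  have hd : MDifferentiableAt (𝓡 m) (𝓡 m) (extChartAt (𝓡 m) p) (N x) :=
    mdifferentiableAt_extChartAt hp
  have hps : N x ∈ (extChartAt (𝓡 m) p).source := by rwa [extChartAt_source]
  have hsymm : MDifferentiableAt (𝓡 m) (𝓡 m) (extChartAt (𝓡 m) p).symm
      (extChartAt (𝓡 m) p (N x)) :=
    ((contMDiffOn_extChartAt_symm (n := ∞) p).contMDiffAt
      ((isOpen_extChartAt_target p).mem_nhds ((extChartAt (𝓡 m) p).map_source hps))).mdifferentiableAt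
      (by simp)
  have hφ : MDifferentiableAt (𝓡 m) (𝓡 m) (extChartAt (𝓡 m) p ∘ N) x := hd.comp x hN
  have e : N =ᶠ[𝓝 x] (extChartAt (𝓡 m) p).symm ∘ (extChartAt (𝓡 m) p ∘ N) := by
    filter_upwards [hN.continuousAt.preimage_mem_nhds
      ((isOpen_extChartAt_source (I := 𝓡 m) p).mem_nhds hps)] with z hz
    exact ((extChartAt (𝓡 m) p).left_inv hz).symm
  have h1 : mderiv N x = mderiv (extChartAt (𝓡 m) p).symm (extChartAt (𝓡 m) p (N x)) ∘L
      fderiv ℝ (extChartAt (𝓡 m) p ∘ N) x := by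
    have h2 := mfderiv_comp x hsymm hφ
    rw [← e.mfderiv_eq, mfderiv_eq_fderiv (f := extChartAt (𝓡 m) p ∘ N)] at h2
    exact h2
  refine ⟨h1, fun a b ↦ ?_⟩
  rw [chartMetric, pullbackForm_apply, pullbackForm_apply, h1,
    (extChartAt (𝓡 m) p).left_inv hps]
  rfl

theorem mderiv_comp {N : Eu m → M} {φ : Eu m → Eu m} {x : Eu m}
    (hN : MDifferentiableAt (𝓡 m) (𝓡 m) N (φ x)) (hφ : DifferentiableAt ℝ φ x) :
    mderiv (N ∘ φ) x = mderiv N (φ x) ∘L fderiv ℝ φ x := by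
  have h2 := mfderiv_comp x hN hφ.mdifferentiableAt
  rw [mfderiv_eq_fderiv (f := φ)] at h2
  exact h2

theorem contMDiffAt_extChartAt_comp {n : WithTop ℕ∞} [IsManifold (𝓡 m) n M] {N : Eu m → M}
    {x : Eu m} {p : M} (hN : ContMDiffAt (𝓡 m) (𝓡 m) n N x)
    (hp : N x ∈ (chartAt (Eu m) p).source) :
    ContDiffAt ℝ n (extChartAt (𝓡 m) p ∘ N) x :=
  ((contMDiffAt_extChartAt' hp).comp x hN).contDiffAt

theorem contMDiffAt_extChartAt_symm {n : WithTop ℕ∞} [IsManifold (𝓡 m) n M] {p : M} {y : Eu m}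
    (hy : y ∈ (extChartAt (𝓡 m) p).target) :
    ContMDiffAt (𝓡 m) (𝓡 m) n (extChartAt (𝓡 m) p).symm y :=
  (contMDiffOn_extChartAt_symm p).contMDiffAt ((isOpen_extChartAt_target p).mem_nhds hy)

theorem injective_mderiv_extChartAt_symm {p : M} {y : Eu m}
    (hy : y ∈ (extChartAt (𝓡 m) p).target) :
    Function.Injective (mderiv (extChartAt (𝓡 m) p).symm y) := by
  have h1 := contMDiffAt_extChartAt_symm (n := ∞) hy
  have h2 := (extChartAt (𝓡 m) p).map_target hy
  have h3 : (extChartAt (𝓡 m) p).symm y ∈ (chartAt (Eu m) p).source := by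
    rwa [extChartAt_source] at h2
  have h4 := (pullbackForm_eq_chart (fun _ ↦ 0) (h1.mdifferentiableAt (by simp)) h3).1
  have e : extChartAt (𝓡 m) p ∘ (extChartAt (𝓡 m) p).symm =ᶠ[𝓝 y] id := by
    filter_upwards [(isOpen_extChartAt_target (I := 𝓡 m) p).mem_nhds hy] with z hz
    exact (extChartAt (𝓡 m) p).right_inv hz
  have h5 := (contMDiffAt_extChartAt_comp h1 h3).differentiableAt (by simp)
  have h6 := mfderiv_comp y (mdifferentiableAt_extChartAt h3) (h1.mdifferentiableAt (by simp))
  rw [mfderiv_eq_fderiv (f := extChartAt (𝓡 m) p ∘ (extChartAt (𝓡 m) p).symm), e.fderiv_eq,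
    fderiv_id] at h6
  intro a b hab
  have h7 : ∀ a : Eu m, a = (mfderiv (𝓡 m) (𝓡 m) (extChartAt (𝓡 m) p)
      ((extChartAt (𝓡 m) p).symm y) (mderiv (extChartAt (𝓡 m) p).symm y a) : Eu m) := fun a ↦
    congrArg (fun L : Eu m →L[ℝ] Eu m ↦ L a) h6
  rw [h7 a, h7 b, hab]

theorem injective_fderiv_extChartAt_comp {N : Eu m → M} {x : Eu m} {p : M}
    (hN : MDifferentiableAt (𝓡 m) (𝓡 m) N x) (hp : N x ∈ (chartAt (Eu m) p).source)
    (hi : Function.Injective (mderiv N x)) :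
    Function.Injective (fderiv ℝ (extChartAt (𝓡 m) p ∘ N) x) := by
  rw [(pullbackForm_eq_chart (fun _ ↦ 0) hN hp).1] at hi
  exact Function.Injective.of_comp (f := mderiv (extChartAt (𝓡 m) p).symm _) hi

theorem IsMetric.chartMetric_symm {n : WithTop ℕ∞} {U : Set M} {g : FormField m M}
    (hg : IsMetric n U g) {p : M} {y : Eu m} (hy : y ∈ chartDomain U p) (a b : Eu m) :
    chartMetric g p y a b = chartMetric g p y b a :=
  hg.symm _ hy.2 _ _

theorem IsMetric.chartMetric_pos {n : WithTop ℕ∞} {U : Set M} {g : FormField m M}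
    (hg : IsMetric n U g) {p : M} {y : Eu m} (hy : y ∈ chartDomain U p) {a : Eu m} (ha : a ≠ 0) :
    0 < chartMetric g p y a a :=
  hg.pos _ hy.2 _ fun h ↦ ha (injective_mderiv_extChartAt_symm hy.1 (h.trans (map_zero _).symm))

theorem extChartAt_mem_chartDomain {U : Set M} {p q : M} (hq : q ∈ (chartAt (Eu m) p).source)
    (hU : q ∈ U) : extChartAt (𝓡 m) p q ∈ chartDomain U p := by
  have h : q ∈ (extChartAt (𝓡 m) p).source := by rwa [extChartAt_source]
  refine ⟨(extChartAt (𝓡 m) p).map_source h, ?_⟩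
  rwa [mem_preimage, (extChartAt (𝓡 m) p).left_inv h]

/-- The geodesic equation at a point of a curve, pulled back by a parametrization. -/
theorem geodesicExpr_chart_iff {n : WithTop ℕ∞} {U : Set M} {g : FormField m M}
    (hg : IsMetric n U g) (hn : 1 ≤ n) {N : Eu m → M} {c : ℝ → Eu m} {t : ℝ}
    (hN : ∀ᶠ z in 𝓝 (c t), ContMDiffAt (𝓡 m) (𝓡 m) ∞ N z) (hi : Function.Injective (mderiv N (c t)))
    (hU : N (c t) ∈ U) (hc : ContDiffAt ℝ 2 c t) {p : M}
    (hp : N (c t) ∈ (chartAt (Eu m) p).source) :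
    (∀ w, geodesicExpr (chartMetric g p) (coordCurve p (N ∘ c)) t w = 0) ↔
      ∀ w, geodesicExpr (pullbackForm g N) c t w = 0 := by
  have hmem := extChartAt_mem_chartDomain hp hU
  have hN1 := hN.self_of_nhds
  have hsrc : ∀ᶠ z in 𝓝 (c t), N z ∈ (chartAt (Eu m) p).source :=
    hN1.continuousAt.preimage_mem_nhds ((chartAt (Eu m) p).open_source.mem_nhds hp)
  have hφ : ContDiffAt ℝ 2 (extChartAt (𝓡 m) p ∘ N) (c t) :=
    ContDiffAt.of_le (n := (∞ : WithTop ℕ∞)) (contMDiffAt_extChartAt_comp hN1 hp)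
      two_le_infty
  have key := fun w ↦ geodesicExpr_pullback (G := pullbackForm g N) (G' := chartMetric g p)
    (φ := extChartAt (𝓡 m) p ∘ N) hc hφ
    (((hg.contDiffOn_chartMetric p).contDiffAt
      ((isOpen_chartDomain hg.isOpen p).mem_nhds hmem)).differentiableAt
        (zero_lt_one.trans_le hn).ne')
    (fun a b ↦ hg.chartMetric_symm hmem a b)
    (by
      filter_upwards [hN, hsrc] with z hz1 hz2
      exact (pullbackForm_eq_chart g (hz1.mdifferentiableAt (by simp)) hz2).2) w
  -- Source and target have the same dimension, so every test vector w in the chart comes from one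
  -- in the source.
  have hs : Function.Surjective (fderiv ℝ (extChartAt (𝓡 m) p ∘ N) (c t)) :=
    LinearMap.injective_iff_surjective.1
      (injective_fderiv_extChartAt_comp (hN1.mdifferentiableAt (by simp)) hp hi)
  constructor
  · intro h w
    rw [← key w]
    exact h _
  · intro h w
    obtain ⟨w', rfl⟩ := hs w
    exact (key w').trans (h w')

end Pullback

/-! ### Geodesics at a single time, and the geodesic equation solved for the acceleration -/

section Geodesic

variable {m : ℕ} {M : Type*} [TopologicalSpace M] [ChartedSpace (Eu m) M]

/-- `γ` is a geodesic of `(U, g)` at the time `t`. -/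
structure GeodesicAt (U : Set M) (g : FormField m M) (γ : ℝ → M) (t : ℝ) : Prop where
  mem : γ t ∈ U
  contMDiffAt : ContMDiffAt 𝓘(ℝ, ℝ) (𝓡 m) 2 γ t
  equation : ∀ p : M, γ t ∈ (chartAt (Eu m) p).source → ∀ w : Eu m,
    geodesicExpr (chartMetric g p) (coordCurve p γ) t w = 0

theorem isGeodesicOn_iff {U : Set M} {g : FormField m M} {γ : ℝ → M} {J : Set ℝ} (hJ : IsOpen J) :
    IsGeodesicOn U g γ J ↔ ∀ t ∈ J, GeodesicAt U g γ t :=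
  ⟨fun h t ht ↦ ⟨h.mapsTo ht, h.contMDiffOn.contMDiffAt (hJ.mem_nhds ht), h.equation t ht⟩,
    fun h ↦ ⟨fun t ht ↦ (h t ht).mem, fun t ht ↦ (h t ht).contMDiffAt.contMDiffWithinAt,
      fun t ht ↦ (h t ht).equation⟩⟩

theorem geodesicExpr_congr {E : Type*} [NormedAddCommGroup E] [NormedSpace ℝ E]
    {G : E → E →L[ℝ] E →L[ℝ] ℝ} {c c' : ℝ → E} {t : ℝ} (h : c =ᶠ[𝓝 t] c') (w : E) :
    geodesicExpr G c t w = geodesicExpr G c' t w := by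
  simp only [geodesicExpr, h.self_of_nhds, h.deriv_eq, h.deriv.deriv_eq]

theorem GeodesicAt.congr {U : Set M} {g : FormField m M} {γ γ' : ℝ → M} {t : ℝ}
    (h : GeodesicAt U g γ t) (e : γ' =ᶠ[𝓝 t] γ) : GeodesicAt U g γ' t := by
  refine ⟨e.self_of_nhds ▸ h.mem, h.contMDiffAt.congr_of_eventuallyEq e, fun p hp w ↦ ?_⟩
  have e' : coordCurve p γ' =ᶠ[𝓝 t] coordCurve (m := m) p γ :=
    e.mono fun s hs ↦ by simp [coordCurve, hs]
  rw [geodesicExpr_congr e']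
  exact h.equation p (e.self_of_nhds ▸ hp) w

/-- The acceleration and the quadratic Christoffel term both scale by a², for every a including 0.
-/
theorem geodesicExpr_comp_affine {E : Type*} [NormedAddCommGroup E] [NormedSpace ℝ E]
    (G : E → E →L[ℝ] E →L[ℝ] ℝ) (c : ℝ → E) (a b t : ℝ) (w : E) :
    geodesicExpr G (fun s ↦ c (a * s + b)) t w = a ^ 2 * geodesicExpr G c (a * t + b) w := by
  have h1 : ∀ c : ℝ → E, deriv (fun s ↦ c (a * s + b)) = fun s ↦ a • deriv c (a * s + b) := by
    intro c
    funext s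
    have h2 := deriv_comp_mul_left a (fun s ↦ c (s + b)) s
    rw [h2, deriv_comp_add_const]
  have h3 : deriv (fun s ↦ a • deriv c (a * s + b)) t
      = a • a • deriv (deriv c) (a * t + b) := by
    rw [deriv_fun_const_smul_field, h1 (deriv c)]
  have h4 : ∀ (r : ℝ) (φ : E → ℝ) (x v : E),
      fderiv ℝ (fun z ↦ r * φ z) x v = r * fderiv ℝ φ x v := fun r φ x v ↦ by
    have h5 := congrFun (fderiv_const_smul_field (𝕜 := ℝ) (f := φ) r) x
    exact congrArg (fun L : E →L[ℝ] ℝ ↦ L v) h5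
  simp only [geodesicExpr, formChristoffel, h1 c, h3]
  simp only [map_smul, smul_apply, smul_eq_mul, h4]
  ring

theorem GeodesicAt.comp_affine {U : Set M} {g : FormField m M} {γ : ℝ → M} {a b t : ℝ}
    (h : GeodesicAt U g γ (a * t + b)) : GeodesicAt U g (fun s ↦ γ (a * s + b)) t := by
  refine ⟨h.mem, ?_, fun p hp w ↦ ?_⟩
  · have h1 : ContMDiffAt 𝓘(ℝ, ℝ) 𝓘(ℝ, ℝ) 2 (fun s : ℝ ↦ a * s + b) t :=
      ContDiffAt.contMDiffAt (by fun_prop)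
    exact h.contMDiffAt.comp t h1
  · have h2 := geodesicExpr_comp_affine (chartMetric g p) (coordCurve p γ) a b t w
    rw [h.equation p hp w, mul_zero] at h2
    exact h2

theorem GeodesicAt.contDiffAt_coordCurve [IsManifold (𝓡 m) ∞ M] {U : Set M} {g : FormField m M}
    {γ : ℝ → M} {t : ℝ} (h : GeodesicAt U g γ t) {p : M}
    (hp : γ t ∈ (chartAt (Eu m) p).source) : ContDiffAt ℝ 2 (coordCurve (m := m) p γ) t := by
  have : IsManifold (𝓡 m) 2 M := IsManifold.of_le (n := ∞) two_le_infty
  exact ((contMDiffAt_extChartAt' hp).comp t h.contMDiffAt).contDiffAt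

variable [IsManifold (𝓡 m) ∞ M]

/-- The geodesic equation may be tested in any local parametrization instead of the preferred
charts. It is applied below to geodesic coordinates. -/
theorem geodesicAt_comp_iff {n : WithTop ℕ∞} {U : Set M} {g : FormField m M}
    (hg : IsMetric n U g) (hn : 1 ≤ n) {N : Eu m → M} {c : ℝ → Eu m} {t : ℝ}
    (hN : ∀ᶠ z in 𝓝 (c t), ContMDiffAt (𝓡 m) (𝓡 m) ∞ N z)
    (hi : Function.Injective (mderiv N (c t))) (hU : N (c t) ∈ U) (hc : ContDiffAt ℝ 2 c t) :
    GeodesicAt U g (N ∘ c) t ↔ ∀ w, geodesicExpr (pullbackForm g N) c t w = 0 := by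
  constructor
  · intro h
    exact (geodesicExpr_chart_iff hg hn hN hi hU hc (mem_chart_source _ _)).1
      (h.equation (N (c t)) (mem_chart_source _ _))
  · intro h
    refine ⟨hU, ?_, fun p hp ↦ (geodesicExpr_chart_iff hg hn hN hi hU hc hp).2 h⟩
    exact (hN.self_of_nhds.of_le two_le_infty).comp t hc.contMDiffAt

theorem geodesicAt_of_chart {n : WithTop ℕ∞} {U : Set M} {g : FormField m M}
    (hg : IsMetric n U g) (hn : 1 ≤ n) {p : M} {c : ℝ → Eu m} {t : ℝ}
    (hm : c t ∈ chartDomain U p) (hc : ContDiffAt ℝ 2 c t)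
    (h : ∀ w, geodesicExpr (chartMetric g p) c t w = 0) :
    GeodesicAt U g ((extChartAt (𝓡 m) p).symm ∘ c) t := by
  refine (geodesicAt_comp_iff hg hn ?_ (injective_mderiv_extChartAt_symm hm.1) hm.2 hc).2 h
  filter_upwards [(isOpen_extChartAt_target (I := 𝓡 m) p).mem_nhds hm.1] with z hz
  exact contMDiffAt_extChartAt_symm hz

/-- The acceleration prescribed by the geodesic equation in the preferred chart at `p`. -/
noncomputable def acceleration (g : FormField m M) (p : M) (z : Eu m × Eu m) : Eu m :=
  -((chartMetric g p z.1).inverse (fderiv ℝ (chartMetric g p) z.1 z.2 z.2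
    - (2⁻¹ : ℝ) • ((fderiv ℝ (chartMetric g p) z.1).flip z.2).flip z.2))

theorem IsMetric.isInvertible {n : WithTop ℕ∞} {U : Set M} {g : FormField m M}
    (hg : IsMetric n U g) {p : M} {y : Eu m} (hy : y ∈ chartDomain U p) :
    (chartMetric g p y).IsInvertible := by
  have hinj : Function.Injective (chartMetric g p y).toLinearMap := by
    refine (injective_iff_map_eq_zero _).2 fun a ha ↦ by_contra fun h ↦ ?_
    have h1 := hg.chartMetric_pos hy h
    have h2 : chartMetric g p y a a = 0 := congrArg (fun L : Eu m →L[ℝ] ℝ ↦ L a) ha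
    exact h1.ne' h2
  have hdim : Module.finrank ℝ (Eu m) = Module.finrank ℝ (Eu m →L[ℝ] ℝ) := by
    rw [← (LinearMap.toContinuousLinearMap (𝕜 := ℝ) (E := Eu m) (F' := ℝ)).finrank_eq]
    exact (Subspace.dual_finrank_eq (K := ℝ) (V := Eu m)).symm
  let e := LinearEquiv.ofInjectiveOfFinrankEq (chartMetric g p y).toLinearMap hinj hdim
  exact ⟨e.toContinuousLinearEquiv, by ext; rfl⟩

/-- A positive definite form is invertible, so the index can be raised. -/
theorem geodesicExpr_eq_zero_iff {n : WithTop ℕ∞} {U : Set M} {g : FormField m M}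
    (hg : IsMetric n U g) (hn : 1 ≤ n) {p : M} {c : ℝ → Eu m} {t : ℝ}
    (hm : c t ∈ chartDomain U p) :
    (∀ w, geodesicExpr (chartMetric g p) c t w = 0) ↔
      deriv (deriv c) t = acceleration g p (c t, deriv c t) := by
  have hd : DifferentiableAt ℝ (chartMetric g p) (c t) :=
    ((hg.contDiffOn_chartMetric p).contDiffAt
      ((isOpen_chartDomain hg.isOpen p).mem_nhds hm)).differentiableAt (zero_lt_one.trans_le hn).ne'
  obtain ⟨e, he⟩ := hg.isInvertible hm
  set L : Eu m →L[ℝ] ℝ := fderiv ℝ (chartMetric g p) (c t) (deriv c t) (deriv c t)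
    - (2⁻¹ : ℝ) • ((fderiv ℝ (chartMetric g p) (c t)).flip (deriv c t)).flip (deriv c t) with hL
  have h1 : ∀ w, geodesicExpr (chartMetric g p) c t w
      = (chartMetric g p (c t) (deriv (deriv c) t) + L) w := by
    intro w
    simp only [geodesicExpr, formChristoffel, fderiv_form_apply hd, hL]
    simp
    ring
  have h2 : acceleration g p (c t, deriv c t) = - e.symm L := by
    simp only [acceleration]
    rw [← hL, ← he, ContinuousLinearMap.inverse_equiv]
    rfl
  rw [h2]
  simp only [h1, ← he]
  constructor
  · intro h
    have h3 : e (deriv (deriv c) t) + L = 0 := ContinuousLinearMap.ext h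
    rw [← e.symm_apply_apply (deriv (deriv c) t), eq_neg_of_add_eq_zero_left h3, map_neg]
  · intro h w
    have h3 : e (deriv (deriv c) t) = - L := by
      rw [h, map_neg, e.apply_symm_apply]
    have h4 : (e : Eu m →L[ℝ] Eu m →L[ℝ] ℝ) (deriv (deriv c) t) = -L := h3
    rw [h4, neg_add_cancel]
    rfl

theorem contDiffAt_inverse {X E F : Type*} [NormedAddCommGroup X] [NormedSpace ℝ X]
    [NormedAddCommGroup E] [NormedSpace ℝ E] [CompleteSpace E] [NormedAddCommGroup F]
    [NormedSpace ℝ F] {n : WithTop ℕ∞} {f : X → E →L[ℝ] F} {x : X} (hf : ContDiffAt ℝ n f x)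
    (h : (f x).IsInvertible) : ContDiffAt ℝ n (fun z ↦ (f z).inverse) x := by
  obtain ⟨e, he⟩ := h
  have h0 : ContDiffAt ℝ n (ContinuousLinearMap.inverse : (E →L[ℝ] F) → F →L[ℝ] E) (f x) :=
    he ▸ contDiffAt_map_inverse e
  exact h0.comp x hf

theorem contDiffOn_acceleration {n : WithTop ℕ∞} (hn : n = (∞ : WithTop ℕ∞) ∨ n = ω) {U : Set M}
    {g : FormField m M} (hg : IsMetric n U g) (p : M) :
    ContDiffOn ℝ n (acceleration g p) (chartDomain U p ×ˢ (univ : Set (Eu m))) := by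
  have hn1 : n + 1 ≤ n := by rcases hn with rfl | rfl <;> simp
  have hG : ∀ z ∈ chartDomain U p ×ˢ (univ : Set (Eu m)), ContDiffAt ℝ n (chartMetric g p) z.1 :=
    fun z hz ↦ (hg.contDiffOn_chartMetric p).contDiffAt
      ((isOpen_chartDomain hg.isOpen p).mem_nhds hz.1)
  have hG2 : ∀ z ∈ chartDomain U p ×ˢ (univ : Set (Eu m)),
      ContDiffAt ℝ n (fun z : Eu m × Eu m ↦ fderiv ℝ (chartMetric g p) z.1) z :=
    fun z hz ↦ ((hG z hz).fderiv_right hn1).comp z contDiffAt_fst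
  have h1 : ∀ z ∈ chartDomain U p ×ˢ (univ : Set (Eu m)), ContDiffAt ℝ n
      (fun z : Eu m × Eu m ↦ fderiv ℝ (chartMetric g p) z.1 z.2 z.2) z :=
    fun z hz ↦ ((hG2 z hz).clm_apply contDiffAt_snd).clm_apply contDiffAt_snd
  have h2 : ContDiffOn ℝ n (fun z : Eu m × Eu m ↦
      ((fderiv ℝ (chartMetric g p) z.1).flip z.2).flip z.2) (chartDomain U p ×ˢ (univ : Set (Eu m))) :=
    contDiffOn_clm_apply.2 fun w z hz ↦ ContDiffAt.contDiffWithinAt <|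
      (((hG2 z hz).clm_apply contDiffAt_const).clm_apply contDiffAt_snd).clm_apply contDiffAt_snd
  intro z hz
  have h : ContDiffAt ℝ n (fun z : Eu m × Eu m ↦ chartMetric g p z.1) z :=
    (hG z hz).comp z contDiffAt_fst
  have hinv := contDiffAt_inverse h (hg.isInvertible hz.1)
  have h3 : ContDiffWithinAt ℝ n (fun z : Eu m × Eu m ↦
      fderiv ℝ (chartMetric g p) z.1 z.2 z.2
        - (2⁻¹ : ℝ) • ((fderiv ℝ (chartMetric g p) z.1).flip z.2).flip z.2)
      (chartDomain U p ×ˢ univ) z :=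
    (h1 z hz).contDiffWithinAt.sub (ContDiffWithinAt.const_smul (2⁻¹ : ℝ) (h2 z hz))
  exact (hinv.contDiffWithinAt.clm_apply h3).neg

end Geodesic

/-! ### Uniqueness of geodesics -/

section Unique

variable {m : ℕ} {M : Type*} [TopologicalSpace M] [ChartedSpace (Eu m) M]

/-- The vector field on the tangent bundle of a chart whose integral curves are the geodesics. -/
noncomputable def geodesicField (g : FormField m M) (p : M) (z : Eu m × Eu m) : Eu m × Eu m :=
  (z.2, acceleration g p z)

variable [IsManifold (𝓡 m) ∞ M]

theorem contDiffOn_geodesicField {n : WithTop ℕ∞} (hn : n = (∞ : WithTop ℕ∞) ∨ n = ω) {U : Set M}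
    {g : FormField m M} (hg : IsMetric n U g) (p : M) :
    ContDiffOn ℝ n (geodesicField g p) (chartDomain U p ×ˢ univ) :=
  contDiffOn_snd.prodMk (contDiffOn_acceleration hn hg p)

theorem one_le_of_infty_or_omega {n : WithTop ℕ∞} (hn : n = (∞ : WithTop ℕ∞) ∨ n = ω) : 1 ≤ n := by
  rcases hn with rfl | rfl <;> simp

theorem GeodesicAt.hasDerivAt {n : WithTop ℕ∞} {U : Set M} {g : FormField m M}
    (hg : IsMetric n U g) (hn : 1 ≤ n) {γ : ℝ → M} {t : ℝ} (h : GeodesicAt U g γ t) {p : M}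
    (hp : γ t ∈ (chartAt (Eu m) p).source) :
    HasDerivAt (fun s ↦ (coordCurve (m := m) p γ s, deriv (coordCurve (m := m) p γ) s))
      (geodesicField g p (coordCurve p γ t, deriv (coordCurve p γ) t)) t := by
  have h1 := h.contDiffAt_coordCurve hp
  have h2 : deriv (deriv (coordCurve (m := m) p γ)) t = _ :=
    (geodesicExpr_eq_zero_iff hg hn (extChartAt_mem_chartDomain hp h.mem)).1 (h.equation p hp)
  have h3 : DifferentiableAt ℝ (deriv (coordCurve (m := m) p γ)) t := by
    have h4 : ContDiffAt ℝ 1 (deriv (coordCurve (m := m) p γ)) t :=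
      (h1.fderiv_right (m := 1) (by norm_num)).clm_apply contDiffAt_const
    exact h4.differentiableAt one_ne_zero
  refine (h1.differentiableAt two_ne_zero).hasDerivAt.prodMk ?_
  rw [← h2]
  exact h3.hasDerivAt

/-- In the chart, position and velocity form an integral curve of a C¹, hence locally Lipschitz,
vector field. -/
theorem geodesic_eventuallyEq {n : WithTop ℕ∞} (hn : n = (∞ : WithTop ℕ∞) ∨ n = ω) {U : Set M}
    {g : FormField m M} (hg : IsMetric n U g) {γ₁ γ₂ : ℝ → M} {t : ℝ}
    (h₁ : ∀ᶠ s in 𝓝 t, GeodesicAt U g γ₁ s) (h₂ : ∀ᶠ s in 𝓝 t, GeodesicAt U g γ₂ s) {p : M}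
    (hp : γ₁ t ∈ (chartAt (Eu m) p).source) (he : γ₁ t = γ₂ t)
    (hd : deriv (coordCurve (m := m) p γ₁) t = deriv (coordCurve (m := m) p γ₂) t) :
    γ₁ =ᶠ[𝓝 t] γ₂ := by
  have hn1 := one_le_of_infty_or_omega hn
  have hmem := extChartAt_mem_chartDomain hp h₁.self_of_nhds.mem
  have hf : ContDiffAt ℝ 1 (geodesicField g p)
      (coordCurve p γ₁ t, deriv (coordCurve p γ₁) t) :=
    (((contDiffOn_geodesicField hn hg p).contDiffAt
      (((isOpen_chartDomain hg.isOpen p).prod isOpen_univ).mem_nhds ⟨hmem, mem_univ _⟩))).of_le hn1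
  obtain ⟨K, V, hV, hK⟩ := hf.exists_lipschitzOnWith
  have key : ∀ γ : ℝ → M, (∀ᶠ s in 𝓝 t, GeodesicAt U g γ s) → γ t = γ₁ t →
      deriv (coordCurve (m := m) p γ) t = deriv (coordCurve (m := m) p γ₁) t →
      (∀ᶠ s in 𝓝 t, γ s ∈ (chartAt (Eu m) p).source) ∧
      ∀ᶠ s in 𝓝 t, HasDerivAt
        (fun s ↦ (coordCurve (m := m) p γ s, deriv (coordCurve (m := m) p γ) s))
        (geodesicField g p (coordCurve p γ s, deriv (coordCurve p γ) s)) s ∧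
        (coordCurve p γ s, deriv (coordCurve p γ) s) ∈ V := by
    intro γ hγ h0 h1
    have hs : ∀ᶠ s in 𝓝 t, γ s ∈ (chartAt (Eu m) p).source :=
      hγ.self_of_nhds.contMDiffAt.continuousAt.preimage_mem_nhds
        ((chartAt (Eu m) p).open_source.mem_nhds (by rwa [h0]))
    refine ⟨hs, ?_⟩
    have hc := (hγ.self_of_nhds.hasDerivAt hg hn1 hs.self_of_nhds).continuousAt
    have hV' : ∀ᶠ s in 𝓝 t, (coordCurve p γ s, deriv (coordCurve p γ) s) ∈ V := by
      refine hc.preimage_mem_nhds ?_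
      have : coordCurve (m := m) p γ t = coordCurve p γ₁ t := by simp [coordCurve, h0]
      rwa [this, h1]
    filter_upwards [hγ, hs, hV'] with s hs1 hs2 hs3
    exact ⟨hs1.hasDerivAt hg hn1 hs2, hs3⟩
  obtain ⟨hs₁, hu₁⟩ := key γ₁ h₁ rfl rfl
  obtain ⟨hs₂, hu₂⟩ := key γ₂ h₂ he.symm hd.symm
  have hu := ODE_solution_unique_of_eventually (v := fun _ ↦ geodesicField g p) (s := fun _ ↦ V)
    (K := K) (Filter.Eventually.of_forall fun _ ↦ hK) hu₁ hu₂
    (by simp only [coordCurve, he]; exact congrArg _ hd)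
  filter_upwards [hu, hs₁, hs₂] with s h3 h4 h5
  have h6 : extChartAt (𝓡 m) p (γ₁ s) = extChartAt (𝓡 m) p (γ₂ s) := congrArg Prod.fst h3
  exact (extChartAt (𝓡 m) p).injOn (by rwa [extChartAt_source]) (by rwa [extChartAt_source]) h6

/-- The set of times at which the two germs agree is open by definition and closed in J: at a limit
time the positions agree because M is Hausdorff, the velocities by continuity, and local uniqueness
applies. -/
theorem geodesic_eqOn [T2Space M] {n : WithTop ℕ∞} (hn : n = (∞ : WithTop ℕ∞) ∨ n = ω) {U : Set M}
    {g : FormField m M} (hg : IsMetric n U g) {γ₁ γ₂ : ℝ → M} {J : Set ℝ} (hJ : IsOpen J)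
    (hJc : IsPreconnected J) (h₁ : ∀ t ∈ J, GeodesicAt U g γ₁ t)
    (h₂ : ∀ t ∈ J, GeodesicAt U g γ₂ t) {t : ℝ} (ht : t ∈ J) {p : M}
    (hp : γ₁ t ∈ (chartAt (Eu m) p).source) (he : γ₁ t = γ₂ t)
    (hd : deriv (coordCurve (m := m) p γ₁) t = deriv (coordCurve (m := m) p γ₂) t) :
    EqOn γ₁ γ₂ J := by
  have e₁ : ∀ s ∈ J, ∀ᶠ r in 𝓝 s, GeodesicAt U g γ₁ r := fun s hs ↦
    Filter.mem_of_superset (hJ.mem_nhds hs) h₁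
  have e₂ : ∀ s ∈ J, ∀ᶠ r in 𝓝 s, GeodesicAt U g γ₂ r := fun s hs ↦
    Filter.mem_of_superset (hJ.mem_nhds hs) h₂
  have hsub : J ⊆ {s | γ₁ =ᶠ[𝓝 s] γ₂} := by
    refine hJc.subset_of_closure_inter_subset isOpen_setOfPred_eventually_nhds
      ⟨t, ht, geodesic_eventuallyEq hn hg (e₁ t ht) (e₂ t ht) hp he hd⟩ ?_
    rintro s ⟨hs, hsJ⟩
    have hfr : ∃ᶠ r in 𝓝 s, γ₁ =ᶠ[𝓝 r] γ₂ := mem_closure_iff_frequently.1 hs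
    have heq : γ₁ s = γ₂ s := tendsto_nhds_unique_of_frequently_eq
      (h₁ s hsJ).contMDiffAt.continuousAt (h₂ s hsJ).contMDiffAt.continuousAt
      (hfr.mono fun r hr ↦ hr.self_of_nhds)
    have hsrc := mem_chart_source (Eu m) (γ₁ s)
    have hn1 := one_le_of_infty_or_omega hn
    refine geodesic_eventuallyEq hn hg (e₁ s hsJ) (e₂ s hsJ) hsrc heq ?_
    refine tendsto_nhds_unique_of_frequently_eq
      (((h₁ s hsJ).hasDerivAt hg hn1 hsrc).continuousAt.snd)
      (((h₂ s hsJ).hasDerivAt hg hn1 (heq ▸ hsrc)).continuousAt.snd)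
      (hfr.mono fun r hr ↦ ?_)
    have hr' : coordCurve (m := m) (γ₁ s) γ₁ =ᶠ[𝓝 r] coordCurve (m := m) (γ₁ s) γ₂ :=
      hr.mono fun x hx ↦ by simp [coordCurve, hx]
    exact hr'.deriv_eq
  exact fun s hs ↦ (hsub hs).self_of_nhds

end Unique

theorem exists_Ioo_subset {S : Set ℝ} (hS : IsOpen S) (hc : S.OrdConnected) (h0 : (0 : ℝ) ∈ S)
    (h1 : (1 : ℝ) ∈ S) : ∃ ε > 0, Ioo (-ε) (1 + ε) ⊆ S := by
  obtain ⟨a, ha, ha'⟩ := Metric.isOpen_iff.1 hS 0 h0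
  obtain ⟨b, hb, hb'⟩ := Metric.isOpen_iff.1 hS 1 h1
  have hm : 0 < min a b := lt_min ha hb
  refine ⟨min a b / 2, by positivity, Ioo_subset_Icc_self.trans (hc.out (ha' ?_) (hb' ?_))⟩
  · have := min_le_left a b
    rw [Metric.mem_ball, Real.dist_eq, abs_lt]
    constructor <;> linarith
  · have := min_le_right a b
    rw [Metric.mem_ball, Real.dist_eq, abs_lt]
    constructor <;> linarith

theorem contDiffOn_succ_of_hasDerivAt {E : Type*} [NormedAddCommGroup E] [NormedSpace ℝ E] {n : ℕ}
    {u u' : ℝ → E} {I : Set ℝ} (hI : IsOpen I) (h : ∀ t ∈ I, HasDerivAt u (u' t) t)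
    (h' : ContDiffOn ℝ n u' I) : ContDiffOn ℝ (n + 1 : ℕ) u I := by
  rw [Nat.cast_add, Nat.cast_one, contDiffOn_succ_iff_deriv_of_isOpen hI]
  exact ⟨fun t ht ↦ (h t ht).differentiableAt.differentiableWithinAt, by simp,
    h'.congr fun t ht ↦ (h t ht).deriv⟩

/-! ### The exponential map and the geodesic flow -/

section Exp

variable {m : ℕ} {M : Type*} [TopologicalSpace M] [ChartedSpace (Eu m) M]

/-- The exponential map, as a map on the model space. -/
noncomputable def expE (U : Set M) (g : FormField m M) (P : M) (v : Eu m) : M :=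
  expMap U g P v

/-- The exponential map is defined at `v`. -/
def HasGeod (U : Set M) (g : FormField m M) (P : M) (v : Eu m) : Prop :=
  ∃ γ : ℝ → M, IsGeodesicFrom U g P v γ

/-- Because of this homogeneity, an integral curve of s times the geodesic field projects to a
geodesic, traversed s times as fast. -/
theorem acceleration_smul (g : FormField m M) (p : M) (y w : Eu m) (s : ℝ) :
    acceleration g p (y, s • w) = s ^ 2 • acceleration g p (y, w) := by
  have h : fderiv ℝ (chartMetric g p) y (s • w) (s • w)
      - (2⁻¹ : ℝ) • ((fderiv ℝ (chartMetric g p) y).flip (s • w)).flip (s • w)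
      = s ^ 2 • (fderiv ℝ (chartMetric g p) y w w
      - (2⁻¹ : ℝ) • ((fderiv ℝ (chartMetric g p) y).flip w).flip w) := by
    ext z
    simp
    ring
  rw [acceleration, h, map_smul, ← smul_neg]
  rfl

variable [IsManifold (𝓡 m) ∞ M]

theorem isGeodesicFrom_iff {U : Set M} {g : FormField m M} {P : M} {v : Eu m} {γ : ℝ → M} :
    IsGeodesicFrom U g P v γ ↔ (∃ ε > 0, ∀ t ∈ Ioo (-ε) (1 + ε), GeodesicAt U g γ t) ∧
      γ 0 = P ∧ deriv (coordCurve (m := m) P γ) 0 = v := by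
  simp only [IsGeodesicFrom, isGeodesicOn_iff isOpen_Ioo]
  refine and_congr_right fun ⟨ε, hε, h⟩ ↦ and_congr_right fun h0 ↦ ?_
  have h1 := (h 0 ⟨by linarith, by linarith⟩).contMDiffAt.mdifferentiableAt two_ne_zero
  rw [mfderiv_curve_eq_deriv h1, h0]
  exact Iff.rfl

/-- The curve s ↦ γ(t s) is a geodesic with initial velocity t v. By uniqueness the value of the
exponential map does not depend on the curve chosen in its definition. -/
theorem expE_smul [T2Space M] {n : WithTop ℕ∞} (hn : n = (∞ : WithTop ℕ∞) ∨ n = ω) {U : Set M}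
    {g : FormField m M} (hg : IsMetric n U g) {P : M} {v : Eu m} {γ : ℝ → M} {J : Set ℝ}
    (hJ : IsOpen J) (hJc : J.OrdConnected) (h0 : (0 : ℝ) ∈ J) (hγ : ∀ t ∈ J, GeodesicAt U g γ t)
    (hP : γ 0 = P) (hv : deriv (coordCurve (m := m) P γ) 0 = v) {t : ℝ} (ht : t ∈ J) :
    HasGeod U g P (t • v) ∧ expE U g P (t • v) = γ t := by
  have hgeo : IsGeodesicFrom U g P (t • v) (fun s ↦ γ (t * s + 0)) := by
    refine isGeodesicFrom_iff.2 ⟨?_, by simpa using hP, ?_⟩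
    · obtain ⟨ε, hε, hs⟩ := exists_Ioo_subset (S := (fun s ↦ t * s + 0) ⁻¹' J)
        (hJ.preimage (by fun_prop))
        ((hJc.convex (𝕜 := ℝ)).is_linear_preimage
          (f := fun s ↦ t * s + 0) ⟨fun a b ↦ by ring, fun a b ↦ by simp; ring⟩).ordConnected
        (by simpa using h0) (by simpa using ht)
      exact ⟨ε, hε, fun s hs' ↦ (hγ _ (hs hs')).comp_affine⟩
    · have h2 := deriv_comp_mul_left t (coordCurve (m := m) P γ) 0
      rw [mul_zero, hv] at h2
      simp only [add_zero]
      exact h2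
  have hG : HasGeod U g P (t • v) := ⟨_, hgeo⟩
  refine ⟨hG, ?_⟩
  have h1 : expE U g P (t • v) = hG.choose 1 := dif_pos hG
  obtain ⟨⟨ε₁, hε₁, h₁⟩, hP₁, hd₁⟩ := isGeodesicFrom_iff.1 hG.choose_spec
  obtain ⟨⟨ε₂, hε₂, h₂⟩, hP₂, hd₂⟩ := isGeodesicFrom_iff.1 hgeo
  have hε : 0 < min ε₁ ε₂ := lt_min hε₁ hε₂
  have hl := min_le_left ε₁ ε₂
  have hr := min_le_right ε₁ ε₂
  have h3 := geodesic_eqOn hn hg (isOpen_Ioo (a := - min ε₁ ε₂) (b := 1 + min ε₁ ε₂))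
    isPreconnected_Ioo (fun s hs ↦ h₁ s ⟨by linarith [hs.1], by linarith [hs.2]⟩)
    (fun s hs ↦ h₂ s ⟨by linarith [hs.1], by linarith [hs.2]⟩)
    (t := 0) (p := P) ⟨by linarith, by linarith⟩ (by rw [hP₁]; exact mem_chart_source _ _)
    (by rw [hP₁, hP₂]) (by rw [hd₁, hd₂])
  have h4 := h3 (x := 1) ⟨by linarith, by linarith⟩
  rw [h1, h4]
  simp

theorem HasGeod.exists_curve [T2Space M] {n : WithTop ℕ∞} (hn : n = (∞ : WithTop ℕ∞) ∨ n = ω)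
    {U : Set M} {g : FormField m M} (hg : IsMetric n U g) {P : M} {v : Eu m}
    (h : HasGeod U g P v) : ∃ (γ : ℝ → M) (ε : ℝ), 0 < ε ∧
      (∀ t ∈ Ioo (-ε) (1 + ε), GeodesicAt (m := m) U g γ t ∧ HasGeod U g P (t • v) ∧
        expE U g P (t • v) = γ t) ∧ γ 0 = P ∧ deriv (coordCurve (m := m) P γ) 0 = v := by
  obtain ⟨γ, hγ⟩ := h
  obtain ⟨⟨ε, hε, h₁⟩, hP, hd⟩ := isGeodesicFrom_iff.1 hγ
  exact ⟨γ, ε, hε, fun t ht ↦ ⟨h₁ t ht, expE_smul hn hg isOpen_Ioo ordConnected_Ioo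
    ⟨by linarith, by linarith⟩ h₁ hP hd ht⟩, hP, hd⟩

/-- The local flow for the short time s, rescaled to unit time: the geodesic from the point z.1 with
velocity s z.2 ends, at time 1, at the first component of φ(z). -/
theorem exists_geodesic_flow {n : WithTop ℕ∞} (hn : n = (∞ : WithTop ℕ∞) ∨ n = ω)
    {U : Set M} {g : FormField m M} (hg : IsMetric n U g) {p : M} {z₀ : Eu m × Eu m}
    (hz₀ : z₀.1 ∈ chartDomain U p) :
    ∃ ε > 0, ∃ V, IsOpen V ∧ z₀ ∈ V ∧ ∀ s : ℝ, |s| < ε → ∃ φ : Eu m × Eu m → Eu m × Eu m,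
      ContDiffOn ℝ n φ V ∧ ∀ z ∈ V, (φ z).1 ∈ chartDomain U p ∧ z.1 ∈ chartDomain U p ∧
        ∃ γ : ℝ → M, (∀ t ∈ Ioo (-1) 2, GeodesicAt U g γ t) ∧
          γ 0 = (extChartAt (𝓡 m) p).symm z.1 ∧ deriv (coordCurve (m := m) p γ) 0 = s • z.2 ∧
          γ 1 = (extChartAt (𝓡 m) p).symm (φ z).1 := by
  have hn1 := one_le_of_infty_or_omega hn
  have hopen := (isOpen_chartDomain (m := m) hg.isOpen p).prod (isOpen_univ (X := Eu m))
  have hf := contDiffOn_geodesicField hn hg p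
  obtain ⟨ε, hε, V, hV, hzV, h⟩ := exists_local_flow hn hopen hf (x₀ := z₀) ⟨hz₀, mem_univ _⟩
  refine ⟨ε, hε, V, hV, hzV, fun s hs ↦ ?_⟩
  obtain ⟨φ, hφ, hu⟩ := h s hs
  refine ⟨φ, hφ, fun z hz ↦ ?_⟩
  obtain ⟨u, hu0, hu1, hu⟩ := hu z hz
  have hI : (0 : ℝ) ∈ Ioo (-1 : ℝ) 2 := by norm_num
  have hI1 : (1 : ℝ) ∈ Ioo (-1 : ℝ) 2 := by norm_num
  have huc : ContinuousOn u (Ioo (-1) 2) := fun t ht ↦ (hu t ht).2.continuousAt.continuousWithinAt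
  have hmaps : MapsTo u (Ioo (-1) 2) (chartDomain U p ×ˢ (univ : Set (Eu m))) :=
    fun t ht ↦ (hu t ht).1
  have hC1 : ContDiffOn ℝ 1 u (Ioo (-1) 2) := by
    refine contDiffOn_succ_of_hasDerivAt (n := 0) isOpen_Ioo (fun t ht ↦ (hu t ht).2) ?_
    exact contDiffOn_zero.2 ((hf.continuousOn.comp huc hmaps).const_smul s)
  have hC2 : ContDiffOn ℝ 2 u (Ioo (-1) 2) := by
    refine contDiffOn_succ_of_hasDerivAt (n := 1) isOpen_Ioo (fun t ht ↦ (hu t ht).2) ?_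
    exact ((hf.of_le hn1).comp hC1 hmaps).const_smul s
  have hd : ∀ t ∈ Ioo (-1 : ℝ) 2, HasDerivAt (fun t ↦ (u t).1) (s • (u t).2) t :=
    fun t ht ↦ (hu t ht).2.fst
  have hd2 : ∀ t ∈ Ioo (-1 : ℝ) 2,
      HasDerivAt (fun t ↦ (u t).2) (s • acceleration g p (u t)) t :=
    fun t ht ↦ (hu t ht).2.snd
  have hgeo : ∀ t ∈ Ioo (-1 : ℝ) 2,
      GeodesicAt (m := m) U g ((extChartAt (𝓡 m) p).symm ∘ fun t ↦ (u t).1) t := by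
    intro t ht
    have hm := (hu t ht).1.1
    refine geodesicAt_of_chart hg hn1 hm
      (contDiffAt_fst.comp t (hC2.contDiffAt (isOpen_Ioo.mem_nhds ht))) ?_
    refine (geodesicExpr_eq_zero_iff hg hn1 hm).2 ?_
    have e : deriv (fun t ↦ (u t).1) =ᶠ[𝓝 t] fun t ↦ s • (u t).2 := by
      filter_upwards [isOpen_Ioo.mem_nhds ht] with r hr using (hd r hr).deriv
    have h2 : deriv (fun t ↦ s • (u t).2) t = s • s • acceleration g p (u t) :=
      ((hd2 t ht).const_smul s).deriv
    rw [e.deriv_eq, e.self_of_nhds, acceleration_smul, h2, smul_smul, sq]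
  refine ⟨hu1 ▸ (hu 1 hI1).1.1, hu0 ▸ (hu 0 hI).1.1, _, hgeo, by simp [hu0], ?_, by simp [hu1]⟩
  have e : coordCurve (m := m) p ((extChartAt (𝓡 m) p).symm ∘ fun t ↦ (u t).1)
      =ᶠ[𝓝 0] fun t ↦ (u t).1 := by
    filter_upwards [isOpen_Ioo.mem_nhds hI] with r hr
    exact (extChartAt (𝓡 m) p).right_inv (hu r hr).1.1.1
  rw [e.deriv_eq, (hd 0 hI).deriv, hu0]

/-- β, run at 1/κ times its speed from time 1 on, is defined on (1 - κ, 1 + 2κ) and agrees with γ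
near time 1 by uniqueness. The curve that follows γ and then β is therefore a geodesic. -/
theorem exists_geodesic_extension {n : WithTop ℕ∞} (hn : n = (∞ : WithTop ℕ∞) ∨ n = ω)
    {U : Set M} {g : FormField m M} (hg : IsMetric n U g) {p : M} {γ β : ℝ → M} {ε κ : ℝ}
    (hε : 0 < ε) (hκ : 0 < κ) (hγ : ∀ t ∈ Ioo (-ε) (1 + ε), GeodesicAt U g γ t)
    (hβ : ∀ t ∈ Ioo (-1) 2, GeodesicAt U g β t) (hp : γ 1 ∈ (chartAt (Eu m) p).source)
    (h0 : β 0 = γ 1)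
    (hd : deriv (coordCurve (m := m) p β) 0 = κ • deriv (coordCurve (m := m) p γ) 1) :
    ∃ α : ℝ → M, (∀ t ∈ Ioo (-ε) (1 + 2 * κ), GeodesicAt U g α t) ∧ α =ᶠ[𝓝 0] γ ∧
      α (1 + κ) = β 1 := by
  have hβ' : ∀ t ∈ Ioo (1 - κ) (1 + 2 * κ), GeodesicAt U g (fun t ↦ β (κ⁻¹ * t + -κ⁻¹)) t := by
    intro t ht
    refine (hβ _ ?_).comp_affine
    have e : κ⁻¹ * t + -κ⁻¹ = (t - 1) / κ := by field_simp; ring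
    rw [e, mem_Ioo, lt_div_iff₀ hκ, div_lt_iff₀ hκ]
    constructor <;> linarith [ht.1, ht.2]
  have heq : γ =ᶠ[𝓝 1] fun t ↦ β (κ⁻¹ * t + -κ⁻¹) := by
    refine geodesic_eventuallyEq hn hg
      (Filter.mem_of_superset (Ioo_mem_nhds (by linarith) (by linarith)) hγ)
      (Filter.mem_of_superset (Ioo_mem_nhds (by linarith) (by linarith)) hβ') hp
      (by simp [h0]) ?_
    have h1 := deriv_comp_mul_left κ⁻¹ (fun s ↦ coordCurve (m := m) p β (s + -κ⁻¹)) 1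
    rw [deriv_comp_add_const, mul_one, add_neg_cancel, hd, smul_smul, inv_mul_cancel₀ hκ.ne',
      one_smul] at h1
    exact h1.symm
  refine ⟨fun t ↦ if t < 1 then γ t else β (κ⁻¹ * t + -κ⁻¹), fun t ht ↦ ?_, ?_, ?_⟩
  · rcases lt_trichotomy t 1 with h | rfl | h
    · refine (hγ t ⟨ht.1, by linarith⟩).congr ?_
      filter_upwards [gt_mem_nhds h] with r hr
      simp [hr]
    · refine (hγ 1 ⟨by linarith, by linarith⟩).congr ?_
      filter_upwards [heq] with r hr
      split_ifs
      · rfl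
      · exact hr.symm
    · refine (hβ' t ⟨by linarith, ht.2⟩).congr ?_
      filter_upwards [lt_mem_nhds h] with r hr
      simp [hr.le]
  · filter_upwards [gt_mem_nhds (zero_lt_one' ℝ)] with r hr
    simp [hr]
  · have : ¬ (1 + κ < 1) := by linarith
    simp only [this, if_false]
    congr 1
    field_simp
    ring

end Exp

/-! ### Regularity of the exponential map -/

section Exp

variable {m : ℕ} {M : Type*} [TopologicalSpace M] [ChartedSpace (Eu m) M]

/-- The exponential map is defined and of class `C^n` near `v`. -/
def ExpSmoothNear (n : WithTop ℕ∞) (U : Set M) (g : FormField m M) (P : M) (v : Eu m) : Prop :=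
  ∀ᶠ w in 𝓝 v, HasGeod U g P w ∧ ContMDiffAt (𝓡 m) (𝓡 m) n (expE U g P) w

theorem isOpen_expSmoothNear (n : WithTop ℕ∞) (U : Set M) (g : FormField m M) (P : M) :
    IsOpen {v | ExpSmoothNear n U g P v} := isOpen_setOfPred_eventually_nhds

variable [IsManifold (𝓡 m) ∞ M] [T2Space M]

theorem contMDiffAt_symm_comp {n : WithTop ℕ∞} [IsManifold (𝓡 m) n M] {p : M} {f : Eu m → Eu m}
    {v : Eu m} (hf : ContDiffAt ℝ n f v) (h : f v ∈ (extChartAt (𝓡 m) p).target) :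
    ContMDiffAt (𝓡 m) (𝓡 m) n (fun w ↦ (extChartAt (𝓡 m) p).symm (f w)) v :=
  (contMDiffAt_extChartAt_symm h).comp v hf.contMDiffAt

/-- A small w is reached by the flow for the fixed time ε / 2 with the velocity w / (ε / 2), which
is close to 0. -/
theorem expSmoothNear_zero {n : WithTop ℕ∞} (hn : n = (∞ : WithTop ℕ∞) ∨ n = ω)
    [IsManifold (𝓡 m) n M] {U : Set M} {g : FormField m M} (hg : IsMetric n U g) {P : M}
    (hP : P ∈ U) : ExpSmoothNear n U g P 0 := by
  obtain ⟨ε, hε, V, hV, hzV, h⟩ := exists_geodesic_flow hn hg (p := P)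
    (z₀ := (extChartAt (𝓡 m) P P, 0)) (extChartAt_mem_chartDomain (mem_chart_source _ _) hP)
  have hs : |ε / 2| < ε := by rw [abs_of_pos (by positivity)]; linarith
  obtain ⟨φ, hφ, hγ⟩ := h (ε / 2) hs
  have hlim : ContinuousAt (fun w : Eu m ↦ (extChartAt (𝓡 m) P P, (ε / 2)⁻¹ • w)) 0 := by
    fun_prop
  have hev : ∀ᶠ w : Eu m in 𝓝 0, (extChartAt (𝓡 m) P P, (ε / 2)⁻¹ • w) ∈ V :=
    hlim.preimage_mem_nhds (hV.mem_nhds (by simpa using hzV))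
  have key : ∀ᶠ w : Eu m in 𝓝 0, HasGeod U g P w ∧ expE U g P w
      = (extChartAt (𝓡 m) P).symm (φ (extChartAt (𝓡 m) P P, (ε / 2)⁻¹ • w)).1 ∧
      ContMDiffAt (𝓡 m) (𝓡 m) n (fun w ↦
        (extChartAt (𝓡 m) P).symm (φ (extChartAt (𝓡 m) P P, (ε / 2)⁻¹ • w)).1) w := by
    filter_upwards [hev] with w hw
    obtain ⟨h1, -, γ, hγ, hγ0, hγd, hγ1⟩ := hγ _ hw
    have h2 : γ 0 = P := hγ0.trans (extChartAt_to_inv P)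
    have h3 := expE_smul hn hg isOpen_Ioo ordConnected_Ioo (v := w) (by norm_num) hγ h2
      (by rw [hγd, smul_smul, mul_inv_cancel₀ (by positivity), one_smul])
      (t := 1) (by norm_num)
    rw [one_smul] at h3
    refine ⟨h3.1, h3.2.trans hγ1, contMDiffAt_symm_comp (f := fun w ↦
      (φ (extChartAt (𝓡 m) P P, (ε / 2)⁻¹ • w)).1) ?_ h1.1⟩
    have h4 : ContDiffAt ℝ n (fun w : Eu m ↦ (extChartAt (𝓡 m) P P, (ε / 2)⁻¹ • w)) w := by
      fun_prop
    have h5 : ContDiffAt ℝ n φ (extChartAt (𝓡 m) P P, (ε / 2)⁻¹ • w) :=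
      hφ.contDiffAt (hV.mem_nhds hw)
    exact contDiffAt_fst.comp w (h5.comp w h4)
  filter_upwards [key.eventually_nhds] with w hw
  exact ⟨hw.self_of_nhds.1, hw.self_of_nhds.2.2.congr_of_eventuallyEq (hw.mono fun z hz ↦ hz.2.1)⟩

/-- Regularity propagates along the ray from 0 to v₀. Near a first bad time t₀ the exponential map
would be its restriction to an earlier good time followed by a local flow, hence regular. -/
theorem HasGeod.expSmoothNear {n : WithTop ℕ∞} (hn : n = (∞ : WithTop ℕ∞) ∨ n = ω)
    [IsManifold (𝓡 m) n M] {U : Set M} {g : FormField m M} (hg : IsMetric n U g) {P : M}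
    {v₀ : Eu m} (hP : P ∈ U) (hv₀ : HasGeod U g P v₀) : ExpSmoothNear n U g P v₀ := by
  have hn1 : n + 1 ≤ n := by rcases hn with rfl | rfl <;> simp
  by_contra hcon
  obtain ⟨γ, ε, hε, hγ, hγ0, hγd⟩ := hv₀.exists_curve hn hg
  have hSo : IsOpen {t : ℝ | ExpSmoothNear n U g P (t • v₀)} :=
    (isOpen_expSmoothNear n U g P).preimage (f := fun t : ℝ ↦ t • v₀) (by fun_prop)
  obtain ⟨t₀, ⟨ht₀, hbad⟩, hleast⟩ := ((isCompact_Icc (a := (0 : ℝ)) (b := 1)).inter_right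
    hSo.isClosed_compl).exists_isLeast ⟨1, ⟨zero_le_one, le_rfl⟩, by simpa using hcon⟩
  have hpos : 0 < t₀ := by
    refine ht₀.1.lt_of_ne fun h ↦ hbad ?_
    rw [← h, mem_ofPred_eq, zero_smul]
    exact expSmoothNear_zero hn hg hP
  have hgood : ∀ t ∈ Ico 0 t₀, ExpSmoothNear n U g P (t • v₀) := fun t ht ↦ by
    by_contra h
    exact (hleast ⟨⟨ht.1, ht.2.le.trans ht₀.2⟩, h⟩).not_gt ht.2
  have hmem : ∀ t ∈ Icc 0 t₀, t ∈ Ioo (-ε) (1 + ε) := fun t ht ↦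
    ⟨by linarith [ht.1], by linarith [ht.2, ht₀.2]⟩
  have hg₀ := (hγ t₀ (hmem t₀ ⟨hpos.le, le_rfl⟩)).1
  have hp₀ := mem_chart_source (Eu m) (γ t₀)
  have h1n := one_le_of_infty_or_omega hn
  set p := γ t₀ with hp
  obtain ⟨ε', hε', V, hV, hzV, hflow⟩ := exists_geodesic_flow hn hg (p := p)
    (z₀ := (coordCurve p γ t₀, deriv (coordCurve p γ) t₀))
    (extChartAt_mem_chartDomain hp₀ hg₀.mem)
  have hcont := (hg₀.hasDerivAt hg h1n hp₀).continuousAt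
  have hev : ∀ᶠ t in 𝓝[<] t₀, (coordCurve (m := m) p γ t, deriv (coordCurve p γ) t) ∈ V ∧
      γ t ∈ (chartAt (Eu m) p).source ∧ t ∈ Ioo (max 0 (t₀ - ε')) t₀ := by
    have h1 := hcont.preimage_mem_nhds (hV.mem_nhds hzV)
    have h2 := hg₀.contMDiffAt.continuousAt.preimage_mem_nhds
      ((chartAt (Eu m) p).open_source.mem_nhds hp₀)
    filter_upwards [mem_nhdsWithin_of_mem_nhds h1, mem_nhdsWithin_of_mem_nhds h2,
      Ioo_mem_nhdsLT (max_lt hpos (by linarith : t₀ - ε' < t₀))] with t a b c using ⟨a, b, c⟩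
  -- A time shortly before t₀ at which position and velocity lie in the flow box V about the state
  -- at t₀, with remaining time t₀ - t₁ below ε'.
  obtain ⟨t₁, hV₁, hsrc₁, ht₁⟩ := hev.exists
  have ht₁0 : 0 < t₁ := (le_max_left _ _).trans_lt ht₁.1
  have hs : 0 < t₀ - t₁ := sub_pos.2 ht₁.2
  obtain ⟨φ, hφ, hβ⟩ := hflow (t₀ - t₁) (by
    rw [abs_of_pos hs]; linarith [(le_max_right 0 (t₀ - ε')).trans_lt ht₁.1])
  set χ : Eu m → Eu m := extChartAt (𝓡 m) p ∘ expE U g P with hχ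
  -- The geodesic s ↦ exp(s w) has velocity `fderiv ℝ χ w w` at s = 1. So σ(w) is the state at time
  -- t₁ of the geodesic with initial velocity w / t₁.
  set σ : Eu m → Eu m × Eu m := fun w ↦ (χ w, t₁⁻¹ • fderiv ℝ χ w w) with hσ
  have hgood₁ := hgood t₁ ⟨ht₁0.le, ht₁.2⟩
  have hγ₁ : expE U g P (t₁ • v₀) = γ t₁ := (hγ t₁ (hmem t₁ ⟨ht₁0.le, ht₁.2.le⟩)).2.2
  have hsrc : ∀ᶠ w in 𝓝 (t₁ • v₀), expE U g P w ∈ (chartAt (Eu m) p).source :=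
    hgood₁.self_of_nhds.2.continuousAt.preimage_mem_nhds
      ((chartAt (Eu m) p).open_source.mem_nhds (by rwa [hγ₁]))
  have hχs : ∀ᶠ w in 𝓝 (t₁ • v₀), ContDiffAt ℝ n χ w := by
    filter_upwards [hsrc, hgood₁] with w h1 h2
    exact contMDiffAt_extChartAt_comp h2.2 h1
  have hσs : ∀ᶠ w in 𝓝 (t₁ • v₀), ContDiffAt ℝ n σ w := by
    filter_upwards [hχs] with w h1
    exact h1.prodMk (((h1.fderiv_right hn1).clm_apply contDiffAt_id).const_smul _)
  have hray : ∀ (w : Eu m) (r : ℝ) (α : ℝ → M), (∀ᶠ s in 𝓝 r, expE U g P (s • w) = α s) →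
      ContDiffAt ℝ n χ (r • w) →
      coordCurve p α r = χ (r • w) ∧ deriv (coordCurve (m := m) p α) r = fderiv ℝ χ (r • w) w := by
    intro w r α hα hd
    have e : coordCurve (m := m) p α =ᶠ[𝓝 r] fun s ↦ χ (s • w) :=
      hα.mono fun s hs ↦ by simp only [coordCurve, ← hs]; rfl
    refine ⟨e.self_of_nhds, ?_⟩
    rw [e.deriv_eq]
    have h1 : HasDerivAt (fun s : ℝ ↦ s • w) w r := by
      simpa using (hasDerivAt_id r).smul_const w
    have h2 := (hd.differentiableAt (zero_lt_one.trans_le h1n).ne').hasFDerivAt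
    exact (h2.comp_hasDerivAt r h1).deriv
  have hσ₁ : σ (t₁ • v₀) ∈ V := by
    have hI : Ioo (-ε) (1 + ε) ∈ 𝓝 t₁ := isOpen_Ioo.mem_nhds (hmem t₁ ⟨ht₁0.le, ht₁.2.le⟩)
    have h1 := hray v₀ t₁ γ (Filter.mem_of_superset hI fun s hs ↦ (hγ s hs).2.2)
      hχs.self_of_nhds
    rw [h1.1, h1.2] at hV₁
    simpa only [hσ, map_smul, smul_smul, inv_mul_cancel₀ ht₁0.ne', one_smul] using hV₁
  have hσV : ∀ᶠ w in 𝓝 (t₁ • v₀), σ w ∈ V :=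
    hσs.self_of_nhds.continuousAt.preimage_mem_nhds (hV.mem_nhds hσ₁)
  have hmain : ∀ᶠ w in 𝓝 (t₁ • v₀), HasGeod U g P ((t₀ / t₁) • w) ∧
      expE U g P ((t₀ / t₁) • w) = (extChartAt (𝓡 m) p).symm (φ (σ w)).1 ∧
      ContMDiffAt (𝓡 m) (𝓡 m) n (fun w ↦ (extChartAt (𝓡 m) p).symm (φ (σ w)).1) w := by
    filter_upwards [hσV, hσs, hχs, hsrc, hgood₁] with w hwV hws hwχ hwsrc hwg
    obtain ⟨hφ1, -, β, hβg, hβ0, hβd, hβ1⟩ := hβ _ hwV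
    obtain ⟨γ', δ, hδ, hγ', hγ'0, hγ'd⟩ := hwg.1.exists_curve hn hg
    have hγ'1 : γ' 1 = expE U g P w := by
      rw [← (hγ' 1 ⟨by linarith, by linarith⟩).2.2, one_smul]
    have h1 := hray w 1 γ' (Filter.mem_of_superset
      (Ioo_mem_nhds (by linarith : -δ < 1) (by linarith : 1 < 1 + δ)) fun s hs ↦ (hγ' s hs).2.2)
      (by rwa [one_smul])
    rw [one_smul] at h1
    -- Parametrized so as to reach exp(w) at time 1, the geodesic has to run on to time t₀ / t₁ = 1
    -- + κ.
    have hκ : 0 < (t₀ - t₁) / t₁ := div_pos hs ht₁0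
    obtain ⟨α, hα, hα0, hα1⟩ := exists_geodesic_extension hn hg (p := p) hδ hκ
      (fun t ht ↦ (hγ' t ht).1) hβg (by rwa [hγ'1])
      (by
        rw [hβ0, hγ'1]
        exact (extChartAt (𝓡 m) p).left_inv (by rwa [extChartAt_source]))
      (by
        rw [hβd, h1.2]
        simp only [hσ, smul_smul, div_eq_mul_inv])
    have hαd : coordCurve (m := m) P α =ᶠ[𝓝 0] coordCurve P γ' :=
      hα0.mono fun s hs ↦ by simp [coordCurve, hs]
    have h2 := expE_smul hn hg isOpen_Ioo ordConnected_Ioo (v := w) (t := t₀ / t₁)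
      (by constructor <;> linarith) hα (hα0.self_of_nhds.trans hγ'0) (by rw [hαd.deriv_eq, hγ'd])
      (by
        have e : t₀ / t₁ = 1 + (t₀ - t₁) / t₁ := by field_simp; ring
        rw [e]
        constructor <;> linarith)
    have e : t₀ / t₁ = 1 + (t₀ - t₁) / t₁ := by field_simp; ring
    refine ⟨h2.1, h2.2.trans ?_, contMDiffAt_symm_comp (f := fun w ↦ (φ (σ w)).1) ?_ hφ1.1⟩
    · rw [e, hα1, hβ1]
    · have h5 : ContDiffAt ℝ n φ (σ w) := hφ.contDiffAt (hV.mem_nhds hwV)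
      exact contDiffAt_fst.comp w (h5.comp w hws)
  refine hbad ?_
  have hscale : Filter.Tendsto (fun v : Eu m ↦ (t₁ / t₀) • v) (𝓝 (t₀ • v₀)) (𝓝 (t₁ • v₀)) := by
    have : Continuous (fun v : Eu m ↦ (t₁ / t₀) • v) := by fun_prop
    have h := this.tendsto (t₀ • v₀)
    rwa [smul_smul, div_mul_cancel₀ _ hpos.ne'] at h
  have hinv : ∀ v : Eu m, (t₀ / t₁) • (t₁ / t₀) • v = v := fun v ↦ by
    rw [smul_smul, div_mul_div_cancel₀ ht₁0.ne', div_self hpos.ne', one_smul]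
  filter_upwards [(hscale.eventually hmain).eventually_nhds] with v hv
  have hv0 := hv.self_of_nhds
  rw [hinv] at hv0
  refine ⟨hv0.1, ContMDiffAt.congr_of_eventuallyEq (f := fun v ↦
    (extChartAt (𝓡 m) p).symm (φ (σ ((t₁ / t₀) • v))).1) ?_ ?_⟩
  · have h6 : ContMDiffAt (𝓡 m) (𝓡 m) n (fun v : Eu m ↦ (t₁ / t₀) • v) v :=
      ContDiffAt.contMDiffAt (by fun_prop)
    exact hv0.2.2.comp v h6
  · filter_upwards [hv] with w hw
    rw [hinv] at hw
    exact hw.2.1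

theorem mderiv_eq_fderiv {N : Eu m → M} {x : Eu m} (h : MDifferentiableAt (𝓡 m) (𝓡 m) N x) :
    mderiv N x = fderiv ℝ (extChartAt (𝓡 m) (N x) ∘ N) x := by
  have h1 : mderiv N x = (fderivWithin ℝ (writtenInExtChartAt (𝓡 m) (𝓡 m) x N) (range (𝓡 m))
      (extChartAt (𝓡 m) x x) : Eu m →L[ℝ] Eu m) := h.mfderiv
  rw [h1]
  simp only [writtenInExtChartAt, extChartAt_model_space_eq_id, PartialEquiv.refl_symm,
    PartialEquiv.refl_coe, Function.comp_id, modelWithCornersSelf_coe, range_id, id_eq,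
    fderivWithin_univ]

theorem expE_zero {n : WithTop ℕ∞} (hn : n = (∞ : WithTop ℕ∞) ∨ n = ω) [IsManifold (𝓡 m) n M]
    {U : Set M} {g : FormField m M} (hg : IsMetric n U g) {P : M} (hP : P ∈ U) :
    expE U g P 0 = P := by
  obtain ⟨γ, ε, hε, hγ, hγ0, -⟩ := (expSmoothNear_zero hn hg hP).self_of_nhds.1.exists_curve hn hg
  have := (hγ 0 ⟨by linarith, by linarith⟩).2.2
  rwa [zero_smul, hγ0] at this

/-- The curve s ↦ exp(s v) is the geodesic with initial velocity v; differentiate it at s = 0. -/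
theorem mderiv_expE_zero {n : WithTop ℕ∞} (hn : n = (∞ : WithTop ℕ∞) ∨ n = ω)
    [IsManifold (𝓡 m) n M] {U : Set M} {g : FormField m M} (hg : IsMetric n U g) {P : M}
    (hP : P ∈ U) : mderiv (expE U g P) 0 = ContinuousLinearMap.id ℝ (Eu m) := by
  have h0 := expSmoothNear_zero hn hg hP
  have hn0 : n ≠ 0 := (zero_lt_one.trans_le (one_le_of_infty_or_omega hn)).ne'
  have hz := expE_zero hn hg hP
  rw [mderiv_eq_fderiv (h0.self_of_nhds.2.mdifferentiableAt hn0), hz]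
  set L := fderiv ℝ (extChartAt (𝓡 m) P ∘ expE U g P) 0 with hL
  have hχ : DifferentiableAt ℝ (extChartAt (𝓡 m) P ∘ expE U g P) 0 :=
    (contMDiffAt_extChartAt_comp h0.self_of_nhds.2
      (by rw [hz]; exact mem_chart_source _ _)).differentiableAt hn0
  have key : ∀ᶠ v : Eu m in 𝓝 0, L v = v := by
    filter_upwards [h0] with v hv
    obtain ⟨γ, ε, hε, hγ, hγ0, hγd⟩ := hv.1.exists_curve hn hg
    have e : coordCurve (m := m) P γ =ᶠ[𝓝 0]
        fun s ↦ (extChartAt (𝓡 m) P ∘ expE U g P) (s • v) := by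
      filter_upwards [Ioo_mem_nhds (by linarith : -ε < 0) (by linarith : 0 < 1 + ε)] with s hs
      simp only [coordCurve, ← (hγ s hs).2.2]
      rfl
    have h1 : HasDerivAt (fun s : ℝ ↦ s • v) v 0 := by
      simpa using (hasDerivAt_id (0 : ℝ)).smul_const v
    have h2 := hχ.hasFDerivAt
    rw [← zero_smul ℝ v] at h2
    have h3 := (h2.comp_hasDerivAt (0 : ℝ) h1).deriv
    rw [e.deriv_eq] at hγd
    rw [zero_smul] at h3
    exact h3.symm.trans hγd
  ext1 v
  -- `key` covers only small vectors; some nonzero multiple of v is small, and L is linear.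
  have hlim : Filter.Tendsto (fun s : ℝ ↦ s • v) (𝓝[≠] 0) (𝓝 0) := by
    have : ContinuousAt (fun s : ℝ ↦ s • v) 0 := by fun_prop
    have h := this.tendsto
    rw [zero_smul] at h
    exact h.mono_left nhdsWithin_le_nhds
  obtain ⟨s, hs, hs0⟩ := ((hlim.eventually key).and self_mem_nhdsWithin).exists
  rw [map_smul] at hs
  exact smul_right_injective _ hs0 hs

end Exp

/-! ### The inverse function theorem for maps into the manifold -/

section Inverse

variable {m : ℕ} {M : Type*} [TopologicalSpace M] [ChartedSpace (Eu m) M] [IsManifold (𝓡 m) ∞ M]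

theorem exists_fderiv_extChartAt_comp_equiv {N : Eu m → M} {x : Eu m}
    (hN : MDifferentiableAt (𝓡 m) (𝓡 m) N x) (hi : Function.Injective (mderiv N x)) :
    ∃ e : Eu m ≃L[ℝ] Eu m, (e : Eu m →L[ℝ] Eu m) = fderiv ℝ (extChartAt (𝓡 m) (N x) ∘ N) x := by
  have h := injective_fderiv_extChartAt_comp hN (mem_chart_source _ _) hi
  refine ⟨(LinearEquiv.ofInjectiveEndo
    (fderiv ℝ (extChartAt (𝓡 m) (N x) ∘ N) x).toLinearMap h).toContinuousLinearEquiv, ?_⟩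
  ext
  rfl

/-- The dimensions agree, so an injective derivative is invertible and the inverse function theorem
applies in the chart at N(x). -/
theorem map_nhds_of_injective_mderiv {n : WithTop ℕ∞} [IsManifold (𝓡 m) n M] (hn : n ≠ 0)
    {N : Eu m → M} {x : Eu m}
    (hN : ContMDiffAt (𝓡 m) (𝓡 m) n N x) (hi : Function.Injective (mderiv N x)) :
    Filter.map N (𝓝 x) = 𝓝 (N x) ∧ (∃ V ∈ 𝓝 x, InjOn N V) ∧
      (∀ᶠ v in 𝓝 x, MDifferentiableAt (𝓡 m) (𝓡 m) N v → Function.Injective (mderiv N v)) ∧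
      ∀ k : M → Eu m, (∀ᶠ v in 𝓝 x, k (N v) = v) → ContMDiffAt (𝓡 m) (𝓡 m) n k (N x) := by
  obtain ⟨e, he⟩ := exists_fderiv_extChartAt_comp_equiv (hN.mdifferentiableAt hn) hi
  have hχ : ContDiffAt ℝ n (extChartAt (𝓡 m) (N x) ∘ N) x :=
    contMDiffAt_extChartAt_comp hN (mem_chart_source _ _)
  have hd : HasFDerivAt (extChartAt (𝓡 m) (N x) ∘ N) (e : Eu m →L[ℝ] Eu m) x := by
    rw [he]; exact (hχ.differentiableAt hn).hasFDerivAt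
  have hs : HasStrictFDerivAt (extChartAt (𝓡 m) (N x) ∘ N) (e : Eu m →L[ℝ] Eu m) x :=
    hχ.hasStrictFDerivAt' hd hn
  have hsrc : ∀ᶠ v in 𝓝 x, N v ∈ (extChartAt (𝓡 m) (N x)).source :=
    hN.continuousAt.preimage_mem_nhds (extChartAt_source_mem_nhds _)
  have hN' : (extChartAt (𝓡 m) (N x)).symm ∘ (extChartAt (𝓡 m) (N x) ∘ N) =ᶠ[𝓝 x] N :=
    hsrc.mono fun v hv ↦ (extChartAt (𝓡 m) (N x)).left_inv hv
  have hmap : Filter.map N (𝓝 x) = 𝓝 (N x) := by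
    rw [← Filter.map_congr hN', ← Filter.map_map, hs.map_nhds_eq_of_equiv, Function.comp_apply,
      ← map_extChartAt_nhds_of_boundaryless, Filter.map_map]
    have : (extChartAt (𝓡 m) (N x)).symm ∘ extChartAt (𝓡 m) (N x) =ᶠ[𝓝 (N x)] id := by
      filter_upwards [extChartAt_source_mem_nhds (I := 𝓡 m) (N x)] with y hy
      exact (extChartAt (𝓡 m) (N x)).left_inv hy
    rw [Filter.map_congr this, Filter.map_id]
  have hinv := hs.eventually_left_inverse
  refine ⟨hmap, ?_, ?_, fun k hk ↦ ?_⟩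
  · refine ⟨_, hinv, fun a ha b hb hab ↦ ?_⟩
    have ha' : hs.localInverse _ _ _ ((extChartAt (𝓡 m) (N x) ∘ N) a) = a := ha
    have hb' : hs.localInverse _ _ _ ((extChartAt (𝓡 m) (N x) ∘ N) b) = b := hb
    rw [← ha', ← hb', Function.comp_apply, Function.comp_apply, hab]
  · have hc : ContinuousAt (fderiv ℝ (extChartAt (𝓡 m) (N x) ∘ N)) x :=
      hχ.continuousAt_fderiv hn
    have hop : ∀ᶠ v in 𝓝 x, fderiv ℝ (extChartAt (𝓡 m) (N x) ∘ N) v ∈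
        range ((↑) : (Eu m ≃L[ℝ] Eu m) → Eu m →L[ℝ] Eu m) :=
      hc.preimage_mem_nhds (ContinuousLinearEquiv.isOpen.mem_nhds ⟨e, he⟩)
    filter_upwards [hop, hsrc] with v hv hv' hdv
    rw [extChartAt_source] at hv'
    obtain ⟨e', he'⟩ := hv
    rw [(pullbackForm_eq_chart (fun _ ↦ 0) hdv hv').1, ← he']
    exact (injective_mderiv_extChartAt_symm ((extChartAt (𝓡 m) (N x)).map_source
      (by rwa [extChartAt_source]))).comp e'.injective
  · have hl : ContDiffAt ℝ n (hs.localInverse _ _ _) ((extChartAt (𝓡 m) (N x) ∘ N) x) :=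
      hχ.to_localInverse hd hn
    have h1 : ContMDiffAt (𝓡 m) (𝓡 m) n
        (hs.localInverse _ _ _ ∘ extChartAt (𝓡 m) (N x)) (N x) :=
      ContMDiffAt.comp (N x) hl.contMDiffAt contMDiffAt_extChartAt
    refine h1.congr_of_eventuallyEq ?_
    change ∀ᶠ y in 𝓝 (N x), k y = _
    rw [← hmap, Filter.eventually_map]
    filter_upwards [hk, hinv] with v h2 h3
    rw [h2]
    exact h3.symm

/-- The inverse and the openness of the image come from the inverse function theorem. What remains
are conditions on one or two points at a time, which are easy to transport. -/
theorem isDiffeoOnto_iff {f : Eu m → M} {s : Set (Eu m)} (hs : IsOpen s) :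
    IsDiffeoOnto f s ↔ ContMDiffOn (𝓡 m) (𝓡 m) ∞ f s ∧ InjOn f s ∧
      ∀ x ∈ s, Function.Injective (mderiv f x) := by
  have h0 : (∞ : WithTop ℕ∞) ≠ 0 := by simp
  constructor
  · rintro ⟨-, hfs, hf, h, hh, hhf⟩
    refine ⟨hf, LeftInvOn.injOn hhf, fun x hx ↦ ?_⟩
    have hfx := (hf.contMDiffAt (hs.mem_nhds hx)).mdifferentiableAt h0
    have hhx := (hh.contMDiffAt (hfs.mem_nhds ⟨x, hx, rfl⟩)).mdifferentiableAt h0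
    have e : h ∘ f =ᶠ[𝓝 x] id := Filter.mem_of_superset (hs.mem_nhds hx) hhf
    have h6 := mfderiv_comp x hhx hfx
    rw [mfderiv_eq_fderiv (f := h ∘ f), e.fderiv_eq, fderiv_id] at h6
    intro a b hab
    have h7 : ∀ a : Eu m, a = (mfderiv (𝓡 m) (𝓡 m) h (f x) (mderiv f x a) : Eu m) := fun a ↦
      congrArg (fun L : Eu m →L[ℝ] Eu m ↦ L a) h6
    rw [h7 a, h7 b, hab]
  · rintro ⟨hf, hinj, hi⟩
    have key := fun x hx ↦ map_nhds_of_injective_mderiv h0 (hf.contMDiffAt (hs.mem_nhds hx))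
      (hi x hx)
    have hopen : IsOpen (f '' s) := by
      refine isOpen_iff_mem_nhds.2 ?_
      rintro _ ⟨x, hx, rfl⟩
      rw [← (key x hx).1]
      exact Filter.image_mem_map (hs.mem_nhds hx)
    refine ⟨hs, hopen, hf, Function.invFunOn f s, ?_, fun v hv ↦ hinj.leftInvOn_invFunOn hv⟩
    rintro _ ⟨x, hx, rfl⟩
    exact ((key x hx).2.2.2 _ (Filter.mem_of_superset (hs.mem_nhds hx)
      fun v hv ↦ hinj.leftInvOn_invFunOn hv)).contMDiffWithinAt

end Inverse

/-! ### The injectivity radius and orthonormal frames -/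

section Radius

variable {m : ℕ} {M : Type*} [TopologicalSpace M] [ChartedSpace (Eu m) M]

theorem isOpen_tangentBall (g : FormField m M) (P : M) (R : ℝ≥0∞) :
    IsOpen (tangentBall g P R) := by
  have h : Continuous fun v : Eu m ↦ formAt g P v v := by fun_prop
  have h2 : Continuous fun v : Eu m ↦ ENNReal.ofReal √(formAt g P v v) :=
    ENNReal.continuous_ofReal.comp (Real.continuous_sqrt.comp h)
  exact isOpen_Iio.preimage h2

/-- `R` is a radius on which the exponential map is a diffeomorphism. -/
def IsInjRadius (U : Set M) (g : FormField m M) (P : M) (R : ℝ≥0∞) : Prop :=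
  (∀ v ∈ tangentBall g P R, HasGeod U g P v) ∧ IsDiffeoOnto (expE U g P) (tangentBall g P R)

theorem injRadius_eq (U : Set M) (g : FormField m M) (P : M) :
    injRadius U g P = sSup {R | IsInjRadius U g P R} := rfl

theorem tangentBall_mono (g : FormField m M) (P : M) {R R' : ℝ≥0∞} (h : R ≤ R') :
    tangentBall g P R ⊆ tangentBall g P R' := fun _ hv ↦ lt_of_lt_of_le hv h

theorem mem_tangentBall_sSup {g : FormField m M} {P : M} {S : Set ℝ≥0∞} {v : Eu m}
    (hv : v ∈ tangentBall g P (sSup S)) : ∃ R ∈ S, v ∈ tangentBall g P R :=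
  lt_sSup_iff.1 hv

variable [IsManifold (𝓡 m) ∞ M]

/-- The supremum is attained: each condition involves at most two vectors, and since tangent balls
are nested these already lie in one admissible ball. -/
theorem isInjRadius_injRadius (U : Set M) (g : FormField m M) (P : M) :
    IsInjRadius U g P (injRadius U g P) := by
  rw [injRadius_eq]
  set S := {R | IsInjRadius U g P R} with hS
  refine ⟨fun v hv ↦ ?_, (isDiffeoOnto_iff (isOpen_tangentBall _ _ _)).2
    ⟨fun v hv ↦ ?_, fun v hv w hw hvw ↦ ?_, fun v hv ↦ ?_⟩⟩
  · obtain ⟨R, hR, hvR⟩ := mem_tangentBall_sSup hv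
    exact hR.1 v hvR
  · obtain ⟨R, hR, hvR⟩ := mem_tangentBall_sSup hv
    exact (((isDiffeoOnto_iff (isOpen_tangentBall _ _ _)).1 hR.2).1.contMDiffAt
      ((isOpen_tangentBall _ _ _).mem_nhds hvR)).contMDiffWithinAt
  · obtain ⟨R, hR, hvR⟩ := mem_tangentBall_sSup hv
    obtain ⟨R', hR', hwR⟩ := mem_tangentBall_sSup hw
    have hmax : max R R' ∈ S := by
      rcases max_choice R R' with h | h <;> rw [h] <;> assumption
    exact ((isDiffeoOnto_iff (isOpen_tangentBall _ _ _)).1 hmax.2).2.1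
      (tangentBall_mono _ _ (le_max_left _ _) hvR) (tangentBall_mono _ _ (le_max_right _ _) hwR) hvw
  · obtain ⟨R, hR, hvR⟩ := mem_tangentBall_sSup hv
    exact ((isDiffeoOnto_iff (isOpen_tangentBall _ _ _)).1 hR.2).2.2 v hvR

/-- A linear map into the tangent space at `P` which preserves the inner products. -/
def IsFrameMap (g : FormField m M) (P : M) (L : Eu m →L[ℝ] Eu m) : Prop :=
  ∀ a b : Eu m, formAt g P (L a) (L b) = inner ℝ a b

theorem IsFrameMap.injective {g : FormField m M} {P : M} {L : Eu m →L[ℝ] Eu m}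
    (h : IsFrameMap g P L) : Function.Injective L := by
  refine (injective_iff_map_eq_zero L).2 fun a ha ↦ ?_
  have h1 := h a a
  rw [ha, map_zero] at h1
  exact inner_self_eq_zero.1 h1.symm

theorem IsFrameMap.exists_equiv {g : FormField m M} {P : M} {L : Eu m →L[ℝ] Eu m}
    (h : IsFrameMap g P L) : ∃ e : Eu m ≃L[ℝ] Eu m, (e : Eu m →L[ℝ] Eu m) = L := by
  refine ⟨(LinearEquiv.ofInjectiveEndo L.toLinearMap h.injective).toContinuousLinearEquiv, ?_⟩
  ext
  rfl

theorem IsFrameMap.tnorm_eq {g : FormField m M} {P : M} {L : Eu m →L[ℝ] Eu m}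
    (h : IsFrameMap g P L) (x : Eu m) : tnorm g P (L x) = ‖x‖ := by
  have h1 : tnorm g P (L x) = √(formAt g P (L x) (L x)) := rfl
  rw [h1, h x x, real_inner_self_eq_norm_sq, Real.sqrt_sq (norm_nonneg x)]

theorem IsFrameMap.mem_tangentBall {g : FormField m M} {P : M} {L : Eu m →L[ℝ] Eu m}
    (h : IsFrameMap g P L) {x : Eu m} {R : ℝ≥0∞} :
    L x ∈ tangentBall g P R ↔ x ∈ enormBall (Eu m) R := by
  change ENNReal.ofReal (tnorm g P (L x)) < R ↔ ‖x‖ₑ < R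
  rw [h.tnorm_eq, ofReal_norm]

/-- The linear map given by a frame. -/
noncomputable def frameMap (e : Fin m → Eu m) : Eu m →L[ℝ] Eu m :=
  ∑ i, (EuclideanSpace.proj i : Eu m →L[ℝ] ℝ).smulRight (e i)

theorem frameMap_apply (e : Fin m → Eu m) (x : Eu m) : frameMap e x = ∑ i, x i • e i := by
  simp [frameMap]

theorem frameMap_single (e : Fin m → Eu m) (i : Fin m) :
    frameMap e (EuclideanSpace.single i 1) = e i := by
  simp [frameMap_apply]

theorem normalCoord_eq (U : Set M) (g : FormField m M) (P : M) (e : Fin m → Eu m) :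
    normalCoord U g P e = expE U g P ∘ frameMap e := by
  funext x
  rw [Function.comp_apply, frameMap_apply]
  rfl

theorem isFrameMap_frameMap {g : FormField m M} {P : M} {e : Fin m → Eu m}
    (he : IsOrthoFrame g P e) : IsFrameMap g P (frameMap e) := by
  have he' : ∀ i j, formAt g P (e i) (e j) = if i = j then 1 else 0 := he
  intro a b
  simp only [frameMap_apply, map_sum, sum_apply, map_smul, smul_apply, he', smul_eq_mul,
    PiLp.inner_apply]
  simp [mul_comm]

theorem IsFrameMap.isOrthoFrame {g : FormField m M} {P : M} {L : Eu m →L[ℝ] Eu m}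
    (h : IsFrameMap g P L) : IsOrthoFrame g P fun i ↦ L (EuclideanSpace.single i 1) := by
  intro i j
  refine (h _ _).trans ?_
  simp [EuclideanSpace.inner_single_left]

theorem frameMap_of_linear (L : Eu m →L[ℝ] Eu m) :
    frameMap (fun i ↦ L (EuclideanSpace.single i 1)) = L := by
  ext1 x
  rw [frameMap_apply]
  simp only [← map_smul, ← map_sum]
  congr 1
  ext i
  simp [Pi.single_apply]

/-- An orthogonal basis of the symmetric form, normalized by positivity. -/
theorem exists_isFrameMap {n : WithTop ℕ∞} {U : Set M} {g : FormField m M}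
    (hg : IsMetric n U g) {P : M} (hP : P ∈ U) : ∃ L, IsFrameMap g P L := by
  let B : LinearMap.BilinForm ℝ (Eu m) :=
    LinearMap.mk₂ ℝ (fun a b ↦ formAt g P a b) (by simp) (by simp) (by simp) (by simp)
  have hB : LinearMap.IsSymm B := ⟨fun a b ↦ hg.symm P hP a b⟩
  obtain ⟨v, hv⟩ := LinearMap.BilinForm.exists_orthogonal_basis hB
  have hfin : Module.finrank ℝ (Eu m) = m := finrank_euclideanSpace_fin
  let v' := v.reindex (finCongr hfin)
  have hv' : ∀ i j, i ≠ j → formAt g P (v' i) (v' j) = 0 := by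
    intro i j hij
    have h1 := hv (i := (finCongr hfin).symm i) (j := (finCongr hfin).symm j)
      (fun h ↦ hij ((finCongr hfin).symm.injective h))
    simp only [v', Module.Basis.reindex_apply]
    exact h1
  have hpos : ∀ i, 0 < formAt g P (v' i) (v' i) := fun i ↦ hg.pos P hP _ (v'.ne_zero i)
  have he : IsOrthoFrame g P fun i ↦ (√(formAt g P (v' i) (v' i)))⁻¹ • v' i := by
    intro i j
    change formAt g P ((√(formAt g P (v' i) (v' i)))⁻¹ • v' i)
      ((√(formAt g P (v' j) (v' j)))⁻¹ • v' j) = _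
    rw [map_smul, map_smul, smul_apply, smul_eq_mul, smul_eq_mul]
    split_ifs with h
    · subst h
      have h1 := Real.mul_self_sqrt (hpos i).le
      have h2 := (Real.sqrt_pos.2 (hpos i)).ne'
      field_simp
      linarith [h1]
    · rw [hv' i j h, mul_zero, mul_zero]
  exact ⟨_, isFrameMap_frameMap he⟩

end Radius

/-! ### Geodesic coordinates -/

section Normal

variable {m : ℕ} {M : Type*} [TopologicalSpace M] [ChartedSpace (Eu m) M]

/-- `N` is a parametrization of a neighbourhood of `P` by geodesic coordinates, on the ball of
radius `ρ`. -/
structure IsNormalParam (U : Set M) (g : FormField m M) (P : M) (N : Eu m → M) (ρ : ℝ≥0∞) :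
    Prop where
  contMDiffOn : ContMDiffOn (𝓡 m) (𝓡 m) ∞ N (enormBall (Eu m) ρ)
  injOn : InjOn N (enormBall (Eu m) ρ)
  injective_mderiv : ∀ x ∈ enormBall (Eu m) ρ, Function.Injective (mderiv N x)
  zero : N 0 = P
  ortho : ∀ a b, pullbackForm g N 0 a b = inner ℝ a b
  geodesicAt : ∀ (v : Eu m) (t : ℝ), t • v ∈ enormBall (Eu m) ρ →
    GeodesicAt U g (fun s ↦ N (s • v)) t

theorem IsNormalParam.mem {U : Set M} {g : FormField m M} {P : M} {N : Eu m → M} {ρ : ℝ≥0∞}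
    (h : IsNormalParam U g P N ρ) {x : Eu m} (hx : x ∈ enormBall (Eu m) ρ) : N x ∈ U := by
  have := (h.geodesicAt x 1 (by rwa [one_smul])).mem
  rwa [one_smul] at this

theorem IsNormalParam.contMDiffAt {U : Set M} {g : FormField m M} {P : M} {N : Eu m → M} {ρ : ℝ≥0∞}
    (h : IsNormalParam U g P N ρ) {x : Eu m} (hx : x ∈ enormBall (Eu m) ρ) :
    ContMDiffAt (𝓡 m) (𝓡 m) ∞ N x :=
  h.contMDiffOn.contMDiffAt ((isOpen_enormBall ρ).mem_nhds hx)

theorem IsNormalParam.mdifferentiableAt {U : Set M} {g : FormField m M} {P : M} {N : Eu m → M}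
    {ρ : ℝ≥0∞} (h : IsNormalParam U g P N ρ) {x : Eu m} (hx : x ∈ enormBall (Eu m) ρ) :
    MDifferentiableAt (𝓡 m) (𝓡 m) N x :=
  (h.contMDiffAt hx).mdifferentiableAt (by simp)

theorem IsNormalParam.mono {U : Set M} {g : FormField m M} {P : M} {N : Eu m → M} {ρ ρ' : ℝ≥0∞}
    (h : IsNormalParam U g P N ρ) (hρ : ρ' ≤ ρ) : IsNormalParam U g P N ρ' := by
  have hs : enormBall (Eu m) ρ' ⊆ enormBall (Eu m) ρ := fun x hx ↦ lt_of_lt_of_le hx hρ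
  exact ⟨h.contMDiffOn.mono hs, h.injOn.mono hs, fun x hx ↦ h.injective_mderiv x (hs hx), h.zero,
    h.ortho, fun v t ht ↦ h.geodesicAt v t (hs ht)⟩

theorem IsNormalParam.isFrameMap {U : Set M} {g : FormField m M} {P : M} {N : Eu m → M}
    {ρ : ℝ≥0∞} (h : IsNormalParam U g P N ρ) : IsFrameMap g P (mderiv N 0) := fun a b ↦ by
  rw [← h.ortho, pullbackForm_apply, h.zero]

variable [IsManifold (𝓡 m) ∞ M]

theorem contDiffAt_pullbackForm {n : WithTop ℕ∞} (hn : n = (∞ : WithTop ℕ∞) ∨ n = ω)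
    [IsManifold (𝓡 m) n M] {U : Set M} {g : FormField m M} (hg : IsMetric n U g)
    {N : Eu m → M} {x : Eu m} (hx : N x ∈ U)
    (hN : ∀ᶠ z in 𝓝 x, ContMDiffAt (𝓡 m) (𝓡 m) n N z) (a b : Eu m) :
    ContDiffAt ℝ n (fun z ↦ pullbackForm g N z a b) x := by
  have hn0 : n ≠ 0 := (zero_lt_one.trans_le (one_le_of_infty_or_omega hn)).ne'
  have hn1 : n + 1 ≤ n := by rcases hn with rfl | rfl <;> simp
  set p := N x with hp
  have hsrc : ∀ᶠ z in 𝓝 x, N z ∈ (chartAt (Eu m) p).source :=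
    hN.self_of_nhds.continuousAt.preimage_mem_nhds
      ((chartAt (Eu m) p).open_source.mem_nhds (mem_chart_source _ _))
  have hχ : ContDiffAt ℝ n (extChartAt (𝓡 m) p ∘ N) x :=
    contMDiffAt_extChartAt_comp hN.self_of_nhds (mem_chart_source _ _)
  have hG : ContDiffAt ℝ n (fun z ↦ chartMetric g p ((extChartAt (𝓡 m) p ∘ N) z)) x :=
    ((hg.contDiffOn_chartMetric p).contDiffAt ((isOpen_chartDomain hg.isOpen p).mem_nhds
      (extChartAt_mem_chartDomain (mem_chart_source _ _) hx))).comp x hχ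
  have hd : ∀ a, ContDiffAt ℝ n (fun z ↦ fderiv ℝ (extChartAt (𝓡 m) p ∘ N) z a) x := fun a ↦
    (hχ.fderiv_right hn1).clm_apply contDiffAt_const
  refine ((hG.clm_apply (hd a)).clm_apply (hd b)).congr_of_eventuallyEq ?_
  filter_upwards [hN, hsrc] with z h1 h2
  exact (pullbackForm_eq_chart g (h1.mdifferentiableAt hn0) h2).2 a b

variable {U : Set M} {g : FormField m M} {P : M} {N : Eu m → M} {ρ : ℝ≥0∞}

theorem IsNormalParam.contDiffOn_pullbackForm (hg : IsMetric ∞ U g)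
    (h : IsNormalParam U g P N ρ) : ContDiffOn ℝ ∞ (pullbackForm g N) (enormBall (Eu m) ρ) :=
  contDiffOn_clm_apply.2 fun a ↦ contDiffOn_clm_apply.2 fun b _ hx ↦
    (contDiffAt_pullbackForm (Or.inl rfl) hg (h.mem hx)
      (Filter.mem_of_superset ((isOpen_enormBall ρ).mem_nhds hx) fun _ hz ↦ h.contMDiffAt hz)
      a b).contDiffWithinAt

theorem IsNormalParam.differentiableAt_pullbackForm (hg : IsMetric ∞ U g)
    (h : IsNormalParam U g P N ρ) {x : Eu m} (hx : x ∈ enormBall (Eu m) ρ) :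
    DifferentiableAt ℝ (pullbackForm g N) x :=
  ((h.contDiffOn_pullbackForm hg).contDiffAt ((isOpen_enormBall ρ).mem_nhds hx)).differentiableAt
    (by simp)

theorem IsNormalParam.pullbackForm_symm (hg : IsMetric ∞ U g) (h : IsNormalParam U g P N ρ)
    {x : Eu m} (hx : x ∈ enormBall (Eu m) ρ) (a b : Eu m) :
    pullbackForm g N x a b = pullbackForm g N x b a := hg.symm _ (h.mem hx) _ _

theorem IsNormalParam.pullbackForm_pos (hg : IsMetric ∞ U g) (h : IsNormalParam U g P N ρ)
    {x : Eu m} (hx : x ∈ enormBall (Eu m) ρ) {a : Eu m} (ha : a ≠ 0) :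
    0 < pullbackForm g N x a a :=
  hg.pos _ (h.mem hx) _ fun h0 ↦ ha (h.injective_mderiv x hx (h0.trans (map_zero _).symm))

theorem IsNormalParam.pullbackForm_nonneg (hg : IsMetric ∞ U g) (h : IsNormalParam U g P N ρ)
    {x : Eu m} (hx : x ∈ enormBall (Eu m) ρ) (a : Eu m) : 0 ≤ pullbackForm g N x a a := by
  rcases eq_or_ne a 0 with rfl | ha
  · simp
  · exact (h.pullbackForm_pos hg hx ha).le

theorem IsNormalParam.formChristoffel_eq_zero (hg : IsMetric ∞ U g)
    (h : IsNormalParam U g P N ρ) (v : Eu m) (t : ℝ) (ht : t • v ∈ enormBall (Eu m) ρ) (w : Eu m) :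
    formChristoffel (pullbackForm g N) (t • v) v v w = 0 := by
  have h1 : deriv (fun s : ℝ ↦ s • v) = fun _ ↦ v := by
    funext s
    simpa using ((hasDerivAt_id s).smul_const v).deriv
  have h2 := (geodesicAt_comp_iff (c := fun s : ℝ ↦ s • v) (t := t) hg (by simp)
    (Filter.mem_of_superset ((isOpen_enormBall ρ).mem_nhds ht) fun _ hz ↦ h.contMDiffAt hz)
    (h.injective_mderiv _ ht) (h.mem ht) (by fun_prop)).1 (h.geodesicAt v t ht) w
  simpa [geodesicExpr, h1] using h2

theorem IsNormalParam.gauss (hg : IsMetric ∞ U g) (h : IsNormalParam U g P N ρ) {x : Eu m}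
    (hx : x ∈ enormBall (Eu m) ρ) (w : Eu m) : pullbackForm g N x x w = inner ℝ x w := by
  rw [gauss_lemma (fun _ ↦ h.differentiableAt_pullbackForm hg) (fun _ ↦ h.pullbackForm_symm hg)
    (h.formChristoffel_eq_zero hg) hx w, h.ortho]

variable [T2Space M]

theorem isNormalParam_exp {n : WithTop ℕ∞} (hn : n = (∞ : WithTop ℕ∞) ∨ n = ω)
    [IsManifold (𝓡 m) n M] (hg : IsMetric n U g) (hP : P ∈ U) {L : Eu m →L[ℝ] Eu m}
    (hL : IsFrameMap g P L) (hρ : ρ ≤ injRadius U g P) :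
    IsNormalParam U g P (expE U g P ∘ L) ρ := by
  have hinj := isInjRadius_injRadius U g P
  obtain ⟨h1, h2, h3⟩ := (isDiffeoOnto_iff (isOpen_tangentBall _ _ _)).1 hinj.2
  have hmem : ∀ x ∈ enormBall (Eu m) ρ, L x ∈ tangentBall g P (injRadius U g P) :=
    fun x hx ↦ hL.mem_tangentBall.2 (lt_of_lt_of_le hx hρ)
  have h1' : ∀ x ∈ enormBall (Eu m) ρ, ContMDiffAt (𝓡 m) (𝓡 m) ∞ (expE U g P) (L x) :=
    fun x hx ↦ h1.contMDiffAt ((isOpen_tangentBall _ _ _).mem_nhds (hmem x hx))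
  have hn0 : n ≠ 0 := (zero_lt_one.trans_le (one_le_of_infty_or_omega hn)).ne'
  refine ⟨fun x hx ↦ ?_, fun x hx y hy hxy ↦ hL.injective (h2 (hmem x hx) (hmem y hy) hxy),
    fun x hx ↦ ?_, ?_, fun a b ↦ ?_, fun v t ht ↦ ?_⟩
  · exact ((h1' x hx).comp x L.contDiff.contDiffAt.contMDiffAt).contMDiffWithinAt
  · rw [mderiv_comp ((h1' x hx).mdifferentiableAt (by simp)) L.differentiableAt, L.fderiv]
    exact (h3 _ (hmem x hx)).comp hL.injective
  · rw [Function.comp_apply, map_zero, expE_zero hn hg hP]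
  · have h0 := (expSmoothNear_zero hn hg hP).self_of_nhds.2.mdifferentiableAt hn0
    rw [← map_zero L] at h0
    rw [pullbackForm_apply, mderiv_comp h0 L.differentiableAt, L.fderiv, Function.comp_apply,
      map_zero, mderiv_expE_zero hn hg hP, expE_zero hn hg hP]
    exact hL a b
  -- The geodesic with initial velocity L(τ v) exists on a neighbourhood of [0, 1], and it passes
  -- the ray parameter t at time t / τ. Take τ = t, or any small nonzero τ when t = 0.
  · obtain ⟨τ, hτ0, hτ, hτt⟩ : ∃ τ : ℝ, τ ≠ 0 ∧ τ • v ∈ enormBall (Eu m) ρ ∧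
        τ⁻¹ * t ∈ Icc (0 : ℝ) 1 := by
      rcases eq_or_ne t 0 with rfl | h
      · have hc : ContinuousAt (fun s : ℝ ↦ s • v) 0 := by fun_prop
        have h4 := hc.preimage_mem_nhds ((isOpen_enormBall ρ).mem_nhds ht)
        obtain ⟨τ, h5, h6⟩ := ((Filter.Eventually.filter_mono nhdsWithin_le_nhds h4).and
          (self_mem_nhdsWithin : ({0}ᶜ : Set ℝ) ∈ 𝓝[≠] 0)).exists
        exact ⟨τ, h6, h5, by simp⟩
      · exact ⟨t, h, ht, by simp [h]⟩
    obtain ⟨γ, ε, hε, hγ, -, -⟩ := (hinj.1 _ (hmem _ hτ)).exists_curve hn hg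
    have hIoo : τ⁻¹ * t + 0 ∈ Ioo (-ε) (1 + ε) := by
      rw [add_zero]
      exact ⟨by linarith [hτt.1], by linarith [hτt.2]⟩
    refine (hγ _ hIoo).1.comp_affine.congr ?_
    have hc : ContinuousAt (fun s : ℝ ↦ τ⁻¹ * s + 0) t := by fun_prop
    filter_upwards [hc.preimage_mem_nhds (isOpen_Ioo.mem_nhds hIoo)] with s hs
    have e : (τ⁻¹ * s + 0) * τ = s := by field_simp; ring
    have h5 := (hγ _ hs).2.2
    simp only [map_smul, smul_smul, e] at h5
    rw [Function.comp_apply, map_smul]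
    exact h5

/-- The images of rays are geodesics with the initial velocities given by the derivative at 0, so
every normal parametrization is the exponential map after that linear map. -/
theorem IsNormalParam.hasGeod_and_expE {n : WithTop ℕ∞} (hn : n = (∞ : WithTop ℕ∞) ∨ n = ω)
    (hg : IsMetric n U g) (h : IsNormalParam U g P N ρ) {x : Eu m}
    (hx : x ∈ enormBall (Eu m) ρ) :
    HasGeod U g P (mderiv N 0 x) ∧ expE U g P (mderiv N 0 x) = N x := by
  have hρ : 0 < ρ := lt_of_le_of_lt zero_le hx
  have h0 := zero_mem_enormBall (E := Eu m) hρ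
  have hlin : IsLinearMap ℝ (fun s : ℝ ↦ s • x) :=
    ⟨fun a b ↦ add_smul a b x, fun a b ↦ by simp [smul_smul]⟩
  have hχ : HasFDerivAt (extChartAt (𝓡 m) P ∘ N) (mderiv N 0) 0 := by
    have h2 := mderiv_eq_fderiv (h.mdifferentiableAt h0)
    rw [h.zero] at h2
    rw [h2]
    exact ((contMDiffAt_extChartAt_comp (h.contMDiffAt h0)
      (by rw [h.zero]; exact mem_chart_source _ _)).differentiableAt (by simp)).hasFDerivAt
  have h1 : HasDerivAt (fun s : ℝ ↦ s • x) x 0 := by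
    simpa using (hasDerivAt_id (0 : ℝ)).smul_const x
  rw [← zero_smul ℝ x] at hχ
  have h3 := (hχ.comp_hasDerivAt (0 : ℝ) h1).deriv
  rw [zero_smul] at h3
  have h4 := expE_smul hn hg (P := P) (v := mderiv N 0 x) (γ := fun s : ℝ ↦ N (s • x))
    (J := (fun s : ℝ ↦ s • x) ⁻¹' enormBall (Eu m) ρ)
    ((isOpen_enormBall ρ).preimage (by fun_prop))
    ((convex_enormBall ρ).is_linear_preimage hlin).ordConnected (by simpa using h0)
    (fun t ht ↦ h.geodesicAt x t ht) (by simp [h.zero]) h3 (t := 1) (by simpa using hx)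
  simpa using h4

theorem IsNormalParam.le_injRadius {n : WithTop ℕ∞} (hn : n = (∞ : WithTop ℕ∞) ∨ n = ω)
    (hg : IsMetric n U g) (h : IsNormalParam U g P N ρ) : ρ ≤ injRadius U g P := by
  rw [injRadius_eq]
  refine le_sSup ?_
  have hL := h.isFrameMap
  obtain ⟨e, he⟩ := hL.exists_equiv
  have hmem : ∀ v ∈ tangentBall g P ρ, e.symm v ∈ enormBall (Eu m) ρ ∧
      mderiv N 0 (e.symm v) = v := by
    intro v hv
    have h1 : mderiv N 0 (e.symm v) = v := by
      rw [← he]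
      exact e.apply_symm_apply v
    exact ⟨hL.mem_tangentBall.1 (by rwa [h1]), h1⟩
  have heq : EqOn (expE U g P) (N ∘ e.symm) (tangentBall g P ρ) := by
    intro v hv
    obtain ⟨h1, h2⟩ := hmem v hv
    have := (h.hasGeod_and_expE hn hg h1).2
    rwa [h2] at this
  refine ⟨fun v hv ↦ ?_, (isDiffeoOnto_iff (isOpen_tangentBall _ _ _)).2
    ⟨fun v hv ↦ ?_, fun v hv w hw hvw ↦ ?_, fun v hv ↦ ?_⟩⟩
  · obtain ⟨h1, h2⟩ := hmem v hv
    have := (h.hasGeod_and_expE hn hg h1).1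
    rwa [h2] at this
  · refine ContMDiffWithinAt.congr ?_ heq (heq hv)
    exact (ContMDiffAt.comp v (h.contMDiffAt (hmem v hv).1)
      e.symm.contDiff.contDiffAt.contMDiffAt).contMDiffWithinAt
  · rw [heq hv, heq hw] at hvw
    exact e.symm.injective (h.injOn (hmem v hv).1 (hmem w hw).1 hvw)
  · have h1 : expE U g P =ᶠ[𝓝 v] N ∘ e.symm :=
      Filter.mem_of_superset ((isOpen_tangentBall _ _ _).mem_nhds hv) heq
    have h2 : mderiv (expE U g P) v = mderiv (N ∘ e.symm) v := h1.mfderiv_eq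
    rw [h2, mderiv_comp (h.mdifferentiableAt (hmem v hv).1) e.symm.differentiableAt,
      e.symm.fderiv]
    exact (h.injective_mderiv _ (hmem v hv).1).comp e.symm.injective

/-- The derivative of the exponential map at 0 is the identity, so the inverse function theorem
applies there. -/
theorem injRadius_pos {n : WithTop ℕ∞} (hn : n = (∞ : WithTop ℕ∞) ∨ n = ω)
    [IsManifold (𝓡 m) n M] (hg : IsMetric n U g) (hP : P ∈ U) : 0 < injRadius U g P := by
  obtain ⟨L, hL⟩ := exists_isFrameMap hg hP
  obtain ⟨e, he⟩ := hL.exists_equiv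
  have hn0 : n ≠ 0 := (zero_lt_one.trans_le (one_le_of_infty_or_omega hn)).ne'
  have hn8 : (∞ : WithTop ℕ∞) ≤ n := by rcases hn with rfl | rfl <;> simp
  have h0 := expSmoothNear_zero hn hg hP
  have hid : Function.Injective (mderiv (expE U g P) 0) := by
    rw [mderiv_expE_zero hn hg hP]
    exact Function.injective_id
  obtain ⟨-, ⟨V, hV, hVinj⟩, hmd, -⟩ := map_nhds_of_injective_mderiv hn0 h0.self_of_nhds.2 hid
  have hev : ∀ᶠ v in 𝓝 (0 : Eu m), v ∈ V ∧ HasGeod U g P v ∧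
      ContMDiffAt (𝓡 m) (𝓡 m) n (expE U g P) v ∧ Function.Injective (mderiv (expE U g P) v) := by
    filter_upwards [hV, hmd, h0] with v h1 h2 h3
    exact ⟨h1, h3.1, h3.2, h2 (h3.2.mdifferentiableAt hn0)⟩
  have hlim : Filter.Tendsto L (𝓝 0) (𝓝 0) := by
    have := L.continuous.tendsto 0
    rwa [map_zero] at this
  obtain ⟨r, hr, hball⟩ := Metric.eventually_nhds_iff_ball.1 (hlim.eventually hev)
  have hmem : ∀ v ∈ tangentBall g P (ENNReal.ofReal r), v ∈ V ∧ HasGeod U g P v ∧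
      ContMDiffAt (𝓡 m) (𝓡 m) n (expE U g P) v ∧ Function.Injective (mderiv (expE U g P) v) := by
    intro v hv
    have h1 : L (e.symm v) = v := by
      rw [← he]
      exact e.apply_symm_apply v
    have h2 : e.symm v ∈ enormBall (Eu m) (ENNReal.ofReal r) := hL.mem_tangentBall.1 (by rwa [h1])
    have h3 : ‖e.symm v‖ₑ < ENNReal.ofReal r := h2
    rw [← ofReal_norm, ENNReal.ofReal_lt_ofReal_iff hr] at h3
    have := hball (e.symm v) (by simpa using h3)
    rwa [h1] at this
  rw [injRadius_eq]
  refine (ENNReal.ofReal_pos.2 hr).trans_le (le_sSup ⟨fun v hv ↦ (hmem v hv).2.1, ?_⟩)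
  refine (isDiffeoOnto_iff (isOpen_tangentBall _ _ _)).2 ⟨fun v hv ↦ ?_,
    hVinj.mono fun v hv ↦ (hmem v hv).1, fun v hv ↦ (hmem v hv).2.2.2⟩
  exact ((hmem v hv).2.2.1.of_le hn8).contMDiffWithinAt

end Normal

/-! ### Lengths of curves and the geodesic distance -/

open MeasureTheory in
-- f is C¹ only in the open interval, so the fundamental theorem is used on compact subintervals,
-- whose endpoints then tend to a and b by continuity.
theorem enorm_sub_le_lintegral {f : ℝ → ℝ} {φ : ℝ → ℝ≥0∞} {a b : ℝ} (hab : a < b)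
    (hc : ContinuousOn f (Icc a b)) (hd : ContDiffOn ℝ 1 f (Ioo a b))
    (hφ : ∀ t ∈ Ioo a b, ‖deriv f t‖ₑ ≤ φ t) : ‖f b - f a‖ₑ ≤ ∫⁻ t in Ioo a b, φ t := by
  have hd' : ContinuousOn (deriv f) (Ioo a b) := hd.continuousOn_deriv_of_isOpen isOpen_Ioo le_rfl
  have key : ∀ s ∈ Ioo a b, ∀ t ∈ Ioo a b, s ≤ t → ‖f t - f s‖ₑ ≤ ∫⁻ t in Ioo a b, φ t := by
    intro s hs t ht hst
    have hsub : uIcc s t ⊆ Ioo a b := by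
      rw [uIcc_of_le hst]
      exact Icc_subset_Ioo hs.1 ht.2
    have h1 := intervalIntegral.integral_eq_sub_of_hasDerivAt (f := f) (f' := deriv f)
      (fun x hx ↦ ((hd.contDiffAt (isOpen_Ioo.mem_nhds (hsub hx))).differentiableAt
        one_ne_zero).hasDerivAt) (hd'.mono hsub).intervalIntegrable
    rw [← h1, intervalIntegral.integral_of_le hst]
    refine (enorm_integral_le_lintegral_enorm _).trans ?_
    have hsub' : Ioc s t ⊆ Ioo a b := fun x hx ↦ ⟨hs.1.trans hx.1, hx.2.trans_lt ht.2⟩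
    exact (lintegral_mono_set hsub').trans (setLIntegral_mono' measurableSet_Ioo hφ)
  have hl : Filter.Tendsto (fun s ↦ f (b - s) - f (a + s)) (𝓝[>] 0) (𝓝 (f b - f a)) := by
    have h1 : Filter.Tendsto (fun s : ℝ ↦ b - s) (𝓝[>] 0) (𝓝[Icc a b] b) := by
      refine tendsto_nhdsWithin_iff.2 ⟨?_, ?_⟩
      · have : Continuous fun s : ℝ ↦ b - s := by fun_prop
        have h := this.tendsto 0
        rw [sub_zero] at h
        exact h.mono_left nhdsWithin_le_nhds
      · filter_upwards [Ioo_mem_nhdsGT (sub_pos.2 hab)] with s hs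
        exact ⟨by linarith [hs.2], by linarith [hs.1]⟩
    have h2 : Filter.Tendsto (fun s : ℝ ↦ a + s) (𝓝[>] 0) (𝓝[Icc a b] a) := by
      refine tendsto_nhdsWithin_iff.2 ⟨?_, ?_⟩
      · have : Continuous fun s : ℝ ↦ a + s := by fun_prop
        have h := this.tendsto 0
        rw [add_zero] at h
        exact h.mono_left nhdsWithin_le_nhds
      · filter_upwards [Ioo_mem_nhdsGT (sub_pos.2 hab)] with s hs
        exact ⟨by linarith [hs.1], by linarith [hs.2]⟩
    exact ((hc b ⟨hab.le, le_rfl⟩).tendsto.comp h1).sub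
      ((hc a ⟨le_rfl, hab.le⟩).tendsto.comp h2)
  refine le_of_tendsto hl.enorm ?_
  filter_upwards [Ioo_mem_nhdsGT (half_pos (sub_pos.2 hab))] with s hs
  have h1 := hs.1
  have h2 := hs.2
  exact key _ ⟨by linarith, by linarith⟩ _ ⟨by linarith, by linarith⟩ (by linarith)

section Distance

variable {m : ℕ} {M : Type*} [TopologicalSpace M] [ChartedSpace (Eu m) M] [IsManifold (𝓡 m) ∞ M]

theorem mfderiv_comp_curve {N : Eu m → M} {c : ℝ → Eu m} {t : ℝ}
    (hN : MDifferentiableAt (𝓡 m) (𝓡 m) N (c t)) (hc : DifferentiableAt ℝ c t) :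
    (mfderiv 𝓘(ℝ, ℝ) (𝓡 m) (N ∘ c) t (1 : ℝ) : Eu m) = mderiv N (c t) (deriv c t) := by
  have h2 := mfderiv_comp t hN hc.mdifferentiableAt
  rw [mfderiv_eq_fderiv (f := c)] at h2
  exact congrArg (fun L : ℝ →L[ℝ] Eu m ↦ L 1) h2

theorem tnorm_eq_sqrt_formAt (g : FormField m M) (p : M) (v : Eu m) :
    tnorm g p v = √(formAt g p v v) := rfl

variable {U : Set M} {g : FormField m M} {P : M} {N : Eu m → M} {ρ : ℝ≥0∞}

theorem tnorm_comp_curve {γ : ℝ → M} {c : ℝ → Eu m} {t : ℝ} (e : γ =ᶠ[𝓝 t] N ∘ c)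
    (hN : MDifferentiableAt (𝓡 m) (𝓡 m) N (c t)) (hc : DifferentiableAt ℝ c t) :
    tnorm g (γ t) (mfderiv 𝓘(ℝ, ℝ) (𝓡 m) γ t (1 : ℝ))
      = √(pullbackForm g N (c t) (deriv c t) (deriv c t)) := by
  have h1 : (mfderiv 𝓘(ℝ, ℝ) (𝓡 m) γ t (1 : ℝ) : Eu m) = mderiv N (c t) (deriv c t) := by
    rw [← mfderiv_comp_curve hN hc]
    exact congrArg (fun L : ℝ →L[ℝ] Eu m ↦ L 1) e.mfderiv_eq
  have h2 : γ t = N (c t) := e.self_of_nhds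
  have h3 := tnorm_eq_sqrt_formAt g (γ t) (mfderiv 𝓘(ℝ, ℝ) (𝓡 m) γ t (1 : ℝ) : Eu m)
  rw [h1] at h3
  rw [pullbackForm_apply, ← h2, ← h3, ← h1]

theorem IsNormalParam.pullbackForm_self (hg : IsMetric ∞ U g) (h : IsNormalParam U g P N ρ)
    {x : Eu m} {t : ℝ} (ht : t ≠ 0) (hx : t • x ∈ enormBall (Eu m) ρ) :
    pullbackForm g N (t • x) x x = ‖x‖ ^ 2 := by
  have h1 := h.gauss hg hx x
  rw [map_smul, smul_apply, inner_smul_left, smul_eq_mul, real_inner_self_eq_norm_sq] at h1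
  exact mul_left_cancel₀ ht h1

/-- By the Gauss lemma the ray to x has constant speed ‖x‖. -/
theorem IsNormalParam.geodDist_le (hg : IsMetric ∞ U g) (h : IsNormalParam U g P N ρ)
    {x : Eu m} (hx : x ∈ enormBall (Eu m) ρ) : geodDist U g P (N x) ≤ ‖x‖ₑ := by
  have hmem : ∀ t ∈ Icc (0 : ℝ) 1, t • x ∈ enormBall (Eu m) ρ := fun t ht ↦
    mem_enormBall_of_norm_le hx (by
      rw [norm_smul, Real.norm_of_nonneg ht.1]
      exact mul_le_of_le_one_left (norm_nonneg _) ht.2)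
  have hline : ContDiff ℝ ∞ (fun t : ℝ ↦ t • x) := by fun_prop
  have hγ : ContMDiffOn 𝓘(ℝ, ℝ) (𝓡 m) 1 (N ∘ fun t : ℝ ↦ t • x) (Icc 0 1) := fun t ht ↦
    (((h.contMDiffAt (hmem t ht)).comp t hline.contDiffAt.contMDiffAt).of_le
      (by simp)).contMDiffWithinAt
  refine (iInf₂_le (N ∘ fun t : ℝ ↦ t • x) ⟨hγ, fun t ht ↦ h.mem (hmem t ht), ?_, ?_⟩).trans ?_
  · have hle : ∀ t ∈ Ioo (0 : ℝ) 1, ENNReal.ofReal (tnorm g ((N ∘ fun t : ℝ ↦ t • x) t)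
        (mfderiv 𝓘(ℝ, ℝ) (𝓡 m) (N ∘ fun t : ℝ ↦ t • x) t (1 : ℝ))) ≤ ‖x‖ₑ := by
      intro t ht
      have h1 : HasDerivAt (fun s : ℝ ↦ s • x) x t := by
        simpa using (hasDerivAt_id t).smul_const x
      have hx' := hmem t (Ioo_subset_Icc_self ht)
      rw [tnorm_comp_curve (N := N) (c := fun t : ℝ ↦ t • x) Filter.EventuallyEq.rfl
        (h.mdifferentiableAt hx') h1.differentiableAt, h1.deriv,
        h.pullbackForm_self hg ht.1.ne' hx', Real.sqrt_sq (norm_nonneg _), ofReal_norm]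
    refine (MeasureTheory.setLIntegral_mono' measurableSet_Ioo hle).trans ?_
    simp
  · simp [h.zero]
  · simp

variable [T2Space M]

theorem IsNormalParam.isOpen_image (h : IsNormalParam U g P N ρ) :
    IsOpen (N '' enormBall (Eu m) ρ) :=
  ((isDiffeoOnto_iff (isOpen_enormBall ρ)).2
    ⟨h.contMDiffOn, h.injOn, h.injective_mderiv⟩).2.1

/-- A curve that leaves the coordinate ball of radius r meets its sphere. Up to that time,
Cauchy–Schwarz and the Gauss lemma bound the rate of change of the radial coordinate by the speed.
-/
theorem IsNormalParam.le_geodDist (hg : IsMetric ∞ U g) (h : IsNormalParam U g P N ρ) {r : ℝ}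
    (hr : 0 < r) (hrρ : ENNReal.ofReal r < ρ) {Q : M}
    (hQ : Q ∉ N '' enormBall (Eu m) (ENNReal.ofReal r)) :
    ENNReal.ofReal r ≤ geodDist U g P Q := by
  refine le_iInf₂ fun γ ⟨hγ, hγU, hγ0, hγ1⟩ ↦ ?_
  obtain ⟨-, hop, -, k, hk, hkN⟩ := (isDiffeoOnto_iff (isOpen_enormBall ρ)).2
    ⟨h.contMDiffOn, h.injOn, h.injective_mderiv⟩
  set D := enormBall (Eu m) ρ with hD
  set Dr := enormBall (Eu m) (ENNReal.ofReal r) with hDr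
  have hsub : Dr ⊆ D := fun x hx ↦ lt_trans hx hrρ
  have hclosed : Metric.closedBall (0 : Eu m) r ⊆ D := fun x hx ↦ by
    change ‖x‖ₑ < ρ
    rw [← ofReal_norm]
    exact (ENNReal.ofReal_le_ofReal (by simpa using hx)).trans_lt hrρ
  have hDr' : ∀ x : Eu m, x ∈ Dr ↔ ‖x‖ < r := fun x ↦ by
    change ‖x‖ₑ < ENNReal.ofReal r ↔ _
    rw [← ofReal_norm, ENNReal.ofReal_lt_ofReal_iff hr]
  have hopr : IsOpen (N '' Dr) := (h.mono hrρ.le).isOpen_image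
  have hK : IsClosed (N '' Metric.closedBall (0 : Eu m) r) :=
    ((isCompact_closedBall (0 : Eu m) r).image_of_continuousOn
      (h.contMDiffOn.continuousOn.mono hclosed)).isClosed
  have h0D : (0 : Eu m) ∈ D := hclosed (by simp [hr.le])
  have hbadc : IsCompact (Icc (0 : ℝ) 1 ∩ γ ⁻¹' (N '' Dr)ᶜ) :=
    isCompact_Icc.of_isClosed_subset
      (hγ.continuousOn.preimage_isClosed_of_isClosed isClosed_Icc hopr.isClosed_compl)
      inter_subset_left
  -- The first exit time. The image of the closed ball is compact, hence closed, so γ(t₁) still has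
  -- coordinates, and their norm is r.
  obtain ⟨t₁, ⟨ht₁, ht₁bad⟩, hleast⟩ := hbadc.exists_isLeast
    ⟨1, ⟨zero_le_one, le_rfl⟩, by rwa [mem_preimage, hγ1]⟩
  have ht₁0 : 0 < t₁ := by
    refine ht₁.1.lt_of_ne fun h' ↦ ht₁bad ?_
    rw [← h', hγ0, ← h.zero]
    exact ⟨0, (hDr' 0).2 (by simpa using hr), rfl⟩
  have hin : ∀ t ∈ Ico 0 t₁, γ t ∈ N '' Dr := fun t ht ↦ by
    by_contra hcon
    exact (hleast ⟨⟨ht.1, ht.2.le.trans ht₁.2⟩, hcon⟩).not_gt ht.2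
  have hsubI : Icc 0 t₁ ⊆ Icc (0 : ℝ) 1 := Icc_subset_Icc le_rfl ht₁.2
  have hγt₁ : γ t₁ ∈ N '' Metric.closedBall (0 : Eu m) r := by
    have hc : ContinuousWithinAt γ (Ico 0 t₁) t₁ :=
      (hγ.continuousOn t₁ ht₁).mono (Ico_subset_Icc_self.trans hsubI)
    have hcl : t₁ ∈ closure (Ico 0 t₁) := by
      rw [closure_Ico ht₁0.ne]
      exact ⟨ht₁0.le, le_rfl⟩
    refine hK.closure_subset_iff.2 ?_ (hc.mem_closure hcl hin)
    exact image_mono fun x hx ↦ by simpa using ((hDr' x).1 hx).le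
  obtain ⟨y, hy, hyt⟩ := hγt₁
  have hyr : ‖y‖ = r := by
    refine le_antisymm (by simpa using hy) (not_lt.1 fun hlt ↦ ht₁bad ?_)
    exact ⟨y, (hDr' y).2 hlt, hyt⟩
  set c : ℝ → Eu m := k ∘ γ with hc
  have hmaps : MapsTo γ (Icc 0 t₁) (N '' D) := by
    intro t ht
    rcases ht.2.lt_or_eq with hlt | rfl
    · exact image_mono hsub (hin t ⟨ht.1, hlt⟩)
    · exact ⟨y, hclosed hy, hyt⟩
  have hNc : ∀ t ∈ Icc 0 t₁, c t ∈ D ∧ N (c t) = γ t := by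
    intro t ht
    obtain ⟨x, hx, hxt⟩ := hmaps ht
    have : c t = x := by rw [hc, Function.comp_apply, ← hxt, hkN x hx]
    exact ⟨this ▸ hx, this ▸ hxt⟩
  have hcc : ContinuousOn c (Icc 0 t₁) :=
    hk.continuousOn.comp (hγ.continuousOn.mono hsubI) hmaps
  have hc1 : ContDiffOn ℝ 1 c (Ioo 0 t₁) := by
    intro t ht
    have h1 : ContMDiffAt 𝓘(ℝ, ℝ) (𝓡 m) 1 γ t :=
      hγ.contMDiffAt (Icc_mem_nhds ht.1 (ht.2.trans_le ht₁.2))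
    have h2 : ContMDiffAt (𝓡 m) (𝓡 m) 1 k (γ t) :=
      (hk.contMDiffAt (hop.mem_nhds (hmaps (Ioo_subset_Icc_self ht)))).of_le (by simp)
    exact (h2.comp t h1).contDiffAt.contDiffWithinAt
  have hc0 : c 0 = 0 := by
    rw [hc, Function.comp_apply, hγ0, ← h.zero, hkN 0 h0D]
  have hct₁ : ‖c t₁‖ = r := by
    rw [hc, Function.comp_apply, ← hyt, hkN y (hclosed hy), hyr]
  -- The norm is not differentiable at 0, so it is replaced by √(‖c‖² + ε²), which grows from ε to
  -- at least r; then ε tends to 0.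
  have hlen : ∀ ε > 0, ENNReal.ofReal (r - ε) ≤ ∫⁻ t in Ioo (0 : ℝ) 1,
      ENNReal.ofReal (tnorm g (γ t) (mfderiv 𝓘(ℝ, ℝ) (𝓡 m) γ t (1 : ℝ))) := by
    intro ε hε
    have hpos : ∀ x : Eu m, 0 < ‖x‖ ^ 2 + ε ^ 2 := fun x ↦ by positivity
    have hf1 : ContDiffOn ℝ 1 (fun t ↦ √(‖c t‖ ^ 2 + ε ^ 2)) (Ioo 0 t₁) :=
      ((hc1.norm_sq ℝ).add contDiffOn_const).sqrt fun t _ ↦ (hpos _).ne'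
    have hder : ∀ t ∈ Ioo 0 t₁, ‖deriv (fun t ↦ √(‖c t‖ ^ 2 + ε ^ 2)) t‖ₑ ≤
        ENNReal.ofReal (tnorm g (γ t) (mfderiv 𝓘(ℝ, ℝ) (𝓡 m) γ t (1 : ℝ))) := by
      intro t ht
      obtain ⟨hctD, -⟩ := hNc t (Ioo_subset_Icc_self ht)
      have hcd : DifferentiableAt ℝ c t :=
        (hc1.contDiffAt (isOpen_Ioo.mem_nhds ht)).differentiableAt one_ne_zero
      have e : γ =ᶠ[𝓝 t] N ∘ c := by
        filter_upwards [isOpen_Ioo.mem_nhds ht] with s hs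
        exact (hNc s (Ioo_subset_Icc_self hs)).2.symm
      rw [tnorm_comp_curve e (h.mdifferentiableAt hctD) hcd, ← ofReal_norm]
      refine ENNReal.ofReal_le_ofReal (Real.le_sqrt_of_sq_le ?_)
      have h1 : HasDerivAt (fun t ↦ √(‖c t‖ ^ 2 + ε ^ 2))
          (2 * inner ℝ (c t) (deriv c t) / (2 * √(‖c t‖ ^ 2 + ε ^ 2))) t :=
        (hcd.hasDerivAt.norm_sq.add_const _).sqrt (hpos _).ne'
      have h2 := form_apply_sq_le (fun a b ↦ h.pullbackForm_symm hg hctD a b)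
        (h.pullbackForm_nonneg hg hctD) (c t) (deriv c t)
      rw [h.gauss hg hctD, h.gauss hg hctD, real_inner_self_eq_norm_sq] at h2
      have h3 := h.pullbackForm_nonneg hg hctD (deriv c t)
      rw [h1.deriv, mul_div_mul_left _ _ two_ne_zero, Real.norm_eq_abs, sq_abs, div_pow,
        Real.sq_sqrt (hpos _).le, div_le_iff₀ (hpos _)]
      nlinarith [sq_nonneg ε, mul_nonneg h3 (sq_nonneg ε)]
    have h1 := enorm_sub_le_lintegral ht₁0
      ((((hcc.norm.pow 2).add continuousOn_const).sqrt)) hf1 hder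
    refine le_trans ?_ (h1.trans (MeasureTheory.lintegral_mono_set
      (Ioo_subset_Ioo le_rfl ht₁.2)))
    rw [← ofReal_norm]
    have h2 : r ≤ √(r ^ 2 + ε ^ 2) := Real.le_sqrt_of_sq_le (by nlinarith [sq_nonneg ε])
    have h3 : √(0 ^ 2 + ε ^ 2) = ε := by
      rw [zero_pow two_ne_zero, zero_add, Real.sqrt_sq hε.le]
    refine ENNReal.ofReal_le_ofReal (le_trans ?_ (Real.le_norm_self _))
    simp only [Pi.add_apply, Pi.pow_apply, hct₁, hc0, norm_zero, h3]
    linarith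
  have hlim : Filter.Tendsto (fun ε : ℝ ↦ ENNReal.ofReal (r - ε)) (𝓝[>] 0)
      (𝓝 (ENNReal.ofReal r)) := by
    have : Continuous fun ε : ℝ ↦ ENNReal.ofReal (r - ε) :=
      ENNReal.continuous_ofReal.comp (by fun_prop)
    have h1 := this.tendsto 0
    rw [sub_zero] at h1
    exact h1.mono_left nhdsWithin_le_nhds
  exact le_of_tendsto hlim (Filter.mem_of_superset self_mem_nhdsWithin hlen)

theorem IsNormalParam.geodDist_eq (hg : IsMetric ∞ U g) (h : IsNormalParam U g P N ρ)
    {x : Eu m} (hx : x ∈ enormBall (Eu m) ρ) : geodDist U g P (N x) = ‖x‖ₑ := by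
  refine le_antisymm (h.geodDist_le hg hx) (le_of_forall_lt fun s hs ↦ ?_)
  obtain ⟨r, hsr, hrx⟩ := ENNReal.lt_iff_exists_nnreal_btwn.1 hs
  have hr0 : 0 < (r : ℝ) := by
    have : (0 : ℝ≥0∞) < r := lt_of_le_of_lt zero_le hsr
    exact_mod_cast this
  have hrr : ENNReal.ofReal (r : ℝ) = r := ENNReal.ofReal_coe_nnreal
  refine hsr.trans_le ?_
  rw [← hrr]
  refine h.le_geodDist hg hr0 (by rw [hrr]; exact hrx.trans hx) ?_
  rintro ⟨y, hy, hyx⟩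
  rw [hrr] at hy
  have h1 := h.injOn (lt_trans hy (hrx.trans hx)) hx hyx
  rw [h1] at hy
  exact lt_asymm hrx hy

/-- A point outside the image has distance at least r for every r < ρ, hence at least ρ. -/
theorem IsNormalParam.geodBall_eq (hg : IsMetric ∞ U g) (h : IsNormalParam U g P N ρ) :
    geodBall U g P ρ = N '' enormBall (Eu m) ρ := by
  refine Subset.antisymm ?_ ?_
  · rintro Q ⟨-, hQ⟩
    obtain ⟨r, hQr, hr⟩ := ENNReal.lt_iff_exists_nnreal_btwn.1 hQ
    have hr0 : 0 < (r : ℝ) := by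
      have : (0 : ℝ≥0∞) < r := lt_of_le_of_lt zero_le hQr
      exact_mod_cast this
    have hrr : ENNReal.ofReal (r : ℝ) = r := ENNReal.ofReal_coe_nnreal
    by_contra hcon
    refine hQr.not_ge ?_
    rw [← hrr]
    refine h.le_geodDist hg hr0 (by rwa [hrr]) fun hmem ↦ hcon ?_
    rw [hrr] at hmem
    exact image_mono (fun x hx ↦ lt_trans hx hr) hmem
  · rintro _ ⟨x, hx, rfl⟩
    exact ⟨h.mem hx, (h.geodDist_le hg hx).trans_lt hx⟩

end Distance

/-! ### From smooth bundle metrics to metrics in charts -/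

section Metric

variable {m : ℕ} {M : Type*} [TopologicalSpace M] [ChartedSpace (Eu m) M] [IsManifold (𝓡 m) ∞ M]

/-- The coordinate vector field is the tangent map of the inverse chart applied to a constant
section. -/
theorem contMDiffAt_mfderiv_extChartAt_symm {n : WithTop ℕ∞} (hn : n + 1 ≤ n)
    [IsManifold (𝓡 m) n M] {p : M} {y : Eu m} (hy : y ∈ (extChartAt (𝓡 m) p).target) (a : Eu m) :
    ContMDiffAt (𝓡 m) (𝓡 m).tangent n (fun z ↦ (⟨(extChartAt (𝓡 m) p).symm z,
      mderiv (extChartAt (𝓡 m) p).symm z a⟩ : TangentBundle (𝓡 m) M)) y := by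
  have ho := isOpen_extChartAt_target (I := 𝓡 m) p
  have h1 := (contMDiffOn_extChartAt_symm (I := 𝓡 m) (n := n) p).contMDiffOn_tangentMapWithin hn
    ho.uniqueMDiffOn
  have h2 : ContMDiffAt (𝓡 m) (𝓡 m).tangent n
      (fun z ↦ (⟨z, a⟩ : TangentBundle (𝓡 m) (Eu m))) y :=
    contMDiffAt_vectorSpace_iff_contDiffAt.2 contDiffAt_const
  have h3 : ContMDiffAt (𝓡 m) (𝓡 m).tangent n
      (fun z ↦ tangentMapWithin (𝓡 m) (𝓡 m) (extChartAt (𝓡 m) p).symm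
        (extChartAt (𝓡 m) p).target (⟨z, a⟩ : TangentBundle (𝓡 m) (Eu m))) y :=
    ContMDiffAt.comp (g := tangentMapWithin (𝓡 m) (𝓡 m) (extChartAt (𝓡 m) p).symm
        (extChartAt (𝓡 m) p).target) y (h1.contMDiffAt ((ho.preimage
      (FiberBundle.continuous_proj _ _)).mem_nhds hy)) h2
  refine h3.congr_of_eventuallyEq ?_
  filter_upwards [ho.mem_nhds hy] with z hz
  simp only [tangentMapWithin, mfderivWithin_of_isOpen ho hz]
  rfl

theorem isMetric_univ {n : WithTop ℕ∞} (hn : n + 1 ≤ n) [IsManifold (𝓡 m) n M]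
    {g : FormField m M} (hsymm : ∀ (p : M) (a b : Eu m), formAt g p a b = formAt g p b a)
    (hpos : ∀ (p : M) (a : Eu m), a ≠ 0 → 0 < formAt g p a a)
    (hg : ContMDiff (𝓡 m) ((𝓡 m).prod 𝓘(ℝ, Eu m →L[ℝ] Eu m →L[ℝ] ℝ)) n
      (fun p : M ↦ TotalSpace.mk' (Eu m →L[ℝ] Eu m →L[ℝ] ℝ)
        (E := fun p : M ↦ TangentSpace (𝓡 m) p →L[ℝ] TangentSpace (𝓡 m) p →L[ℝ] ℝ) p (g p))) :
    IsMetric n univ g := by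
  refine ⟨isOpen_univ, fun p _ ↦ hsymm p, fun p _ ↦ hpos p, fun p a b y hy ↦ ?_⟩
  have hb : ContMDiffAt (𝓡 m) (𝓡 m) n (extChartAt (𝓡 m) p).symm y :=
    contMDiffAt_extChartAt_symm hy.1
  have this : ContMDiffAt (𝓡 m) ((𝓡 m).prod 𝓘(ℝ)) n
      (fun z ↦ TotalSpace.mk' ℝ (E := Bundle.Trivial M ℝ) ((extChartAt (𝓡 m) p).symm z)
        (g ((extChartAt (𝓡 m) p).symm z) (mderiv (extChartAt (𝓡 m) p).symm z a)
          (mderiv (extChartAt (𝓡 m) p).symm z b))) y := by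
    apply ContMDiffAt.clm_bundle_apply₂ (F₁ := Eu m) (F₂ := Eu m)
    · exact hg.contMDiffAt.comp y hb
    · exact contMDiffAt_mfderiv_extChartAt_symm hn hy.1 a
    · exact contMDiffAt_mfderiv_extChartAt_symm hn hy.1 b
  simp only [contMDiffAt_totalSpace] at this
  exact this.2.contDiffAt.contDiffWithinAt

theorem isMetric_inner (g : ContMDiffRiemannianMetric (𝓡 m) ∞ (Eu m)
    (fun p : M ↦ TangentSpace (𝓡 m) p)) : IsMetric ∞ univ g.inner :=
  isMetric_univ (by simp) (fun p a b ↦ g.symm p a b) (fun p a ha ↦ g.pos p a ha) g.contMDiff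

theorem isMetric_inner_of_isRealAnalytic (g : ContMDiffRiemannianMetric (𝓡 m) ∞ (Eu m)
    (fun p : M ↦ TangentSpace (𝓡 m) p)) (hg : IsRealAnalytic g.inner) :
    IsMetric ω univ g.inner :=
  have := hg.1
  isMetric_univ (by simp) (fun p a b ↦ g.symm p a b) (fun p a ha ↦ g.pos p a ha) hg.2

theorem formAt_conformal (ψ : M → ℝ) (g : FormField m M) (p : M) :
    formAt (conformal ψ g) p = (ψ p) ^ 2 • formAt g p := rfl

theorem pullbackForm_conformal (ψ : M → ℝ) (g : FormField m M) (N : Eu m → M) (x : Eu m) :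
    pullbackForm (conformal ψ g) N x = (ψ (N x)) ^ 2 • pullbackForm g N x := rfl

theorem IsMetric.conformal {U B : Set M} {g : FormField m M} (hg : IsMetric ∞ U g)
    (hB : IsOpen B) (hBU : B ⊆ U) {ψ : M → ℝ} (hψ : ContMDiffOn (𝓡 m) 𝓘(ℝ, ℝ) ∞ ψ B)
    (hpos : ∀ p ∈ B, 0 < ψ p) : IsMetric ∞ B (conformal ψ g) := by
  refine ⟨hB, fun p hp a b ↦ ?_, fun p hp a ha ↦ ?_, fun p a b y hy ↦ ?_⟩
  · rw [formAt_conformal, smul_apply, smul_apply, smul_apply, smul_apply, hg.symm p (hBU hp)]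
  · rw [formAt_conformal, smul_apply, smul_apply, smul_eq_mul]
    exact mul_pos (pow_pos (hpos p hp) 2) (hg.pos p (hBU hp) a ha)
  · have h1 : ContDiffAt ℝ ∞ (fun z ↦ ψ ((extChartAt (𝓡 m) p).symm z)) y :=
      ((hψ.contMDiffAt (hB.mem_nhds hy.2)).comp y (contMDiffAt_extChartAt_symm hy.1)).contDiffAt
    have h2 : ContDiffAt ℝ ∞ (fun z ↦ chartMetric g p z a b) y :=
      (hg.contDiffOn p a b).contDiffAt
        ((isOpen_chartDomain hg.isOpen p).mem_nhds ⟨hy.1, hBU hy.2⟩)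
    exact ((h1.pow 2).mul h2).contDiffWithinAt

end Metric

/-! ### The radial change of variables inverse to h -/

section RadialChange

/-- The change of variables `t ↦ t q(t)` is the inverse of `h`. -/
structure IsRadialChange (h q : ℝ → ℝ) (ρ R : ℝ≥0∞) : Prop where
  contDiffOn : ContDiffOn ℝ ∞ q (enormBall ℝ R)
  even : ∀ t ∈ enormBall ℝ R, q (-t) = q t
  pos : ∀ t ∈ enormBall ℝ R, 0 < q t
  mem : ∀ t ∈ enormBall ℝ R, t * q t ∈ enormBall ℝ ρ
  left : ∀ t ∈ enormBall ℝ R, h (t * q t) = t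
  right : ∀ r ∈ enormBall ℝ ρ, h r ∈ enormBall ℝ R ∧ h r * q (h r) = r
  deriv_mul : ∀ t ∈ enormBall ℝ R, deriv h (t * q t) * (q t + radialDeriv q t * t ^ 2) = 1
  zero : q 0 = 1

theorem hasDerivAt_mul_even {q : ℝ → ℝ} {R : ℝ≥0∞} (hq : ContDiffOn ℝ ∞ q (enormBall ℝ R))
    (he : ∀ t ∈ enormBall ℝ R, q (-t) = q t) {t : ℝ} (ht : t ∈ enormBall ℝ R) :
    HasDerivAt (fun t ↦ t * q t) (q t + radialDeriv q t * t ^ 2) t := by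
  have h1 : HasDerivAt q (deriv q t) t :=
    ((hq.contDiffAt ((isOpen_enormBall R).mem_nhds ht)).differentiableAt (by simp)).hasDerivAt
  rw [← mul_radialDeriv (deriv_zero_of_even (lt_of_le_of_lt zero_le ht) he)] at h1
  exact ((hasDerivAt_id t).mul h1).congr_deriv (by simp; ring)

/-- The inverse k of h is odd and increasing, so k(t) = t q(t) with q smooth, even and positive, and
q(0) = k'(0) = 1. -/
theorem exists_isRadialChange {h : ℝ → ℝ} {ρ : ℝ≥0∞} (hρ : 0 < ρ)
    (hc : ContDiffOn ℝ ∞ h (enormBall ℝ ρ)) (ho : ∀ t ∈ enormBall ℝ ρ, h (-t) = - h t)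
    (hd : ∀ t ∈ enormBall ℝ ρ, 0 < deriv h t) (h1 : deriv h 0 = 1) :
    ∃ R q, 0 < R ∧ IsRadialChange h q ρ R := by
  obtain ⟨R, k, hR, hk, -, hkl, hkr⟩ := exists_odd_inverse hρ hc ho hd
  have h0ρ : (0 : ℝ) ∈ enormBall ℝ ρ := zero_mem_enormBall hρ
  have h0R : (0 : ℝ) ∈ enormBall ℝ R := zero_mem_enormBall hR
  have h0 : h 0 = 0 := by
    have := ho 0 h0ρ
    rw [neg_zero] at this
    linarith
  have hk0 : k 0 = 0 := by
    have := (hkr 0 h0ρ).2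
    rwa [h0] at this
  have hmono := strictMonoOn_of_deriv_pos_enormBall (hc.differentiableOn (by simp)) hd
  have hmul : ∀ t, t * dslope k 0 t = k t := fun t ↦ by
    simpa [hk0] using sub_smul_dslope k 0 t
  have hkd : ∀ t ∈ enormBall ℝ R, HasDerivAt k (deriv k t) t := fun t ht ↦
    ((hk.contDiffAt ((isOpen_enormBall R).mem_nhds ht)).differentiableAt (by simp)).hasDerivAt
  have hprod : ∀ t ∈ enormBall ℝ R, deriv h (k t) * deriv k t = 1 := by
    intro t ht
    have h2 : HasDerivAt h (deriv h (k t)) (k t) :=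
      ((hc.contDiffAt ((isOpen_enormBall ρ).mem_nhds (hkl t ht).1)).differentiableAt
        (by simp)).hasDerivAt
    have h3 := h2.comp t (hkd t ht)
    have e : h ∘ k =ᶠ[𝓝 t] id := by
      filter_upwards [(isOpen_enormBall R).mem_nhds ht] with s hs using (hkl s hs).2
    exact (h3.congr_of_eventuallyEq e.symm).unique (hasDerivAt_id t)
  have hkpos : ∀ t ∈ enormBall ℝ R, 0 < t → 0 < k t := by
    intro t ht htpos
    by_contra hcon
    have h2 := hmono.le_iff_le (hkl t ht).1 h0ρ |>.2 (not_lt.1 hcon)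
    rw [(hkl t ht).2, h0] at h2
    linarith
  have hkodd : ∀ t ∈ enormBall ℝ R, k (-t) = - k t := by
    intro t ht
    have h2 : h (- k t) = -t := by rw [ho _ (hkl t ht).1, (hkl t ht).2]
    rw [← h2, (hkr _ (neg_mem_enormBall (hkl t ht).1)).2]
  have hd0 : dslope k 0 0 = 1 := by
    have := hprod 0 h0R
    rwa [hk0, h1, one_mul, ← dslope_same k 0] at this
  have hq : ContDiffOn ℝ ∞ (dslope k 0) (enormBall ℝ R) :=
    contDiffOn_dslope (Or.inl rfl) (isOpen_enormBall R) hk h0R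
  have heven : ∀ t ∈ enormBall ℝ R, dslope k 0 (-t) = dslope k 0 t := by
    intro t ht
    rcases eq_or_ne t 0 with rfl | hne
    · simp
    · have h2 := hmul (-t)
      rw [hkodd t ht, ← hmul t] at h2
      exact mul_left_cancel₀ hne (by linarith)
  have hqpos : ∀ t ∈ enormBall ℝ R, 0 ≤ t → 0 < dslope k 0 t := by
    intro t ht ht0
    rcases ht0.eq_or_lt with rfl | hlt
    · rw [hd0]
      exact one_pos
    · have h2 := hkpos t ht hlt
      rw [← hmul t] at h2
      exact pos_of_mul_pos_right h2 hlt.le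
  refine ⟨R, dslope k 0, hR, hq, heven, fun t ht ↦ ?_, fun t ht ↦ ?_, fun t ht ↦ ?_,
    fun r hr ↦ ⟨(hkr r hr).1, ?_⟩, fun t ht ↦ ?_, hd0⟩
  · rcases le_total 0 t with h2 | h2
    · exact hqpos t ht h2
    · rw [← heven t ht]
      exact hqpos _ (neg_mem_enormBall ht) (by linarith)
  · rw [hmul]
    exact (hkl t ht).1
  · rw [hmul]
    exact (hkl t ht).2
  · rw [hmul, (hkr r hr).2]
  · have h2 := hasDerivAt_mul_even hq heven ht
    simp only [hmul] at h2
    rw [← h2.deriv, hmul]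
    exact hprod t ht

variable {E : Type*} [NormedAddCommGroup E] [InnerProductSpace ℝ E] {h q : ℝ → ℝ} {ρ R : ℝ≥0∞}

/-- The radial map `x ↦ q(‖x‖) x`. -/
noncomputable def radialMap (q : ℝ → ℝ) (x : E) : E := q ‖x‖ • x

namespace IsRadialChange

theorem norm_radialMap (hq : IsRadialChange h q ρ R) {x : E} (hx : x ∈ enormBall E R) :
    ‖radialMap q x‖ = ‖x‖ * q ‖x‖ := by
  rw [radialMap, norm_smul, Real.norm_of_nonneg (hq.pos _ (norm_mem_enormBall.2 hx)).le, mul_comm]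

theorem radialMap_mem (hq : IsRadialChange h q ρ R) {x : E} (hx : x ∈ enormBall E R) :
    radialMap q x ∈ enormBall E ρ := by
  rw [← norm_mem_enormBall, hq.norm_radialMap hx]
  exact hq.mem _ (norm_mem_enormBall.2 hx)

theorem apply_norm_radialMap (hq : IsRadialChange h q ρ R) {x : E} (hx : x ∈ enormBall E R) :
    h ‖radialMap q x‖ = ‖x‖ := by
  rw [hq.norm_radialMap hx, hq.left _ (norm_mem_enormBall.2 hx)]

theorem injOn_radialMap (hq : IsRadialChange h q ρ R) :
    InjOn (radialMap q : E → E) (enormBall E R) := by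
  intro x hx y hy hxy
  have h1 : ‖x‖ = ‖y‖ := by
    rw [← hq.apply_norm_radialMap hx, ← hq.apply_norm_radialMap hy, hxy]
  rw [radialMap, radialMap, h1] at hxy
  exact smul_right_injective _ (hq.pos _ (norm_mem_enormBall.2 hy)).ne' hxy

theorem image_radialMap (hq : IsRadialChange h q ρ R) (hh : ∀ r ∈ enormBall ℝ ρ, 0 ≤ r → 0 ≤ h r) :
    radialMap q '' enormBall E R = enormBall E ρ := by
  refine Subset.antisymm (by rintro _ ⟨x, hx, rfl⟩; exact hq.radialMap_mem hx) fun y hy ↦ ?_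
  have hy' := norm_mem_enormBall.2 hy
  obtain ⟨h1, h2⟩ := hq.right _ hy'
  rcases eq_or_ne y 0 with rfl | hne
  · exact ⟨0, zero_mem_enormBall (lt_of_le_of_lt zero_le h1), by simp [radialMap]⟩
  have hnorm : ‖(h ‖y‖ / ‖y‖) • y‖ = h ‖y‖ := by
    rw [norm_smul, Real.norm_of_nonneg (div_nonneg (hh _ hy' (norm_nonneg _)) (norm_nonneg _)),
      div_mul_cancel₀ _ (norm_ne_zero_iff.2 hne)]
  refine ⟨(h ‖y‖ / ‖y‖) • y, ?_, ?_⟩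
  · rw [← norm_mem_enormBall, hnorm]
    exact h1
  · rw [radialMap, hnorm, smul_smul, mul_comm, div_mul_eq_mul_div, h2,
      div_self (norm_ne_zero_iff.2 hne), one_smul]

theorem hasFDerivAt (hq : IsRadialChange h q ρ R) {x : E} (hx : x ∈ enormBall E R) :
    HasFDerivAt (radialMap q) (radialMapDeriv q x) x :=
  hasFDerivAt_radialMap (hq.contDiffOn.differentiableOn (by simp)) hq.even hx

theorem contDiffAt_radialMap (hq : IsRadialChange h q ρ R) {x : E} (hx : x ∈ enormBall E R) :
    ContDiffAt ℝ ∞ (radialMap q : E → E) x :=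
  ((contDiffOn_radial (Or.inl rfl) hq.contDiffOn hq.even).contDiffAt
    ((isOpen_enormBall R).mem_nhds hx)).smul contDiffAt_id

/-- Pairing a kernel vector a with x gives (q + r q') ⟨x, a⟩ = 0, where q + r q' is the derivative
of the inverse of h and does not vanish. Then q a = 0. -/
theorem injective_radialMapDeriv (hq : IsRadialChange h q ρ R) {x : E} (hx : x ∈ enormBall E R) :
    Function.Injective (radialMapDeriv q x) := by
  have hx' := norm_mem_enormBall.2 hx
  refine (injective_iff_map_eq_zero _).2 fun a ha ↦ ?_
  have h1 : q ‖x‖ • a + (radialDeriv q ‖x‖ * inner ℝ x a) • x = 0 := by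
    simpa [radialMapDeriv] using ha
  have h2 : (q ‖x‖ + radialDeriv q ‖x‖ * ‖x‖ ^ 2) * inner ℝ x a = 0 := by
    have h3 := congrArg (fun v ↦ inner ℝ x v) h1
    simp only [inner_add_right, inner_smul_right, real_inner_self_eq_norm_sq, inner_zero_right]
      at h3
    linarith
  have h4 : inner ℝ x a = 0 := by
    refine (mul_eq_zero.1 h2).resolve_left fun h0 ↦ ?_
    have := hq.deriv_mul _ hx'
    rw [h0, mul_zero] at this
    exact zero_ne_one this
  rw [h4, mul_zero, zero_smul, add_zero] at h1
  exact (smul_eq_zero.1 h1).resolve_left (hq.pos _ hx').ne'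

end IsRadialChange

end RadialChange

/-! ### Gram determinants -/

theorem geodesicExpr_congr_form {E : Type*} [NormedAddCommGroup E] [NormedSpace ℝ E]
    {G G' : E → E →L[ℝ] E →L[ℝ] ℝ} {c : ℝ → E} {t : ℝ} (h : G =ᶠ[𝓝 (c t)] G') (w : E) :
    geodesicExpr G c t w = geodesicExpr G' c t w := by
  have h1 : ∀ a b : E, fderiv ℝ (fun z ↦ G z a b) (c t) = fderiv ℝ (fun z ↦ G' z a b) (c t) :=
    fun a b ↦ Filter.EventuallyEq.fderiv_eq (h.mono fun z hz ↦ by simp only [hz])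
  simp only [geodesicExpr, formChristoffel, h1, h.self_of_nhds]

/-- The Gram matrix of a bilinear form in the standard basis. -/
noncomputable def gram {m : ℕ} (B : Eu m →L[ℝ] Eu m →L[ℝ] ℝ) : Matrix (Fin m) (Fin m) ℝ :=
  Matrix.of fun i j ↦ B (EuclideanSpace.single i 1) (EuclideanSpace.single j 1)

theorem form_eq_sum {m : ℕ} (B : Eu m →L[ℝ] Eu m →L[ℝ] ℝ) (a b : Eu m) :
    B a b = ∑ i, ∑ j, a i * gram B i j * b j := by
  have h : ∀ v : Eu m, v = ∑ i, v i • EuclideanSpace.single i (1 : ℝ) := fun v ↦ by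
    ext i
    simp [Pi.single_apply]
  conv_lhs => rw [h a, h b]
  simp only [map_sum, sum_apply, map_smul, smul_apply, smul_eq_mul, gram, Matrix.of_apply]
  rw [Finset.sum_comm]
  refine Finset.sum_congr rfl fun i _ ↦ ?_
  try rw [Finset.mul_sum]
  refine Finset.sum_congr rfl fun j _ ↦ ?_
  ring

theorem gram_bilinearComp {m : ℕ} (B : Eu m →L[ℝ] Eu m →L[ℝ] ℝ) (D : Eu m →L[ℝ] Eu m) :
    gram (B.bilinearComp D D) = (Matrix.of fun i j ↦ D (EuclideanSpace.single j 1) i).transpose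
      * gram B * Matrix.of fun i j ↦ D (EuclideanSpace.single j 1) i := by
  ext i j
  have h : gram (B.bilinearComp D D) i j
      = B (D (EuclideanSpace.single i 1)) (D (EuclideanSpace.single j 1)) := rfl
  rw [h, form_eq_sum, Matrix.mul_apply, Finset.sum_comm]
  refine Finset.sum_congr rfl fun k _ ↦ ?_
  rw [Matrix.mul_apply, Finset.sum_mul]
  rfl

theorem det_gram_bilinearComp {m : ℕ} (B : Eu m →L[ℝ] Eu m →L[ℝ] ℝ) (D : Eu m →L[ℝ] Eu m) :
    (gram (B.bilinearComp D D)).det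
      = (Matrix.of fun i j ↦ D (EuclideanSpace.single j 1) i).det ^ 2 * (gram B).det := by
  rw [gram_bilinearComp, Matrix.det_mul, Matrix.det_mul, Matrix.det_transpose]
  ring

theorem gram_posDef {m : ℕ} {B : Eu m →L[ℝ] Eu m →L[ℝ] ℝ} (hs : ∀ a b, B a b = B b a)
    (hp : ∀ a, a ≠ 0 → 0 < B a a) : (gram B).PosDef := by
  refine Matrix.PosDef.of_dotProduct_mulVec_pos ?_ fun x hx ↦ ?_
  · ext i j
    simp [gram, Matrix.conjTranspose_apply, hs]
  · have h1 := hp (WithLp.toLp 2 x) (fun h ↦ hx (by simpa using h))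
    rw [form_eq_sum] at h1
    simp only [dotProduct, Matrix.mulVec, Pi.star_apply, star_trivial, Finset.mul_sum]
    simpa only [mul_assoc] using h1

/-! ### Geodesic coordinates of the conformal metric -/

section Conformal

variable {m : ℕ} {M : Type*} [TopologicalSpace M] [ChartedSpace (Eu m) M] [IsManifold (𝓡 m) ∞ M]
  [T2Space M]

variable {g : FormField m M} {P : M} {ρ R : ℝ≥0∞} {h q : ℝ → ℝ} {N : Eu m → M}

/-- The radial conformal factor with profile `f`. -/
noncomputable def radialFactor (g : FormField m M) (P : M) (f : ℝ → ℝ) (Q : M) : ℝ :=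
  f (geodDist univ g P Q).toReal

theorem IsNormalParam.radialFactor_eq (hg : IsMetric ∞ univ g) (hN : IsNormalParam univ g P N ρ)
    (f : ℝ → ℝ) {x : Eu m} (hx : x ∈ enormBall (Eu m) ρ) : radialFactor g P f (N x) = f ‖x‖ := by
  rw [radialFactor, hN.geodDist_eq hg hx, toReal_enorm]

/-- In the coordinates N the function is f(‖x‖), and N has a C^n inverse near each point of the
ball. -/
theorem IsNormalParam.contMDiffOn_radialFactor {n : WithTop ℕ∞}
    (hn : n = (∞ : WithTop ℕ∞) ∨ n = ω) [IsManifold (𝓡 m) n M] (hg : IsMetric ∞ univ g)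
    (hN : IsNormalParam univ g P N ρ)
    (hNn : ∀ x ∈ enormBall (Eu m) ρ, ContMDiffAt (𝓡 m) (𝓡 m) n N x) {f : ℝ → ℝ}
    (hf : ContDiffOn ℝ n f (enormBall ℝ ρ)) (he : ∀ t ∈ enormBall ℝ ρ, f (-t) = f t) :
    ContMDiffOn (𝓡 m) 𝓘(ℝ, ℝ) n (radialFactor g P f) (geodBall univ g P ρ) := by
  rw [hN.geodBall_eq hg]
  rintro _ ⟨x, hx, rfl⟩
  refine ContMDiffAt.contMDiffWithinAt ?_
  have hn0 : n ≠ 0 := (zero_lt_one.trans_le (one_le_of_infty_or_omega hn)).ne'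
  have hD := (isOpen_enormBall (E := Eu m) ρ).mem_nhds hx
  obtain ⟨hmap, -, -, hk⟩ := map_nhds_of_injective_mderiv hn0 (hNn x hx) (hN.injective_mderiv x hx)
  set k := Function.invFunOn N (enormBall (Eu m) ρ)
  have hkN : ∀ v ∈ enormBall (Eu m) ρ, k (N v) = v := fun v hv ↦ hN.injOn.leftInvOn_invFunOn hv
  have h1 := hk k (Filter.mem_of_superset hD hkN)
  have h2 : ContMDiffAt (𝓡 m) 𝓘(ℝ, ℝ) n (fun x : Eu m ↦ f ‖x‖) (k (N x)) := by
    rw [hkN x hx]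
    exact ((contDiffOn_radial hn hf he).contDiffAt hD).contMDiffAt
  refine (h2.comp (N x) h1).congr_of_eventuallyEq ?_
  change ∀ᶠ Q in 𝓝 (N x), _ = _
  rw [← hmap, Filter.eventually_map]
  filter_upwards [hD] with v hv
  rw [hN.radialFactor_eq hg f hv, Function.comp_apply, hkN v hv]

/-- The ray s ↦ s v in the new coordinates is the old ray at the radius whose h-value is s ‖v‖.
There the conformal factor h' makes the speed constant, which is the condition of
`geodesicExpr_conformal_ray`. -/
theorem IsNormalParam.conformal (hρ : 0 < ρ) (hg : IsMetric ∞ univ g)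
    (hN : IsNormalParam univ g P N ρ)
    (hc : ContDiffOn ℝ ∞ h (enormBall ℝ ρ)) (ho : ∀ t ∈ enormBall ℝ ρ, h (-t) = - h t)
    (hd : ∀ t ∈ enormBall ℝ ρ, 0 < deriv h t) (hR : 0 < R) (hq : IsRadialChange h q ρ R) :
    IsMetric ∞ (geodBall univ g P ρ)
      (RadialConformal.conformal (radialFactor g P (deriv h)) g) ∧
    IsNormalParam (geodBall univ g P ρ) (RadialConformal.conformal (radialFactor g P (deriv h)) g) P
      (N ∘ radialMap q) R := by
  have hdc : ContDiffOn ℝ ∞ (deriv h) (enormBall ℝ ρ) :=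
    contDiffOn_deriv (Or.inl rfl) (isOpen_enormBall ρ) hc
  have hde : ∀ t ∈ enormBall ℝ ρ, deriv h (-t) = deriv h t := fun t ht ↦ deriv_neg_of_odd ho ht
  have hball := hN.geodBall_eq hg
  have hψ := fun {x : Eu m} ↦ hN.radialFactor_eq hg (deriv h) (x := x)
  have hg' : IsMetric ∞ (geodBall univ g P ρ)
      (RadialConformal.conformal (radialFactor g P (deriv h)) g) := by
    refine hg.conformal (hball ▸ hN.isOpen_image) (subset_univ _)
      (hN.contMDiffOn_radialFactor (Or.inl rfl) hg (fun x hx ↦ hN.contMDiffAt hx) hdc hde) ?_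
    rw [hball]
    rintro _ ⟨x, hx, rfl⟩
    rw [hψ hx]
    exact hd _ (norm_mem_enormBall.2 hx)
  have h0R : (0 : Eu m) ∈ enormBall (Eu m) R := zero_mem_enormBall hR
  have h0ρ : (0 : Eu m) ∈ enormBall (Eu m) ρ := zero_mem_enormBall hρ
  have hκ0 : radialMap q (0 : Eu m) = 0 := by simp [radialMap]
  have hκd : ∀ x ∈ enormBall (Eu m) R, mderiv (N ∘ radialMap q) x
      = mderiv N (radialMap q x) ∘L radialMapDeriv q x := fun x hx ↦ by
    rw [mderiv_comp (hN.mdifferentiableAt (hq.radialMap_mem hx)) (hq.hasFDerivAt hx).differentiableAt,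
      (hq.hasFDerivAt hx).fderiv]
  refine ⟨hg', fun x hx ↦ ?_, fun x hx y hy hxy ↦ ?_, fun x hx ↦ ?_, ?_, fun a b ↦ ?_,
    fun v t ht ↦ ?_⟩
  · exact (ContMDiffAt.comp x (hN.contMDiffAt (hq.radialMap_mem hx))
      (hq.contDiffAt_radialMap hx).contMDiffAt).contMDiffWithinAt
  · exact hq.injOn_radialMap hx hy (hN.injOn (hq.radialMap_mem hx) (hq.radialMap_mem hy) hxy)
  · rw [hκd x hx]
    exact (hN.injective_mderiv _ (hq.radialMap_mem hx)).comp (hq.injective_radialMapDeriv hx)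
  · rw [Function.comp_apply, hκ0, hN.zero]
  · have h1 : radialMapDeriv q (0 : Eu m) = ContinuousLinearMap.id ℝ (Eu m) := by
      simp [radialMapDeriv, hq.zero]
    have h2 : deriv h 0 = 1 := by
      have := hq.deriv_mul 0 (zero_mem_enormBall hR)
      simpa [hq.zero] using this
    have h3 : radialFactor g P (deriv h) (N 0) = 1 := by rw [hψ h0ρ, norm_zero, h2]
    rw [← hN.ortho, pullbackForm_conformal, smul_apply, smul_apply, Function.comp_apply, hκ0, h3,
      one_pow, one_smul, pullbackForm_apply, pullbackForm_apply, hκd 0 h0R, hκ0, h1,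
      Function.comp_apply, hκ0]
    rfl
  · have hcurve : ∀ s, (N ∘ radialMap q) (s • v) = N ((q ‖s • v‖ * s) • v) := fun s ↦ by
      rw [Function.comp_apply, radialMap, smul_smul]
    have hnear : ∀ᶠ s : ℝ in 𝓝 t, s • v ∈ enormBall (Eu m) R := by
      have : ContinuousAt (fun s : ℝ ↦ s • v) t := by fun_prop
      exact this.preimage_mem_nhds ((isOpen_enormBall R).mem_nhds ht)
    have hu : ∀ s : ℝ, s • v ∈ enormBall (Eu m) R → s * ‖v‖ ∈ enormBall ℝ R := fun s hs ↦
      mem_enormBall_of_norm_le hs (by rw [norm_mul, norm_norm, norm_smul])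
    have hq' : ∀ s : ℝ, s • v ∈ enormBall (Eu m) R → q ‖s • v‖ = q (s * ‖v‖) := by
      intro s hs
      rw [norm_smul, Real.norm_eq_abs]
      rcases abs_choice s with h1 | h1 <;> rw [h1]
      rw [neg_mul, hq.even _ (hu s hs)]
    -- Since q is even, ‖s v‖ may be replaced by s ‖v‖, which is smooth across s = 0.
    set a : ℝ → ℝ := fun s ↦ q (s * ‖v‖) * s with ha
    have hNa : (fun s ↦ (N ∘ radialMap q) (s • v)) =ᶠ[𝓝 t] N ∘ fun s ↦ a s • v := by
      filter_upwards [hnear] with s hs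
      rw [hcurve, hq' s hs, Function.comp_apply]
    have hat : a t • v ∈ enormBall (Eu m) ρ := by
      have := hq.radialMap_mem ht
      rwa [radialMap, smul_smul, hq' t ht] at this
    have hda : ∀ s : ℝ, s • v ∈ enormBall (Eu m) R →
        HasDerivAt a (q (s * ‖v‖) + radialDeriv q (s * ‖v‖) * (s * ‖v‖) ^ 2) s := by
      intro s hs
      have h0 : deriv q 0 = 0 := deriv_zero_of_even hR hq.even
      have h1 : HasDerivAt q (deriv q (s * ‖v‖)) (s * ‖v‖) :=
        ((hq.contDiffOn.contDiffAt ((isOpen_enormBall R).mem_nhds (hu s hs))).differentiableAt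
          (by simp)).hasDerivAt
      rw [← mul_radialDeriv h0] at h1
      have h2 : HasDerivAt (fun s : ℝ ↦ s * ‖v‖) (1 * ‖v‖) s := (hasDerivAt_id s).mul_const _
      exact ((h1.comp s h2).mul (hasDerivAt_id s)).congr_deriv (by simp; ring)
    have haC : ContDiffAt ℝ 2 a t := by
      have h1 : ContDiffAt ℝ 2 q (t * ‖v‖) :=
        (hq.contDiffOn.contDiffAt ((isOpen_enormBall R).mem_nhds (hu t ht))).of_le two_le_infty
      have h2 : ContDiffAt ℝ 2 (fun s : ℝ ↦ s * ‖v‖) t := by fun_prop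
      exact (h1.comp t h2).mul contDiffAt_id
    have hfa : ∀ᶠ s in 𝓝 t, deriv h (a s * ‖v‖) * deriv a s = 1 := by
      filter_upwards [hnear] with s hs
      have e : a s * ‖v‖ = s * ‖v‖ * q (s * ‖v‖) := by simp only [ha]; ring
      rw [(hda s hs).deriv, e]
      exact hq.deriv_mul _ (hu s hs)
    refine GeodesicAt.congr ?_ hNa
    have hDt := (isOpen_enormBall ρ).mem_nhds hat
    have hNz : ∀ᶠ z in 𝓝 (a t • v), ContMDiffAt (𝓡 m) (𝓡 m) ∞ N z :=
      Filter.mem_of_superset hDt fun z hz ↦ hN.contMDiffAt hz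
    have hi := hN.injective_mderiv _ hat
    have hB : N (a t • v) ∈ geodBall univ g P ρ := hball ▸ mem_image_of_mem N hat
    have hcC : ContDiffAt ℝ 2 (fun s ↦ a s • v) t := haC.smul contDiffAt_const
    refine (geodesicAt_comp_iff (c := fun s ↦ a s • v) hg' (by simp) hNz hi hB hcC).2 fun w ↦ ?_
    have e : pullbackForm (RadialConformal.conformal (radialFactor g P (deriv h)) g) N
        =ᶠ[𝓝 (a t • v)] fun x ↦ (deriv h ‖x‖) ^ 2 • pullbackForm g N x := by
      filter_upwards [hDt] with x hx
      rw [pullbackForm_conformal, hψ hx]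
    rw [geodesicExpr_congr_form e]
    exact geodesicExpr_conformal_ray (fun x hx ↦ hN.differentiableAt_pullbackForm hg hx)
      (fun x hx ↦ hN.pullbackForm_symm hg hx) (hN.formChristoffel_eq_zero hg) hN.ortho hdc hde
      hat haC hfa w

end Conformal

/-! ### The volume density function and its radial profile -/

section Density

variable {m : ℕ} {M : Type*} [TopologicalSpace M] [ChartedSpace (Eu m) M]

theorem pullbackForm_congr {g : FormField m M} {N N' : Eu m → M} {x : Eu m} (h : N =ᶠ[𝓝 x] N') :
    pullbackForm g N x = pullbackForm g N' x := by
  have h1 : mderiv N x = mderiv N' x := h.mfderiv_eq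
  rw [pullbackForm, pullbackForm, h1, h.self_of_nhds]

theorem volDensity_eq (U : Set M) (g : FormField m M) (P : M) (e : Fin m → Eu m) (x : Eu m) :
    volDensity U g P e x = √(gram (pullbackForm g (normalCoord U g P e) x)).det := rfl

theorem gram_smul (c : ℝ) (B : Eu m →L[ℝ] Eu m →L[ℝ] ℝ) : gram (c • B) = c • gram B := rfl

theorem gram_inner {B : Eu m →L[ℝ] Eu m →L[ℝ] ℝ} (h : ∀ a b, B a b = inner ℝ a b) :
    gram B = 1 := by
  ext i j
  simp [gram, h, EuclideanSpace.inner_single_left, Matrix.one_apply]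

variable [IsManifold (𝓡 m) ∞ M] [T2Space M] {g : FormField m M} {P : M} {ρ R : ℝ≥0∞}
  {U : Set M}

theorem isNormalParam_normalCoord (hg : IsMetric ∞ U g) (hP : P ∈ U)
    (hρ : ρ ≤ injRadius U g P) {e : Fin m → Eu m} (he : IsFrameMap g P (frameMap e)) :
    IsNormalParam U g P (normalCoord U g P e) ρ := by
  rw [normalCoord_eq]
  exact isNormalParam_exp (Or.inl rfl) hg hP he hρ

theorem mderiv_normalCoord_zero (hg : IsMetric ∞ U g) (hP : P ∈ U) (e : Fin m → Eu m) :
    mderiv (normalCoord U g P e) 0 = frameMap e := by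
  have h0 := (expSmoothNear_zero (Or.inl rfl) hg hP).self_of_nhds.2.mdifferentiableAt (by simp)
  rw [← map_zero (frameMap e)] at h0
  rw [normalCoord_eq, mderiv_comp h0 (frameMap e).differentiableAt, (frameMap e).fderiv, map_zero,
    mderiv_expE_zero (Or.inl rfl) hg hP, ContinuousLinearMap.id_comp]

theorem contMDiffAt_normalCoord {n : WithTop ℕ∞} (hn : n = (∞ : WithTop ℕ∞) ∨ n = ω)
    [IsManifold (𝓡 m) n M] (hg : IsMetric n U g) (hP : P ∈ U) (hρ : ρ ≤ injRadius U g P)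
    {e : Fin m → Eu m} (he : IsFrameMap g P (frameMap e)) {x : Eu m}
    (hx : x ∈ enormBall (Eu m) ρ) : ContMDiffAt (𝓡 m) (𝓡 m) n (normalCoord U g P e) x := by
  have h1 := (isInjRadius_injRadius U g P).1 _ (he.mem_tangentBall.2 (lt_of_lt_of_le hx hρ))
  have h2 := (h1.expSmoothNear hn hg hP).self_of_nhds.2
  rw [normalCoord_eq]
  exact h2.comp x (frameMap e).contDiff.contDiffAt.contMDiffAt

theorem exists_isOrthoFrame (hg : IsMetric ∞ U g) (hP : P ∈ U) :
    ∃ e : Fin m → Eu m, IsOrthoFrame g P e ∧ IsFrameMap g P (frameMap e) := by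
  obtain ⟨L, hL⟩ := exists_isFrameMap hg hP
  exact ⟨_, hL.isOrthoFrame, by rwa [frameMap_of_linear]⟩

theorem smul_single_mem_enormBall {t : ℝ} (ht : t ∈ enormBall ℝ ρ) (i : Fin m) :
    t • (EuclideanSpace.single i 1 : Eu m) ∈ enormBall (Eu m) ρ :=
  mem_enormBall_of_norm_le ht (by simp [norm_smul])

/-- The profile of a radial density is the density along an axis. -/
theorem radial_profile_eq [NeZero m] {F : Eu m → ℝ} {η : ℝ → ℝ}
    (he : ∀ t ∈ enormBall ℝ ρ, η (-t) = η t) (hF : ∀ x ∈ enormBall (Eu m) ρ, F x = η ‖x‖) {t : ℝ}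
    (ht : t ∈ enormBall ℝ ρ) : F (t • EuclideanSpace.single 0 1) = η t := by
  rw [hF _ (smul_single_mem_enormBall ht 0), norm_smul, PiLp.norm_single, norm_one,
    mul_one, Real.norm_eq_abs]
  rcases abs_choice t with h | h <;> rw [h]
  exact he t ht

theorem IsNormalParam.det_gram_pos {N : Eu m → M} (hg : IsMetric ∞ U g)
    (hN : IsNormalParam U g P N ρ) {x : Eu m} (hx : x ∈ enormBall (Eu m) ρ) :
    0 < (gram (pullbackForm g N x)).det :=
  (gram_posDef (fun a b ↦ hN.pullbackForm_symm hg hx a b)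
    fun _ ha ↦ hN.pullbackForm_pos hg hx ha).det_pos

theorem radial_profile_pos [NeZero m] (hg : IsMetric ∞ U g) (hP : P ∈ U) (hρ0 : 0 < ρ)
    (hρ : ρ ≤ injRadius U g P) {η : ℝ → ℝ} (he : ∀ t ∈ enormBall ℝ ρ, η (-t) = η t)
    (hη : ∀ e, IsOrthoFrame g P e → ∀ x ∈ enormBall (Eu m) ρ, volDensity U g P e x = η ‖x‖) :
    (∀ t ∈ enormBall ℝ ρ, 0 < η t) ∧ η 0 = 1 := by
  obtain ⟨e, heo, hef⟩ := exists_isOrthoFrame hg hP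
  have hN := isNormalParam_normalCoord hg hP hρ hef
  constructor
  · intro t ht
    rw [← radial_profile_eq he (hη e heo) ht, volDensity_eq]
    exact Real.sqrt_pos.2 (hN.det_gram_pos hg (smul_single_mem_enormBall ht 0))
  · have h1 := hη e heo 0 (zero_mem_enormBall hρ0)
    rw [norm_zero, volDensity_eq, gram_inner hN.ortho, Matrix.det_one, Real.sqrt_one] at h1
    exact h1.symm

theorem contDiffAt_det {X : Type*} [NormedAddCommGroup X] [NormedSpace ℝ X] {n : WithTop ℕ∞}
    {A : X → Matrix (Fin m) (Fin m) ℝ} {x : X} (hA : ∀ i j, ContDiffAt ℝ n (fun z ↦ A z i j) x) :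
    ContDiffAt ℝ n (fun z ↦ (A z).det) x := by
  simp only [Matrix.det_apply']
  exact ContDiffAt.sum fun σ _ ↦ contDiffAt_const.mul (contDiffAt_prod fun i _ ↦ hA _ _)

/-- Central harmonicity provides only a smooth η. For an analytic metric the geodesic coordinates
are analytic on the whole ball, so the density along an axis, the root of a positive determinant, is
analytic too. -/
theorem contDiffOn_radial_profile [NeZero m] {n : WithTop ℕ∞}
    (hn : n = (∞ : WithTop ℕ∞) ∨ n = ω) [IsManifold (𝓡 m) n M] (hg : IsMetric ∞ U g)
    (hgn : IsMetric n U g) (hP : P ∈ U)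
    (hρ : ρ ≤ injRadius U g P) {η : ℝ → ℝ} (he : ∀ t ∈ enormBall ℝ ρ, η (-t) = η t)
    (hη : ∀ e, IsOrthoFrame g P e → ∀ x ∈ enormBall (Eu m) ρ, volDensity U g P e x = η ‖x‖) :
    ContDiffOn ℝ n η (enormBall ℝ ρ) := by
  obtain ⟨e, heo, hef⟩ := exists_isOrthoFrame hg hP
  have hN := isNormalParam_normalCoord hg hP hρ hef
  have key : ContDiffOn ℝ n (fun t : ℝ ↦ volDensity U g P e (t • EuclideanSpace.single 0 1))
      (enormBall ℝ ρ) := by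
    intro t ht
    have hx := smul_single_mem_enormBall (m := m) ht 0
    have h1 : ContDiffAt ℝ n (fun x ↦ (gram (pullbackForm g (normalCoord U g P e) x)).det)
        (t • EuclideanSpace.single 0 1) :=
      contDiffAt_det fun i j ↦ contDiffAt_pullbackForm hn hgn (hN.mem hx)
        (Filter.mem_of_superset ((isOpen_enormBall ρ).mem_nhds hx)
          fun z hz ↦ contMDiffAt_normalCoord hn hgn hP hρ hef hz) _ _
    have h2 : ContDiffAt ℝ n (fun t : ℝ ↦ t • (EuclideanSpace.single 0 1 : Eu m)) t := by fun_prop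
    have h3 : ContDiffAt ℝ n (fun t : ℝ ↦ (gram (pullbackForm g (normalCoord U g P e)
        (t • EuclideanSpace.single 0 1))).det) t :=
      ContDiffAt.comp (g := fun x ↦ (gram (pullbackForm g (normalCoord U g P e) x)).det) t h1 h2
    exact (h3.sqrt (hN.det_gram_pos hg hx).ne').contDiffWithinAt
  exact key.congr fun t ht ↦ (radial_profile_eq he (hη e heo) ht).symm

/-- If the injectivity radius exceeded R, a vector of norm between the two would be mapped into U,
which is already the image of the ball of radius R. This contradicts injectivity. -/
theorem IsNormalParam.injRadius_eq_of_image_eq [NeZero m] {N : Eu m → M} (hg : IsMetric ∞ U g)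
    (hP : P ∈ U) (hN : IsNormalParam U g P N R) (hU : N '' enormBall (Eu m) R = U) :
    injRadius U g P = R := by
  refine le_antisymm (not_lt.1 fun hlt ↦ ?_) (hN.le_injRadius (Or.inl rfl) hg)
  have hN' := isNormalParam_exp (Or.inl rfl) hg hP hN.isFrameMap le_rfl
  obtain ⟨r, hRr, hr⟩ := ENNReal.lt_iff_exists_nnreal_btwn.1 hlt
  have hx : ‖((r : ℝ) • EuclideanSpace.single 0 1 : Eu m)‖ₑ = r := by
    rw [← ofReal_norm, norm_smul, PiLp.norm_single, norm_one, mul_one,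
      Real.norm_of_nonneg r.coe_nonneg, ENNReal.ofReal_coe_nnreal]
  have hxm : ((r : ℝ) • EuclideanSpace.single 0 1 : Eu m) ∈ enormBall (Eu m) (injRadius U g P) := by
    change ‖((r : ℝ) • EuclideanSpace.single 0 1 : Eu m)‖ₑ < _
    rwa [hx]
  obtain ⟨y, hy, hyx⟩ := hU.ge (hN'.mem hxm)
  have h2 := (hN.hasGeod_and_expE (Or.inl rfl) hg hy).2
  have h3 := hN'.injOn (lt_trans hy hlt) hxm (h2.trans hyx)
  rw [h3] at hy
  have h4 : ‖((r : ℝ) • EuclideanSpace.single 0 1 : Eu m)‖ₑ < R := hy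
  rw [hx] at h4
  exact lt_asymm h4 hRr

end Density

/-! ### The prescribed density -/

section Prescribe

variable {l : ℕ} {M : Type*} [TopologicalSpace M] [ChartedSpace (Eu (l + 1)) M]
  [IsManifold (𝓡 (l + 1)) ∞ M] [T2Space M] {g : FormField (l + 1) M} {P : M} {ρ : ℝ≥0∞}
  {η Ξ h : ℝ → ℝ}

/-- With τ = ‖x‖ q(‖x‖), so that h(τ) = ‖x‖, the new density at x is h'(τ)^(l+1) · det Dκ(x) · η(τ),
and the profile equation at τ says that this is Ξ(‖x‖). The last claim keeps the new distances
within the values of h, hence in the domain of Ξ. -/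
theorem prescribesDensity_of_isProfile (hg : IsMetric ∞ univ g) (hρ0 : 0 < ρ)
    (hρ : ρ ≤ injRadius univ g P)
    (hη : ∀ e, IsOrthoFrame g P e → ∀ x ∈ enormBall (Eu (l + 1)) ρ,
      volDensity univ g P e x = η ‖x‖) (hη0 : η 0 = 1) (hΞ0 : Ξ 0 = 1)
    (hh : IsProfile l η Ξ ρ h) :
    PrescribesDensity g P ρ Ξ (radialFactor g P (deriv h)) ∧
      ∀ Q ∈ geodBall univ g P ρ, ∃ t ∈ enormBall ℝ ρ, geodDist (geodBall univ g P ρ)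
        (conformal (radialFactor g P (deriv h)) g) P Q = ‖h t‖ₑ := by
  obtain ⟨R, q, hR, hq⟩ := exists_isRadialChange hρ0 hh.contDiffOn hh.odd hh.deriv_pos
    hh.deriv_zero
  have hdc : ContDiffOn ℝ ∞ (deriv h) (enormBall ℝ ρ) :=
    contDiffOn_deriv (Or.inl rfl) (isOpen_enormBall ρ) hh.contDiffOn
  have hde : ∀ t ∈ enormBall ℝ ρ, deriv h (-t) = deriv h t := fun t ht ↦
    deriv_neg_of_odd hh.odd ht
  have h0ρ : (0 : Eu (l + 1)) ∈ enormBall (Eu (l + 1)) ρ := zero_mem_enormBall hρ0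
  have h0R : (0 : Eu (l + 1)) ∈ enormBall (Eu (l + 1)) R := zero_mem_enormBall hR
  have hnonneg : ∀ r ∈ enormBall ℝ ρ, 0 ≤ r → 0 ≤ h r := fun r hr hr0 ↦ by
    have h1 := (strictMonoOn_of_deriv_pos_enormBall (hh.contDiffOn.differentiableOn (by simp))
      hh.deriv_pos).monotoneOn (zero_mem_enormBall hρ0) hr hr0
    have h2 := hh.odd 0 (zero_mem_enormBall hρ0)
    rw [neg_zero] at h2
    linarith
  have hframe : ∀ e : Fin (l + 1) → Eu (l + 1), IsFrameMap g P (frameMap e) →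
      IsNormalParam univ g P (normalCoord univ g P e) ρ := fun e he ↦
    isNormalParam_normalCoord hg (mem_univ P) hρ he
  obtain ⟨e₀, he₀o, he₀⟩ := exists_isOrthoFrame hg (mem_univ P)
  have hN₀ := hframe e₀ he₀
  have hB := hN₀.geodBall_eq hg
  obtain ⟨hg', hN₀'⟩ := hN₀.conformal hρ0 hg hh.contDiffOn hh.odd hh.deriv_pos hR hq
  set ψ := radialFactor g P (deriv h) with hψ
  set B := geodBall univ g P ρ with hBdef
  have himage : ∀ N : Eu (l + 1) → M, (N ∘ radialMap q) '' enormBall (Eu (l + 1)) R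
      = N '' enormBall (Eu (l + 1)) ρ := fun N ↦ by
    rw [image_comp, hq.image_radialMap hnonneg]
  have hPB : P ∈ B := by
    rw [hB]
    exact ⟨0, h0ρ, hN₀.zero⟩
  have hinj : injRadius B (conformal ψ g) P = R :=
    hN₀'.injRadius_eq_of_image_eq hg' hPB ((himage _).trans hB.symm)
  have hψP : ψ P = 1 := by
    have h1 := hN₀.radialFactor_eq hg (deriv h) h0ρ
    rwa [hN₀.zero, norm_zero, hh.deriv_zero] at h1
  have hball : geodBall B (conformal ψ g) P R = B := by
    rw [hN₀'.geodBall_eq hg', himage, hB]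
  refine ⟨⟨?_, ?_, ?_, ?_, ?_⟩, ?_⟩
  · exact hN₀.contMDiffOn_radialFactor (Or.inl rfl) hg (fun x hx ↦ hN₀.contMDiffAt hx) hdc hde
  · rw [← hBdef, hB]
    rintro _ ⟨x, hx, rfl⟩
    rw [hψ, hN₀.radialFactor_eq hg (deriv h) hx]
    exact hh.deriv_pos _ (norm_mem_enormBall.2 hx)
  · refine ⟨deriv h, hdc, hde, fun e he x hx ↦ ?_⟩
    exact (hframe e (isFrameMap_frameMap he)).radialFactor_eq hg (deriv h) hx
  · rw [hinj, hball]
  · rw [hinj]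
    suffices key : ∀ e : Fin (l + 1) → Eu (l + 1), IsOrthoFrame (conformal ψ g) P e →
        ∀ x ∈ enormBall (Eu (l + 1)) R, volDensity B (conformal ψ g) P e x
          = Ξ (geodDist B (conformal ψ g) P (normalCoord B (conformal ψ g) P e x)).toReal from key
    intro e he x hx
    have hfc : IsFrameMap (conformal ψ g) P (frameMap e) := isFrameMap_frameMap he
    -- The two metrics agree at P because ψ(P) = h'(0) = 1, so they have the same orthonormal
    -- frames.
    have hf : IsFrameMap g P (frameMap e) := fun a b ↦ by
      have h1 := hfc a b
      rwa [formAt_conformal, hψP, one_pow, one_smul] at h1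
    have heo : IsOrthoFrame g P e := by
      have h1 : (fun i ↦ frameMap e (EuclideanSpace.single i 1)) = e :=
        funext (frameMap_single e)
      exact h1 ▸ hf.isOrthoFrame
    have hN := hframe e hf
    have hN0 := mderiv_normalCoord_zero hg (mem_univ P) e
    have hNη := hη e heo
    simp only [volDensity_eq] at hNη
    generalize normalCoord univ g P e = N at hN hN0 hNη
    obtain ⟨-, hN'⟩ := hN.conformal hρ0 hg hh.contDiffOn hh.odd hh.deriv_pos hR hq
    have hκd : ∀ x ∈ enormBall (Eu (l + 1)) R, mderiv (N ∘ radialMap q) x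
        = mderiv N (radialMap q x) ∘L radialMapDeriv q x := fun x hx ↦ by
      rw [mderiv_comp (hN.mdifferentiableAt (hq.radialMap_mem hx))
        (hq.hasFDerivAt hx).differentiableAt, (hq.hasFDerivAt hx).fderiv]
    have hL : mderiv (N ∘ radialMap q) 0 = frameMap e := by
      have h1 : radialMap q (0 : Eu (l + 1)) = 0 := by simp [radialMap]
      have h2 : radialMapDeriv q (0 : Eu (l + 1)) = ContinuousLinearMap.id ℝ _ := by
        simp [radialMapDeriv, hq.zero]
      rw [hκd 0 h0R, h1, h2, hN0, ContinuousLinearMap.comp_id]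
    have hcoord : EqOn (normalCoord B (conformal ψ g) P e) (N ∘ radialMap q)
        (enormBall (Eu (l + 1)) R) := by
      intro y hy
      have h1 := (hN'.hasGeod_and_expE (Or.inl rfl) hg' hy).2
      rw [hL] at h1
      rw [normalCoord_eq]
      exact h1
    have hev : normalCoord B (conformal ψ g) P e =ᶠ[𝓝 x] N ∘ radialMap q :=
      Filter.mem_of_superset ((isOpen_enormBall R).mem_nhds hx) hcoord
    have hx' := norm_mem_enormBall.2 hx
    have hκx := hq.radialMap_mem hx
    have hpb : pullbackForm g (N ∘ radialMap q) x = (pullbackForm g N (radialMap q x)).bilinearComp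
        (radialMapDeriv q x) (radialMapDeriv q x) := by
      ext a b
      rw [pullbackForm_apply, hκd x hx]
      rfl
    have hdist : geodDist B (conformal ψ g) P (normalCoord B (conformal ψ g) P e x) = ‖x‖ₑ := by
      rw [hcoord hx]
      exact hN'.geodDist_eq hg' hx
    have hτ : ‖radialMap q x‖ = ‖x‖ * q ‖x‖ := hq.norm_radialMap hx
    have hηx : √(gram (pullbackForm g N (radialMap q x))).det = η (‖x‖ * q ‖x‖) := by
      rw [← hτ, hNη _ hκx]
    have hψx : ψ ((N ∘ radialMap q) x) = deriv h (‖x‖ * q ‖x‖) := by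
      rw [← hτ]
      exact hN.radialFactor_eq hg (deriv h) hκx
    have hqx := hq.pos _ hx'
    have hτm := hq.mem _ hx'
    have hdh := hh.deriv_pos _ hτm
    have hmul := hq.deriv_mul _ hx'
    have hdet : (0 : ℝ) < q ‖x‖ + radialDeriv q ‖x‖ * ‖x‖ ^ 2 :=
      pos_of_mul_pos_right (hmul ▸ one_pos) hdh.le
    rw [hdist, toReal_enorm, volDensity_eq, pullbackForm_congr hev, pullbackForm_conformal, hpb,
      hψx, gram_smul, Matrix.det_smul, Fintype.card_fin, det_gram_bilinearComp,
      det_radialMapDeriv q x hqx.ne', ← mul_assoc, Real.sqrt_mul (by positivity), hηx]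
    -- One factor h'(τ) cancels against q + r q', as h and t q(t) are inverse to each other.
    have hsq : √((deriv h (‖x‖ * q ‖x‖) ^ 2) ^ (l + 1)
        * (q ‖x‖ ^ l * (q ‖x‖ + radialDeriv q ‖x‖ * ‖x‖ ^ 2)) ^ 2)
        = deriv h (‖x‖ * q ‖x‖) ^ l * q ‖x‖ ^ l := by
      rw [← pow_mul, mul_comm 2 (l + 1), pow_mul, ← mul_pow, Real.sqrt_sq (by positivity)]
      linear_combination deriv h (‖x‖ * q ‖x‖) ^ l * q ‖x‖ ^ l * hmul
    rw [hsq]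
    have hden := hh.density _ hτm
    rw [hq.left _ hx', mul_pow] at hden
    -- The profile equation carries the factor ‖x‖^l, which can be cancelled away from the origin
    -- only; at the origin both densities are 1.
    rcases eq_or_ne ‖x‖ 0 with h0 | h0
    · rw [h0, zero_mul, hq.zero, hh.deriv_zero, hη0, hΞ0]
      simp
    · have h0' : ‖x‖ ^ l ≠ 0 := pow_ne_zero _ h0
      refine mul_right_cancel₀ h0' ?_
      rw [← hden]
      ring
  · intro Q hQ
    rw [hB, ← himage] at hQ
    obtain ⟨x, hx, rfl⟩ := hQ
    refine ⟨‖x‖ * q ‖x‖, hq.mem _ (norm_mem_enormBall.2 hx), ?_⟩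
    rw [hq.left _ (norm_mem_enormBall.2 hx), hN₀'.geodDist_eq hg' hx, enorm_norm]

theorem contMDiffOn_radialFactor_deriv {n : WithTop ℕ∞} (hn : n = (∞ : WithTop ℕ∞) ∨ n = ω)
    [IsManifold (𝓡 (l + 1)) n M] (hg : IsMetric ∞ univ g) (hgn : IsMetric n univ g)
    (hρ : ρ ≤ injRadius univ g P) (hc : ContDiffOn ℝ n h (enormBall ℝ ρ))
    (ho : ∀ t ∈ enormBall ℝ ρ, h (-t) = - h t) :
    ContMDiffOn (𝓡 (l + 1)) 𝓘(ℝ, ℝ) n (radialFactor g P (deriv h)) (geodBall univ g P ρ) := by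
  obtain ⟨e, -, he⟩ := exists_isOrthoFrame hg (mem_univ P)
  exact (isNormalParam_normalCoord hg (mem_univ P) hρ he).contMDiffOn_radialFactor hn hg
    (fun x hx ↦ contMDiffAt_normalCoord hn hgn (mem_univ P) hρ he hx)
    (contDiffOn_deriv hn (isOpen_enormBall ρ) hc) fun t ht ↦ deriv_neg_of_odd ho ht

end Prescribe

/-! ### Conclusion -/

theorem enormBall_ofReal {δ : ℝ} (hδ : 0 < δ) : enormBall ℝ (ENNReal.ofReal δ) = Ioo (-δ) δ := by
  ext t
  change ‖t‖ₑ < ENNReal.ofReal δ ↔ _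
  rw [← ofReal_norm, ENNReal.ofReal_lt_ofReal_iff hδ, Real.norm_eq_abs, abs_lt]
  rfl

theorem exists_contDiffOn_omega {Ξ : ℝ → ℝ} (h : AnalyticAt ℝ Ξ 0) :
    ∃ δ > 0, ContDiffOn ℝ ω Ξ (Ioo (-δ) δ) := by
  obtain ⟨δ, hδ, hb⟩ := Metric.eventually_nhds_iff_ball.1 h.eventually_analyticAt
  refine ⟨δ, hδ, fun t ht ↦ (hb t ?_).contDiffAt.contDiffWithinAt⟩
  rw [Metric.mem_ball, dist_zero_right, Real.norm_eq_abs, abs_lt]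
  exact ht

end RadialConformal

theorem theorem1p2 {m : ℕ} (hm : 4 ≤ m) {M : Type*} [TopologicalSpace M] [T2Space M]
    [SecondCountableTopology M] [ConnectedSpace M] [ChartedSpace (Eu m) M]
    [IsManifold (𝓡 m) ∞ M]
    (g : ContMDiffRiemannianMetric (𝓡 m) ∞ (Eu m)
      (fun p : M ↦ TangentSpace (𝓡 m) p))
    (P : M) :
    (IsCentralHarmonicGerm univ g.inner P →
      ∀ (Ξ : ℝ → ℝ) (δ : ℝ), 0 < δ → ContDiffOn ℝ ∞ Ξ (Ioo (-δ) δ) →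
        (∀ t ∈ Ioo (-δ) δ, 0 < Ξ t) → (∀ t ∈ Ioo (-δ) δ, Ξ (-t) = Ξ t) → Ξ 0 = 1 →
        ∃ ρ : ℝ≥0∞, 0 < ρ ∧ ρ ≤ injRadius univ g.inner P ∧
          ∃ ψ : M → ℝ, PrescribesDensity g.inner P ρ Ξ ψ ∧
            (∀ Q ∈ geodBall univ g.inner P ρ,
              geodDist (geodBall univ g.inner P ρ) (conformal ψ g.inner) P Q < ENNReal.ofReal δ) ∧
            (IsRealAnalytic g.inner → AnalyticAt ℝ Ξ 0 →
              ContMDiffOn (𝓡 m) 𝓘(ℝ, ℝ) ω ψ (geodBall univ g.inner P ρ))) ∧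
    (IsCentralHarmonic univ g.inner P →
      ∃ ψ : M → ℝ,
        PrescribesDensity g.inner P
          (injRadius univ g.inner P) (fun _ ↦ 1) ψ ∧
        (IsRealAnalytic g.inner →
          ContMDiffOn (𝓡 m) 𝓘(ℝ, ℝ) ω ψ
            (geodBall univ g.inner P
              (injRadius univ g.inner P)))) := by
  obtain ⟨l, rfl⟩ : ∃ l, m = l + 1 := ⟨m - 1, by omega⟩
  -- The equation for the profile is solved by taking l-th roots.
  have hl : l ≠ 0 := by omega
  have hg := isMetric_inner g
  have hι : 0 < injRadius univ g.inner P := injRadius_pos (Or.inl rfl) hg (mem_univ P)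
  constructor
  · rintro ⟨ρ₀, hρ₀, η, hη, hηe, hηv⟩ Ξ δ hδ hΞ hΞpos hΞe hΞ0
    -- Analyticity of Ξ at 0 holds on some smaller interval only. The interval is chosen before ψ is
    -- built, because one ψ must serve for the smooth and the analytic claims.
    obtain ⟨δ', hδ', hδδ, hΞω⟩ : ∃ δ' > 0, δ' ≤ δ ∧
        (AnalyticAt ℝ Ξ 0 → ContDiffOn ℝ ω Ξ (Ioo (-δ') δ')) := by
      by_cases hA : AnalyticAt ℝ Ξ 0
      · obtain ⟨δ₁, hδ₁, h⟩ := exists_contDiffOn_omega hA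
        exact ⟨min δ δ₁, lt_min hδ hδ₁, min_le_left _ _, fun _ ↦ h.mono
          (Ioo_subset_Ioo (neg_le_neg (min_le_right _ _)) (min_le_right _ _))⟩
      · exact ⟨δ, hδ, le_rfl, fun h ↦ absurd h hA⟩
    have hsub : Ioo (-δ') δ' ⊆ Ioo (-δ) δ := Ioo_subset_Ioo (neg_le_neg hδδ) hδδ
    -- The radius in the hypothesis on the germ is not bounded by the injectivity radius.
    set ρ₁ := min ρ₀ (injRadius univ g.inner P) with hρ₁
    have hρ₁0 : 0 < ρ₁ := lt_min hρ₀ hι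
    have hρ₁ι : ρ₁ ≤ injRadius univ g.inner P := min_le_right _ _
    have hball : enormBall ℝ ρ₁ ⊆ enormBall ℝ ρ₀ := fun t ht ↦
      (show ‖t‖ₑ < ρ₁ from ht).trans_le (min_le_left _ _)
    have hηe₁ : ∀ t ∈ enormBall ℝ ρ₁, η (-t) = η t := fun t ht ↦ hηe t (hball ht)
    have hηv₁ : ∀ e, IsOrthoFrame g.inner P e → ∀ x ∈ enormBall (Eu (l + 1)) ρ₁,
        volDensity univ g.inner P e x = η ‖x‖ := fun e he x hx ↦
      hηv e he x (lt_of_lt_of_le hx (min_le_left _ _))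
    obtain ⟨hηpos, hη0⟩ := radial_profile_pos hg (mem_univ P) hρ₁0 hρ₁ι hηe₁ hηv₁
    obtain ⟨ρ, hρ0, hρ, h, hh, hhδ, hhω⟩ := exists_isProfile hρ₁0 (ENNReal.ofReal_pos.2 hδ') hl
      (hη.mono hball) hηe₁ hηpos hη0 (by rw [enormBall_ofReal hδ']; exact hΞ.mono hsub)
      (by rw [enormBall_ofReal hδ']; exact fun t ht ↦ hΞe t (hsub ht))
      (by rw [enormBall_ofReal hδ']; exact fun t ht ↦ hΞpos t (hsub ht)) hΞ0
    have hρι := hρ.trans hρ₁ι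
    obtain ⟨hpres, hdist⟩ := prescribesDensity_of_isProfile hg hρ0 hρι
      (fun e he x hx ↦ hηv₁ e he x (lt_of_lt_of_le hx hρ)) hη0 hΞ0 hh
    refine ⟨ρ, hρ0, hρι, _, hpres, fun Q hQ ↦ ?_, fun hA hΞA ↦ ?_⟩
    · obtain ⟨t, ht, htQ⟩ := hdist Q hQ
      rw [htQ]
      exact lt_of_lt_of_le (hhδ t ht) (ENNReal.ofReal_le_ofReal hδδ)
    · have := hA.1
      have hgω := isMetric_inner_of_isRealAnalytic g hA
      exact contMDiffOn_radialFactor_deriv (Or.inr rfl) hg hgω hρι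
        (hhω (contDiffOn_radial_profile (Or.inr rfl) hg hgω (mem_univ P) hρ₁ι hηe₁ hηv₁)
          (by rw [enormBall_ofReal hδ']; exact hΞω hΞA)) hh.odd
  · rintro ⟨η, hη, hηe, hηv⟩
    obtain ⟨hηpos, hη0⟩ := radial_profile_pos hg (mem_univ P) hι le_rfl hηe hηv
    -- For Ξ = 1 the profile lives on the full injectivity ball, so no radius is lost.
    obtain ⟨h, hh, hhω⟩ := exists_isProfile_one hι hl hη hηe hηpos hη0
    refine ⟨_, (prescribesDensity_of_isProfile hg hι le_rfl hηv hη0 rfl hh).1, fun hA ↦ ?_⟩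
    have := hA.1
    have hgω := isMetric_inner_of_isRealAnalytic g hA
    exact contMDiffOn_radialFactor_deriv (Or.inr rfl) hg hgω le_rfl
      (hhω (contDiffOn_radial_profile (Or.inr rfl) hg hgω (mem_univ P) le_rfl hηe hηv)) hh.odd
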